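/- Let $\mathcal L=\{1,\dots,L\}$ (users) and $\mathcal K=\{1,\dots,K\}$ (relays), let $\mathcal X_l$ ($l\in\mathcal L$) and $\mathcal Y_k$ ($k\in\mathcal K$) be finite alphabets, let $p(y_{\mathcal K}|x_{\mathcal L})$ be an arbitrary discrete memoryless channel from $\prod_l\mathcal X_l$ to $\prod_k\mathcal Y_k$, and let relay $k$ be connected to a central processor (CP) by an error-free link of capacity $C_k$. Logarithms are to base 2. A code of blocklength $n$ with $M_l\ge 1$ messages for user $l$ (with oblivious relaying and enabled time-sharing) consists of: a finite alphabet $\mathcal Q$ with a pmf $p_Q$ and pmfs $p_{X_l|Q}$; encoders $\phi_l:[1,|\mathcal X_l|^{nM_l}]\times[1,M_l]\times\mathcal Q^n\to\mathcal X_l^n$ such that, for every $q^n$, the index $F_l\in[1,|\mathcal X_l|^{nM_l}]$ runs exactly once over all codebooks $(\phi_l(F_l,m,q^n))_{m}\in(\mathcal X_l^n)^{M_l}$; relay maps $\phi^r_k:\mathcal Y_k^n\times\mathcal Q^n\to[1,\lfloor 2^{nC_k}\rfloor]$; and a decoder $g$ that maps $(F_{\mathcal L},J_{\mathcal K},Q^n)$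 to a tuple of messages. The time-sharing sequence $Q^n$ is i.i.d. with law $p_Q$ and known to all terminals; the messages $m_l$ are independent and uniform on $[1,M_l]$, and independent of $(Q^n,F_{\mathcal L})$; given $Q^n=q^n$ the indices $F_l$ are independent, with $\Pr\{F_l=f\mid q^n\}=\prod_{m}\prod_{i=1}^n p_{X_l|Q}(\phi_{l,i}(f,m,q^n)|q_i)$; user $l$ sends $\phi_l(F_l,m_l,Q^n)$ over the channel; relay $k$ does not know $F_{\mathcal L}$ and sends $J_k=\phi_k^r(Y_k^n,Q^n)$ to the CP, which outputs $g(F_{\mathcal L},J_{\mathcal K},Q^n)$. A rate tuple $(R_1,\dots,R_L)$ is achievable if for every $\epsilon>0$ and every sufficiently large $n$ there is such a code with $M_l\ge\lfloor 2^{nR_l}\rfloor$ for all $l$ and with $\Pr\{(\hat m_1,\dots,\hat m_L)\ne(m_1,\dots,m_L)\}\le\epsilon$. **Theorem.** If $(R_1,\dots,R_L)$ is achievable, then there are random variables $(Q,X_{\mathcal L},Y_{\mathcal K},U_{\mathcal K},W)$, with $Q$ taking finitely many values and $W,U_1,\dots,U_K$ taking values in standard Borel spaces, distributed according to $$p(q)\prod_{l=1}^L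 p(x_l|q)\;p(y_{\mathcal K}|x_{\mathcal L})\;p(w|q),\qquad U_k=f_k(W,Y_k,Q),\quad k\in\mathcal K,$$ for some (measurable) deterministic functions $f_k$, such that for all $\mathcal T\subseteq\mathcal L$ and all $\mathcal S\subseteq\mathcal K$ $$\sum_{t\in\mathcal T}R_t\;\le\;\sum_{s\in\mathcal S}C_s\;-\;I(Y_{\mathcal S};U_{\mathcal S}\,|\,X_{\mathcal L},U_{\mathcal S^c},Q)\;+\;I(X_{\mathcal T};U_{\mathcal S^c}\,|\,X_{\mathcal T^c},Q).$$ -/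

import Mathlib

open MeasureTheory

noncomputable section

namespace CRAN

/-! ### Conditional entropy and conditional mutual information (in bits) -/

/-- `H(A | Z)` in bits, for a random variable `A` with finitely many values and an arbitrary
random variable `Z`: the expected Shannon entropy of the conditional law of `A` given `Z`. -/
def condEntropy {Ω α γ : Type*} [MeasurableSpace Ω] [Fintype α] [MeasurableSpace γ]
    (μ : Measure Ω) (A : Ω → α) (Z : Ω → γ) : ℝ :=
  (∫ ω, ∑ a, Real.negMulLog
    ((μ[(A ⁻¹' {a}).indicator (fun _ => (1 : ℝ)) |
      MeasurableSpace.comap Z inferInstance]) ω) ∂μ) / Real.log 2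

/-- `I(A ; B | Z) = H(A | Z) - H(A | B, Z)` in bits, for a random variable `A` with finitely many
values and arbitrary random variables `B` and `Z`. -/
def condMutualInfo {Ω α β γ : Type*} [MeasurableSpace Ω] [Fintype α]
    [MeasurableSpace β] [MeasurableSpace γ]
    (μ : Measure Ω) (A : Ω → α) (B : Ω → β) (Z : Ω → γ) : ℝ :=
  condEntropy μ A Z - condEntropy μ A (fun ω => (B ω, Z ω))

/-! ### Codes with oblivious relay processing and enabled time-sharing -/

/-- A code of blocklength `n` with `M l` messages for user `l`, over input alphabets `𝒳 l`, output
alphabets `𝒴 k` and fronthaul capacities `C k`. -/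
structure Code {L K : ℕ} (𝒳 : Fin L → Type*) [∀ l, Fintype (𝒳 l)] (𝒴 : Fin K → Type*)
    (C : Fin K → ℝ) (n : ℕ) (M : Fin L → ℕ) where
  /-- every user has at least one message -/
  M_pos : ∀ l, 0 < M l
  /-- the size of the time-sharing alphabet -/
  nQ : ℕ
  /-- the pmf `p(q)` of one letter of the time-sharing sequence -/
  pQ : Fin nQ → ℝ
  pQ_mem : pQ ∈ stdSimplex ℝ (Fin nQ)
  /-- the pmfs `p(x_l | q)` -/
  pX : ∀ l, Fin nQ → 𝒳 l → ℝ
  pX_mem : ∀ l q, pX l q ∈ stdSimplex ℝ (𝒳 l)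
  /-- the encoders: codebook index, message and time-sharing sequence give a codeword -/
  enc : ∀ l, Fin (Fintype.card (𝒳 l) ^ (n * M l)) → Fin (M l) → (Fin n → Fin nQ) → Fin n → 𝒳 l
  /-- the codebook index runs over all possible codebooks -/
  enc_bijective : ∀ l (q : Fin n → Fin nQ),
    Function.Bijective (fun (f : Fin (Fintype.card (𝒳 l) ^ (n * M l))) (m : Fin (M l)) =>
      enc l f m q)
  /-- the relays: received sequence and time-sharing sequence give a fronthaul index -/
  relay : ∀ k, (Fin n → 𝒴 k) → (Fin n → Fin nQ) → Fin ⌊(2 : ℝ) ^ ((n : ℝ) * C k)⌋₊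
  /-- the decoder: codebook indices, fronthaul indices and time-sharing sequence -/
  dec : (∀ l, Fin (Fintype.card (𝒳 l) ^ (n * M l))) →
    (∀ k, Fin ⌊(2 : ℝ) ^ ((n : ℝ) * C k)⌋₊) → (Fin n → Fin nQ) → ∀ l, Fin (M l)

namespace Code

variable {L K : ℕ} {𝒳 : Fin L → Type*} [∀ l, Fintype (𝒳 l)] {𝒴 : Fin K → Type*}
  [∀ k, Fintype (𝒴 k)] {C : Fin K → ℝ} {n : ℕ} {M : Fin L → ℕ}

/-- The probability that user `l` selects the codebook of index `f` when the time-sharing sequence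
is `q`: all `M l` codewords are drawn independently with law `∏ i, p(x_i | q_i)`. -/
def codebookProb (c : Code 𝒳 𝒴 C n M) (l : Fin L)
    (f : Fin (Fintype.card (𝒳 l) ^ (n * M l))) (q : Fin n → Fin c.nQ) : ℝ :=
  ∏ m, ∏ i, c.pX l (q i) (c.enc l f m q i)

/-- The probability that the decoded message tuple differs from the sent one over the memoryless
channel `ch`, for uniform independent messages. -/
def errorProb (c : Code 𝒳 𝒴 C n M) (ch : (∀ l, 𝒳 l) → (∀ k, 𝒴 k) → ℝ) : ℝ :=
  ∑ q : Fin n → Fin c.nQ, ∑ f : (∀ l, Fin (Fintype.card (𝒳 l) ^ (n * M l))),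
    ∑ m : (∀ l, Fin (M l)), ∑ y : Fin n → (∀ k, 𝒴 k),
      (∏ i, c.pQ (q i)) * (∏ l, c.codebookProb l (f l) q) * (∏ l, ((M l : ℝ))⁻¹) *
        (∏ i, ch (fun l => c.enc l (f l) (m l) q i) (y i)) *
        (if c.dec f (fun k => c.relay k (fun i => y i k) q) q = m then 0 else 1)

end Code

/-- The rate tuple `R` is achievable over the channel `ch` with fronthaul capacities `C`: for every
`ε > 0` and all large blocklengths there is a code with at least `⌊2 ^ (n R l)⌋` messages for every
user `l` whose error probability is at most `ε`. -/
def Achievable {L K : ℕ} {𝒳 : Fin L → Type*} [∀ l, Fintype (𝒳 l)] {𝒴 : Fin K → Type*}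
    [∀ k, Fintype (𝒴 k)] (ch : (∀ l, 𝒳 l) → (∀ k, 𝒴 k) → ℝ) (C : Fin K → ℝ)
    (R : Fin L → ℝ) : Prop :=
  ∀ ε : ℝ, 0 < ε → ∃ n₀ : ℕ, ∀ n : ℕ, n₀ ≤ n →
    ∃ (M : Fin L → ℕ) (c : Code 𝒳 𝒴 C n M),
      (∀ l, ⌊(2 : ℝ) ^ ((n : ℝ) * R l)⌋₊ ≤ M l) ∧ c.errorProb ch ≤ ε

/-! ### The single-letter random variables of the outer bound -/

/-- The free data of a joint law `p(q) ∏ p(x_l | q) p(y | x) p(w | q)` with `u_k = f_k(w, y_k, q)`: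
everything but the channel `p(y | x)`. -/
structure Aux {L K : ℕ} (𝒳 : Fin L → Type*) [∀ l, Fintype (𝒳 l)] (𝒴 : Fin K → Type*) where
  /-- the size of the alphabet of `Q` -/
  nQ : ℕ
  /-- `p(q)` -/
  pQ : Fin nQ → ℝ
  pQ_mem : pQ ∈ stdSimplex ℝ (Fin nQ)
  /-- `p(x_l | q)` -/
  pX : ∀ l, Fin nQ → 𝒳 l → ℝ
  pX_mem : ∀ l q, pX l q ∈ stdSimplex ℝ (𝒳 l)
  /-- the alphabet of `W` -/
  W : Type
  [measW : MeasurableSpace W]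
  [borelW : StandardBorelSpace W]
  /-- the law of `W` given `Q = q` -/
  pW : Fin nQ → Measure W
  [probW : ∀ q, IsProbabilityMeasure (pW q)]
  /-- the alphabet of `U_k` -/
  U : Fin K → Type
  [measU : ∀ k, MeasurableSpace (U k)]
  [borelU : ∀ k, StandardBorelSpace (U k)]
  /-- the deterministic functions `f_k` -/
  f : ∀ k, W → 𝒴 k → Fin nQ → U k
  measurable_f : ∀ k y q, Measurable (fun w => f k w y q)

attribute [instance] Aux.measW Aux.borelW Aux.probW Aux.measU Aux.borelU

namespace Aux

variable {L K : ℕ} {𝒳 : Fin L → Type*} [∀ l, Fintype (𝒳 l)] {𝒴 : Fin K → Type*}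

/-- The sample space, whose points are the values `(q, x, y, w)`. -/
abbrev Ω (a : Aux 𝒳 𝒴) : Type _ := Fin a.nQ × (∀ l, 𝒳 l) × (∀ k, 𝒴 k) × a.W

/-- The joint law `p(q) ∏ p(x_l | q) p(y | x) p(w | q)` of `(Q, X, Y, W)`. -/
def law [∀ l, MeasurableSpace (𝒳 l)] [∀ k, Fintype (𝒴 k)] [∀ k, MeasurableSpace (𝒴 k)]
    (a : Aux 𝒳 𝒴) (ch : (∀ l, 𝒳 l) → (∀ k, 𝒴 k) → ℝ) : Measure a.Ω :=
  ∑ q, ∑ x : (∀ l, 𝒳 l), ∑ y : (∀ k, 𝒴 k),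
    ENNReal.ofReal (a.pQ q * (∏ l, a.pX l q (x l)) * ch x y) •
      (a.pW q).map (fun w => (q, x, y, w))

/-- The random variable `Q`. -/
def Qvar (a : Aux 𝒳 𝒴) : a.Ω → Fin a.nQ := fun ω => ω.1

/-- The random variables `X_T = (X_l)_{l ∈ T}`. -/
def Xvar (a : Aux 𝒳 𝒴) (T : Finset (Fin L)) : a.Ω → (∀ l : T, 𝒳 l) := fun ω l => ω.2.1 l

/-- The random variables `Y_S = (Y_k)_{k ∈ S}`. -/
def Yvar (a : Aux 𝒳 𝒴) (S : Finset (Fin K)) : a.Ω → (∀ k : S, 𝒴 k) := fun ω k => ω.2.2.1 k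

/-- The random variables `U_S = (U_k)_{k ∈ S}`, where `U_k = f_k(W, Y_k, Q)`. -/
def Uvar (a : Aux 𝒳 𝒴) (S : Finset (Fin K)) : a.Ω → (∀ k : S, a.U k) :=
  fun ω k => a.f k ω.2.2.2 (ω.2.2.1 k) ω.1

end Aux

end CRAN

end

/-!
# An outer bound for oblivious relaying with enabled time-sharing

*From codes to single letters.* Fano's inequality bounds the rates of a code by multi-letter
entropies. Obliviousness enters in `Code.sum_weight`: averaged over the codebook index, the
transmitted letters are independent over time given the time-sharing sequence, so that the relays
act on a memoryless source `(Q^n, X^n, Y^n)`. The chain rules `input_info_le` and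
`output_info_le` split the multi-letter entropies over time; the time-sharing sequence, the inputs
at the other times and the earlier outputs (`past`) become the time-sharing variable of the letter
at time `i`, and the later outputs, whose law given the past does not involve the letter
(`sum_resample`), become the private randomness `W`. This proves the bounds up to a slack that
tends to `0`, for an average over a time-sharing alphabet that grows with `n`.

*Removing the slack.* The alphabets of `W` and `U_k` grow with `n` too, so no compactness is
available for the variables themselves. The bounds depend, however, only on the posteriors of
`(X, Y)` given `U_A`, for the coalitions `A` of relays. Since `U_k` is a function of `W` and `Y_k`,
the value of `W` determines a `Table`, which assigns a posterior to the outputs `y_A` of every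
coalition, and the bounds are continuous in the input laws and in the law of the table. Tables form
a compact space, so their laws do, and to consist of posteriors is a closed condition
(`consistentConfigs`). The bound vectors of consistent configurations are thus a compact set, and so
is its convex hull by Carathéodory's theorem. Hence a single finite average satisfies all the bounds
without slack (`exists_mem_convexHull_ge`).

*Back to deterministic relay functions.* A consistent law of a table has to come from some
`U_k = f_k(W, Y_k)` whose coalitions learn exactly the posterior that the table assigns to their
outputs. A private simultaneous message scheme achieves this: `W` consists of the table, of random
permutations of the output alphabets and of random masks in the circle group. Every relay sends the
masked and permuted table, the permuted label of its output, and its masks for the entries with that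
label. The coalition `A` can unmask the entry at `y_A` (`decodeMessages_messages`), while the law of
its messages depends on nothing but the entries at `y_B` for `B ⊆ A` (`messageAverage_congr`), and
consistency says that these carry no further information on `(X, Y)` (`messages_posterior`).
-/

set_option linter.unusedSectionVars false

noncomputable section

namespace CRAN

/-! ### Entropy of finite random variables -/

section FiniteEntropy

variable {Ω Ω' Θ α α' β γ : Type*} [Fintype Ω] [Fintype Ω'] [Fintype Θ]

open scoped Classical in
/-- The mass that the weight `p` gives to the event `A = a`. -/
def pr (p : Ω → ℝ) (A : Ω → α) (a : α) : ℝ := ∑ ω, if A ω = a then p ω else 0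

/-- The entropy `H(A)` in nats under the weight `p`, written as the expectation of
`-log P(A)` so that no finiteness of the target of `A` is needed. -/
def ent (p : Ω → ℝ) (A : Ω → α) : ℝ := -∑ ω, p ω * Real.log (pr p A (A ω))

/-- The conditional entropy `H(A | B) = H(A, B) - H(B)` in nats under the weight `p`. -/
def cent (p : Ω → ℝ) (A : Ω → α) (B : Ω → β) : ℝ := ent p (fun ω => (A ω, B ω)) - ent p B

theorem pr_nonneg {p : Ω → ℝ} (hp : ∀ ω, 0 ≤ p ω) (A : Ω → α) (a : α) : 0 ≤ pr p A a := by
  unfold pr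
  refine Finset.sum_nonneg fun ω _ => ?_
  split_ifs
  exacts [hp ω, le_rfl]

theorem le_pr {p : Ω → ℝ} (hp : ∀ ω, 0 ≤ p ω) (A : Ω → α) (ω : Ω) : p ω ≤ pr p A (A ω) := by
  classical
  unfold pr
  have := Finset.single_le_sum (s := Finset.univ)
    (f := fun ω' => if A ω' = A ω then p ω' else 0)
    (fun ω' _ => by split_ifs; exacts [hp ω', le_rfl]) (Finset.mem_univ ω)
  simpa using this

theorem pr_pos {p : Ω → ℝ} (hp : ∀ ω, 0 ≤ p ω) (A : Ω → α) {ω : Ω} (h : 0 < p ω) :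
    0 < pr p A (A ω) := h.trans_le (le_pr hp A ω)

theorem pr_le_pr_of_imp {p : Ω → ℝ} (hp : ∀ ω, 0 ≤ p ω) {A : Ω → α} {B : Ω → β} {a : α} {b : β}
    (h : ∀ ω, A ω = a → B ω = b) : pr p A a ≤ pr p B b := by
  classical
  unfold pr
  refine Finset.sum_le_sum fun ω _ => ?_
  by_cases hA : A ω = a
  · simp [hA, h ω hA]
  · rw [if_neg hA]
    split_ifs
    exacts [hp ω, le_rfl]

theorem pr_congr_iff {p : Ω → ℝ} {A : Ω → α} {B : Ω → β} {a : α} {b : β}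
    (h : ∀ ω, A ω = a ↔ B ω = b) : pr p A a = pr p B b := by
  classical
  unfold pr
  exact Finset.sum_congr rfl fun ω _ => by simp [h ω]

theorem sum_mul_comp [Fintype α] (p : Ω → ℝ) (A : Ω → α) (φ : α → ℝ) :
    ∑ ω, p ω * φ (A ω) = ∑ a, pr p A a * φ a := by
  classical
  unfold pr
  simp_rw [Finset.sum_mul]
  rw [Finset.sum_comm]
  refine Finset.sum_congr rfl fun ω _ => ?_
  simp [ite_mul]

theorem ent_eq_sum_negMulLog (p : Ω → ℝ) (A : Ω → α) [Fintype α] :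
    ent p A = ∑ a, Real.negMulLog (pr p A a) := by
  unfold ent
  rw [sum_mul_comp p A (fun a => Real.log (pr p A a)), ← Finset.sum_neg_distrib]
  exact Finset.sum_congr rfl fun a _ => by rw [Real.negMulLog]; ring

theorem continuous_pr (A : Ω → α) (a : α) : Continuous fun p : Ω → ℝ => pr p A a := by
  classical
  unfold pr
  refine continuous_finsetSum _ fun ω _ => ?_
  split_ifs
  exacts [continuous_apply ω, continuous_const]

theorem continuous_ent (A : Ω → α) : Continuous fun p : Ω → ℝ => ent p A := by
  classical
  -- only the values in the finite range of `A` matter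
  have h : ∀ p : Ω → ℝ, ent p A = ent p (fun ω => (⟨A ω, ω, rfl⟩ : Set.range A)) := by
    intro p
    unfold ent
    congr 1
    refine Finset.sum_congr rfl fun ω _ => ?_
    congr 2
    exact pr_congr_iff fun ω' => Subtype.mk_eq_mk.symm
  have : Fintype (Set.range A) := Fintype.ofFinite _
  simp_rw [h, ent_eq_sum_negMulLog]
  exact continuous_finsetSum _ fun a _ => Real.continuous_negMulLog.comp (continuous_pr _ a)

theorem continuous_cent (A : Ω → α) (B : Ω → β) : Continuous fun p : Ω → ℝ => cent p A B :=
  (continuous_ent _).sub (continuous_ent _)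

/-- Entropy depends only on the law. -/
theorem ent_congr_law {p : Ω → ℝ} {p' : Ω' → ℝ} {A : Ω → α} {A' : Ω' → α}
    (h : ∀ φ : α → ℝ, ∑ ω, p ω * φ (A ω) = ∑ ω, p' ω * φ (A' ω)) : ent p A = ent p' A' := by
  classical
  have hpr : ∀ a, pr p A a = pr p' A' a := by
    intro a
    have := h (fun x => if x = a then 1 else 0)
    simpa [pr] using this
  unfold ent
  rw [h (fun a => Real.log (pr p A a))]
  simp_rw [hpr]

theorem cent_congr_law {p : Ω → ℝ} {p' : Ω' → ℝ} {A : Ω → α} {A' : Ω' → α} {B : Ω → β}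
    {B' : Ω' → β}
    (h : ∀ φ : α → β → ℝ, ∑ ω, p ω * φ (A ω) (B ω) = ∑ ω, p' ω * φ (A' ω) (B' ω)) :
    cent p A B = cent p' A' B' := by
  unfold cent
  congr 1
  · exact ent_congr_law fun φ => h fun a b => φ (a, b)
  · exact ent_congr_law fun φ => h fun _ b => φ b

/-- Entropy depends only on the partition that the random variable induces. -/
theorem ent_congr_iff (p : Ω → ℝ) {A : Ω → α} {B : Ω → β}
    (h : ∀ ω ω', A ω = A ω' ↔ B ω = B ω') : ent p A = ent p B := by
  unfold ent
  congr 1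
  exact Finset.sum_congr rfl fun ω _ => by rw [pr_congr_iff fun ω' => h ω' ω]

theorem cent_congr_iff (p : Ω → ℝ) {A : Ω → α} {A' : Ω → α'} {B : Ω → β} {C : Ω → γ}
    (hB : ∀ ω ω', B ω = B ω' ↔ C ω = C ω')
    (hA : ∀ ω ω', B ω = B ω' → (A ω = A ω' ↔ A' ω = A' ω')) :
    cent p A B = cent p A' C := by
  unfold cent
  congr 1
  · refine ent_congr_iff p fun ω ω' => ?_
    simp only [Prod.mk.injEq]
    rw [← hB]
    exact and_congr_left fun h => hA ω ω' h
  · exact ent_congr_iff p hB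

theorem ent_mono {p : Ω → ℝ} (hp : ∀ ω, 0 ≤ p ω) {A : Ω → α} {B : Ω → β}
    (h : ∀ ω ω', A ω = A ω' → B ω = B ω') : ent p B ≤ ent p A := by
  unfold ent
  refine neg_le_neg (Finset.sum_le_sum fun ω _ => ?_)
  rcases (hp ω).eq_or_lt with h0 | h0
  · simp [← h0]
  · exact mul_le_mul_of_nonneg_left
      (Real.log_le_log (pr_pos hp A h0) (pr_le_pr_of_imp hp fun ω' => h ω' ω)) (hp ω)

theorem cent_nonneg {p : Ω → ℝ} (hp : ∀ ω, 0 ≤ p ω) (A : Ω → α) (B : Ω → β) :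
    0 ≤ cent p A B :=
  sub_nonneg.2 (ent_mono hp fun _ _ h => (Prod.mk.inj h).2)

theorem cent_chain (p : Ω → ℝ) (A : Ω → α) (A' : Ω → α') (B : Ω → β) :
    cent p (fun ω => (A ω, A' ω)) B = cent p A B + cent p A' (fun ω => (A ω, B ω)) := by
  have : ent p (fun ω => ((A ω, A' ω), B ω)) = ent p (fun ω => (A' ω, A ω, B ω)) :=
    ent_congr_iff p fun ω ω' => by simp only [Prod.mk.injEq]; tauto
  unfold cent
  rw [this]
  ring

/-- Gibbs' inequality: the cross entropy with respect to any conditional subprobability `q(a | b)`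
bounds the conditional entropy. -/
theorem cent_le_crossEntropy [Fintype α] {p : Ω → ℝ} (hp : ∀ ω, 0 ≤ p ω) (hp1 : ∑ ω, p ω = 1)
    (A : Ω → α) (B : Ω → β) (q : α → β → ℝ) (hq0 : ∀ a b, 0 ≤ q a b)
    (hq : ∀ ω, 0 < p ω → 0 < q (A ω) (B ω)) (hs : ∀ ω, ∑ a, q a (B ω) ≤ 1) :
    cent p A B ≤ -∑ ω, p ω * Real.log (q (A ω) (B ω)) := by
  classical
  set P : α → β → ℝ := fun a b => pr p (fun ω => (A ω, B ω)) (a, b) with hP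
  have hP0 : ∀ a b, 0 ≤ P a b := fun a b => pr_nonneg hp _ _
  have key : ∑ ω, p ω * (pr p B (B ω) * q (A ω) (B ω) / P (A ω) (B ω)) ≤ 1 := by
    calc ∑ ω, p ω * (pr p B (B ω) * q (A ω) (B ω) / P (A ω) (B ω))
        = ∑ ω', p ω' * ∑ ω, if B ω = B ω' then p ω * (q (A ω) (B ω') / P (A ω) (B ω')) else 0 := by
          simp_rw [Finset.mul_sum]
          rw [Finset.sum_comm]
          refine Finset.sum_congr rfl fun ω _ => ?_
          unfold pr
          simp_rw [mul_div_assoc, Finset.sum_mul, Finset.mul_sum]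
          refine Finset.sum_congr rfl fun ω' _ => ?_
          by_cases h : B ω' = B ω
          · simp only [h, if_true]; ring
          · simp [h, Ne.symm h]
      _ ≤ ∑ ω', p ω' * 1 := by
          refine Finset.sum_le_sum fun ω' _ => mul_le_mul_of_nonneg_left ?_ (hp ω')
          refine le_trans ?_ (hs ω')
          rw [← Finset.sum_fiberwise (s := Finset.univ) (g := A)]
          refine Finset.sum_le_sum fun a _ => ?_
          calc ∑ ω ∈ Finset.univ.filter (fun ω => A ω = a),
                (if B ω = B ω' then p ω * (q (A ω) (B ω') / P (A ω) (B ω')) else 0)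
              = P a (B ω') * (q a (B ω') / P a (B ω')) := by
                simp only [hP, pr]
                rw [Finset.sum_filter, Finset.sum_mul]
                refine Finset.sum_congr rfl fun ω _ => ?_
                by_cases h1 : A ω = a
                · by_cases h2 : B ω = B ω' <;> simp [h1, h2]
                · simp [h1]
            _ ≤ q a (B ω') := by
                rcases (hP0 a (B ω')).eq_or_lt with h | h
                · rw [← h]; simpa using hq0 _ _
                · rw [mul_div_cancel₀ _ h.ne']
      _ = 1 := by simpa using hp1
  have hle : cent p A B + ∑ ω, p ω * Real.log (q (A ω) (B ω)) ≤
      ∑ ω, p ω * (pr p B (B ω) * q (A ω) (B ω) / P (A ω) (B ω)) - ∑ ω, p ω := by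
    unfold cent ent
    rw [neg_sub_neg, ← Finset.sum_sub_distrib, ← Finset.sum_add_distrib, ← Finset.sum_sub_distrib]
    refine Finset.sum_le_sum fun ω _ => ?_
    rcases (hp ω).eq_or_lt with h | h
    · simp [← h]
    · have h1 : 0 < pr p B (B ω) := pr_pos hp B h
      have h2 : 0 < P (A ω) (B ω) := pr_pos hp (fun ω => (A ω, B ω)) h
      have h3 := hq ω h
      have := Real.log_le_sub_one_of_pos (div_pos (mul_pos h1 h3) h2)
      rw [Real.log_div (mul_pos h1 h3).ne' h2.ne', Real.log_mul h1.ne' h3.ne'] at this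
      have := mul_le_mul_of_nonneg_left this h.le
      change p ω * Real.log (pr p B (B ω)) - p ω * Real.log (P (A ω) (B ω)) + _ ≤ _
      linarith
  linarith

theorem cent_le_log_card [Fintype α] [Nonempty α] {p : Ω → ℝ} (hp : ∀ ω, 0 ≤ p ω)
    (hp1 : ∑ ω, p ω = 1) (A : Ω → α) (B : Ω → β) :
    cent p A B ≤ Real.log (Fintype.card α) := by
  have hc : (0 : ℝ) < Fintype.card α := by exact_mod_cast Fintype.card_pos
  have := cent_le_crossEntropy hp hp1 A B (fun _ _ => (Fintype.card α : ℝ)⁻¹)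
    (fun _ _ => (inv_pos.2 hc).le) (fun _ _ => inv_pos.2 hc)
    (fun _ => by simp)
  rw [← Finset.sum_mul, hp1, Real.log_inv] at this
  linarith

/-- Conditioning reduces entropy. -/
theorem cent_anti [Finite α] {p : Ω → ℝ} (hp : ∀ ω, 0 ≤ p ω) (hp1 : ∑ ω, p ω = 1) (A : Ω → α)
    {B : Ω → β} {C : Ω → γ} (h : ∀ ω ω', B ω = B ω' → C ω = C ω') :
    cent p A B ≤ cent p A C := by
  classical
  have : Fintype α := Fintype.ofFinite α
  have hBC : cent p A B = cent p A (fun ω => (B ω, C ω)) :=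
    cent_congr_iff p (fun ω ω' => by simpa using h ω ω') (fun _ _ _ => Iff.rfl)
  have := cent_le_crossEntropy hp hp1 A (fun ω => (B ω, C ω))
    (fun a bc => pr p (fun ω => (A ω, C ω)) (a, bc.2) / pr p C bc.2)
    (fun a b => div_nonneg (pr_nonneg hp _ _) (pr_nonneg hp _ _))
    (fun ω hω => div_pos (pr_pos hp (fun ω => (A ω, C ω)) hω) (pr_pos hp C hω))
    (fun ω => by
      rw [← Finset.sum_div]
      refine div_le_one_of_le₀ ?_ (pr_nonneg hp _ _)
      unfold pr
      rw [Finset.sum_comm]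
      refine Finset.sum_le_sum fun ω' _ => ?_
      by_cases h' : C ω' = C ω <;> simp [h'])
  rw [hBC]
  refine this.trans_eq ?_
  unfold cent ent
  rw [neg_sub_neg, ← Finset.sum_sub_distrib, ← Finset.sum_neg_distrib]
  refine Finset.sum_congr rfl fun ω _ => ?_
  rcases (hp ω).eq_or_lt with h0 | h0
  · simp [← h0]
  · rw [Real.log_div (pr_pos hp (fun ω => (A ω, C ω)) h0).ne' (pr_pos hp C h0).ne']
    ring

open scoped Classical in
/-- Fano's inequality. The comparison law guesses `dec b` with probability `1 / 2` and is uniform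
otherwise. -/
theorem cent_le_fano [Fintype α] [Nonempty α] {p : Ω → ℝ} (hp : ∀ ω, 0 ≤ p ω)
    (hp1 : ∑ ω, p ω = 1) (A : Ω → α) (B : Ω → β) (dec : β → α) :
    cent p A B ≤ Real.log 2 +
      (∑ ω, p ω * if dec (B ω) = A ω then 0 else 1) * Real.log (Fintype.card α) := by
  have hc : (0 : ℝ) < Fintype.card α := by exact_mod_cast Fintype.card_pos
  have hci := inv_pos.2 hc
  have := cent_le_crossEntropy hp hp1 A B
    (fun a b => (if dec b = a then 1 / 2 else 0) + 1 / 2 * (Fintype.card α : ℝ)⁻¹)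
    (fun a b => by split_ifs <;> positivity)
    (fun ω _ => by split_ifs <;> positivity)
    (fun ω => by
      rw [Finset.sum_add_distrib]
      simp only [Finset.sum_ite_eq, Finset.mem_univ, if_true, Finset.sum_const, Finset.card_univ,
        nsmul_eq_mul]
      field_simp
      norm_num)
  refine this.trans ?_
  have h2 : Real.log 2 = ∑ ω, p ω * Real.log 2 := by rw [← Finset.sum_mul, hp1, one_mul]
  rw [h2, Finset.sum_mul, ← Finset.sum_add_distrib, ← Finset.sum_neg_distrib]
  refine Finset.sum_le_sum fun ω _ => ?_
  rw [mul_assoc, ← mul_add, ← mul_neg]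
  refine mul_le_mul_of_nonneg_left ?_ (hp ω)
  split_ifs
  · have : Real.log (1 / 2) ≤ Real.log (1 / 2 + 1 / 2 * (Fintype.card α : ℝ)⁻¹) :=
      Real.log_le_log (by norm_num) (by linarith)
    rw [one_div, Real.log_inv] at this
    rw [one_div]
    linarith
  · rw [zero_add, one_div, ← mul_inv, Real.log_inv, Real.log_mul two_ne_zero hc.ne']
    linarith

/-- If `V` is a function of the first stage of a two-stage experiment and determines the law of
the second stage, the entropy of the outcome given `V` is the average entropy of the second
stage. -/
theorem cent_eq_sum_ent {p : Ω → ℝ} (hp : ∀ ω, 0 ≤ p ω) {κ : Ω → Θ → ℝ} (hκ0 : ∀ ω t, 0 ≤ κ ω t)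
    (hκ1 : ∀ ω, 0 < p ω → ∑ t, κ ω t = 1) (V : Ω → β) (A : Ω → Θ → α)
    (hV : ∀ ω ω', V ω = V ω' → κ ω = κ ω' ∧ A ω = A ω') :
    cent (fun x : Ω × Θ => p x.1 * κ x.1 x.2) (fun x => A x.1 x.2) (fun x => V x.1) =
      ∑ ω, p ω * ent (κ ω) (A ω) := by
  classical
  have h1 : ∀ ω, pr (fun x : Ω × Θ => p x.1 * κ x.1 x.2) (fun x => V x.1) (V ω) =
      pr p V (V ω) := by
    intro ω
    unfold pr
    rw [Fintype.sum_prod_type]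
    refine Finset.sum_congr rfl fun ω' _ => ?_
    by_cases h : V ω' = V ω
    · rcases (hp ω').eq_or_lt with h0 | h0
      · simp [← h0]
      · simp [h, ← Finset.mul_sum, hκ1 ω' h0]
    · simp [h]
  have h2 : ∀ ω t, pr (fun x : Ω × Θ => p x.1 * κ x.1 x.2) (fun x => (A x.1 x.2, V x.1))
      (A ω t, V ω) = pr p V (V ω) * pr (κ ω) (A ω) (A ω t) := by
    intro ω t
    unfold pr
    rw [Fintype.sum_prod_type, Finset.sum_mul]
    refine Finset.sum_congr rfl fun ω' _ => ?_
    by_cases h : V ω' = V ω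
    · simp only [h, Prod.mk.injEq, and_true, if_true, (hV ω' ω h).1, (hV ω' ω h).2]
      rw [Finset.mul_sum]
      exact Finset.sum_congr rfl fun t' _ => by split_ifs <;> simp
    · simp [h]
  unfold cent ent
  rw [neg_sub_neg, ← Finset.sum_sub_distrib, Fintype.sum_prod_type]
  refine Finset.sum_congr rfl fun ω _ => ?_
  rw [mul_neg, Finset.mul_sum, ← Finset.sum_neg_distrib]
  refine Finset.sum_congr rfl fun t _ => ?_
  dsimp only
  rw [h1, h2]
  rcases (hp ω).eq_or_lt with h | h
  · simp [← h]
  rcases (hκ0 ω t).eq_or_lt with h' | h'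
  · simp [← h']
  rw [Real.log_mul (pr_pos hp V h).ne' (pr_pos (hκ0 ω) (A ω) h').ne']
  ring

theorem cent_eq_sum_cent {p : Ω → ℝ} (hp : ∀ ω, 0 ≤ p ω) {κ : Ω → Θ → ℝ}
    (hκ0 : ∀ ω t, 0 ≤ κ ω t) (hκ1 : ∀ ω, 0 < p ω → ∑ t, κ ω t = 1) (V : Ω → γ) (A : Ω → Θ → α)
    (B : Ω → Θ → β) (hV : ∀ ω ω', V ω = V ω' → κ ω = κ ω' ∧ A ω = A ω' ∧ B ω = B ω') :
    cent (fun x : Ω × Θ => p x.1 * κ x.1 x.2) (fun x => A x.1 x.2)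
      (fun x => (B x.1 x.2, V x.1)) = ∑ ω, p ω * cent (κ ω) (A ω) (B ω) := by
  have h1 := cent_eq_sum_ent hp hκ0 hκ1 V (fun ω t => (A ω t, B ω t)) (fun ω ω' h => by
    obtain ⟨a, b, c⟩ := hV ω ω' h
    exact ⟨a, by rw [b, c]⟩)
  have h2 := cent_eq_sum_ent hp hκ0 hκ1 V B (fun ω ω' h => by
    obtain ⟨a, b, c⟩ := hV ω ω' h
    exact ⟨a, c⟩)
  have h3 := cent_chain (fun x : Ω × Θ => p x.1 * κ x.1 x.2) (fun x => B x.1 x.2)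
    (fun x => A x.1 x.2) (fun x => V x.1)
  have h4 : cent (fun x : Ω × Θ => p x.1 * κ x.1 x.2) (fun x => (B x.1 x.2, A x.1 x.2))
      (fun x => V x.1) = cent (fun x : Ω × Θ => p x.1 * κ x.1 x.2)
      (fun x => (A x.1 x.2, B x.1 x.2)) (fun x => V x.1) :=
    cent_congr_iff _ (fun _ _ => Iff.rfl) (fun _ _ _ => by simp only [Prod.mk.injEq]; tauto)
  unfold cent at *
  simp_rw [mul_sub, Finset.sum_sub_distrib]
  linarith

/-- Averaging against the posterior of `Z` given `U` is averaging against `Z`. -/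
theorem sum_posterior {p : Ω → ℝ} (hp : ∀ ω, 0 ≤ p ω) (Z : Ω → α) (U : Ω → β) (z : α)
    (ψ : β → ℝ) :
    ∑ ω, p ω * (pr p (fun ω => (Z ω, U ω)) (z, U ω) / pr p U (U ω) * ψ (U ω)) =
      pr (fun ω => p ω * ψ (U ω)) Z z := by
  classical
  have h1 : ∀ ω, p ω * (pr p (fun ω => (Z ω, U ω)) (z, U ω) / pr p U (U ω) * ψ (U ω)) =
      ∑ ω', if Z ω' = z then p ω' * ψ (U ω') *
        ((if U ω = U ω' then p ω else 0) / pr p U (U ω')) else 0 := by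
    intro ω
    conv_lhs => rw [pr, div_mul_eq_mul_div, Finset.sum_mul, Finset.sum_div, Finset.mul_sum]
    refine Finset.sum_congr rfl fun ω' _ => ?_
    by_cases h : Z ω' = z
    · by_cases h' : U ω' = U ω
      · simp only [h, h', if_true]; ring
      · simp [h, h', Ne.symm h']
    · simp [h]
  simp_rw [h1]
  rw [Finset.sum_comm, pr]
  refine Finset.sum_congr rfl fun ω' _ => ?_
  split_ifs
  · rw [← Finset.mul_sum, ← Finset.sum_div]
    change p ω' * ψ (U ω') * (pr p U (U ω') / pr p U (U ω')) = _
    rcases (hp ω').eq_or_lt with h | h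
    · simp [← h]
    · rw [div_self (pr_pos hp U h).ne', mul_one]
  · simp

/-- The conditional entropy of functions of `Z` given `U` is the average entropy of the
posterior. -/
theorem cent_eq_sum_posterior {p : Ω → ℝ} (hp : ∀ ω, 0 ≤ p ω) (Z : Ω → Θ) (U : Ω → γ)
    (f : Θ → α) (g : Θ → β) :
    cent p (fun ω => f (Z ω)) (fun ω => (g (Z ω), U ω)) =
      ∑ ω, p ω * cent (fun z => pr p (fun ω => (Z ω, U ω)) (z, U ω) / pr p U (U ω)) f g := by
  classical
  rw [← cent_eq_sum_cent hp (V := U)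
    (κ := fun ω z => pr p (fun ω => (Z ω, U ω)) (z, U ω) / pr p U (U ω))
    (fun ω t => div_nonneg (pr_nonneg hp _ _) (pr_nonneg hp _ _)) ?_ (fun _ => f) (fun _ => g) ?_]
  · refine cent_congr_law fun φ => ?_
    rw [Fintype.sum_prod_type, Finset.sum_comm]
    simp_rw [mul_assoc]
    have := fun z => sum_posterior hp Z U z (fun u => φ (f z) (g z, u))
    simp_rw [this, pr]
    rw [Finset.sum_comm]
    exact Finset.sum_congr rfl fun ω _ => by simp
  · intro ω hω
    rw [← Finset.sum_div, div_eq_one_iff_eq (pr_pos hp U hω).ne']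
    unfold pr
    rw [Finset.sum_comm]
    refine Finset.sum_congr rfl fun ω' _ => ?_
    by_cases h : U ω' = U ω <;> simp [h]
  · intro ω ω' h
    exact ⟨by simp only [h], rfl, rfl⟩

/-- The first `k` letters of a sequence. -/
def pre {n : ℕ} (k : ℕ) (x : Fin n → α) : Fin n → Option α :=
  fun j => if (j : ℕ) < k then some (x j) else none

theorem pre_eq_pre_iff {n : ℕ} {k : ℕ} {x y : Fin n → α} :
    pre k x = pre k y ↔ ∀ j : Fin n, (j : ℕ) < k → x j = y j := by
  unfold pre
  constructor
  · intro h j hj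
    have := congrFun h j
    simpa [hj] using this
  · intro h
    funext j
    by_cases hj : (j : ℕ) < k
    · simp [hj, h j hj]
    · simp [hj]

theorem cent_chain_fin {n : ℕ} (p : Ω → ℝ) (X : Ω → Fin n → α) (G : Ω → β) :
    cent p X G = ∑ i : Fin n, cent p (fun ω => X ω i) (fun ω => (pre i (X ω), G ω)) := by
  set f : ℕ → ℝ := fun k => ent p (fun ω => (pre k (X ω), G ω)) with hf
  have h1 : ∀ i : Fin n, cent p (fun ω => X ω i) (fun ω => (pre i (X ω), G ω)) =
      f (i + 1) - f i := by
    intro i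
    unfold cent
    congr 1
    refine ent_congr_iff p fun ω ω' => ?_
    simp only [Prod.mk.injEq, pre_eq_pre_iff, ← and_assoc]
    refine and_congr_left fun _ => ⟨fun h j hj => ?_, fun h => ⟨h i (by omega), fun j hj => h j
      (by omega)⟩⟩
    rcases Nat.lt_succ_iff_lt_or_eq.1 hj with h' | h'
    · exact h.2 j h'
    · rw [Fin.ext h']; exact h.1
  simp_rw [h1]
  rw [Fin.sum_univ_eq_sum_range (fun k => f (k + 1) - f k) n, Finset.sum_range_sub]
  unfold cent
  congr 1
  · refine ent_congr_iff p fun ω ω' => ?_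
    simp only [Prod.mk.injEq, pre_eq_pre_iff]
    refine and_congr_left fun _ => ⟨fun h j _ => congrFun h j, fun h => funext fun j => h j j.2⟩
  · refine ent_congr_iff p fun ω ω' => ?_
    simp [pre_eq_pre_iff]

end FiniteEntropy

/-! ### Compactness of convex hulls -/

/-- The convex hull of a compact set in finite dimension is compact, by Carathéodory's theorem. -/
theorem isCompact_convexHull_of_isCompact {E : Type*} [NormedAddCommGroup E] [NormedSpace ℝ E]
    [FiniteDimensional ℝ E] {s : Set E} (hs : IsCompact s) : IsCompact (convexHull ℝ s) := by
  rcases s.eq_empty_or_nonempty with rfl | ⟨z₀, hz₀⟩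
  · simp
  set d := Module.finrank ℝ E + 1
  have himage : convexHull ℝ s = (fun wz : (Fin d → ℝ) × (Fin d → E) => ∑ i, wz.1 i • wz.2 i) ''
      (stdSimplex ℝ (Fin d) ×ˢ Set.univ.pi fun _ => s) := by
    apply Set.Subset.antisymm
    · intro x hx
      obtain ⟨ι, _, z, w, hzs, hind, hw0, hw1, rfl⟩ := eq_pos_convex_span_of_mem_convexHull hx
      have hcard : Fintype.card ι ≤ d :=
        hind.card_le_finrank_succ.trans (Nat.succ_le_succ (Submodule.finrank_le _))
      obtain ⟨e⟩ : Nonempty (ι ↪ Fin d) :=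
        Function.Embedding.nonempty_of_card_le (by simpa using hcard)
      refine ⟨(Function.extend e w 0, Function.extend e z fun _ => z₀), ⟨⟨fun i => ?_, ?_⟩, ?_⟩, ?_⟩
      · by_cases h : ∃ a, e a = i
        · obtain ⟨a, rfl⟩ := h
          simp only [e.injective.extend_apply]
          exact (hw0 a).le
        · simp only [Function.extend_apply' _ _ _ h]
          exact le_rfl
      · rw [← hw1]
        refine (Fintype.sum_of_injective e e.injective _ _ (fun i hi => ?_) fun a => ?_).symm
        · exact Function.extend_apply' _ _ _ hi
        · exact (e.injective.extend_apply _ _ _).symm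
      · intro i _
        by_cases h : ∃ a, e a = i
        · obtain ⟨a, rfl⟩ := h
          simp only [e.injective.extend_apply]
          exact hzs ⟨a, rfl⟩
        · simp only [Function.extend_apply' _ _ _ h]
          exact hz₀
      · refine (Fintype.sum_of_injective e e.injective _ _ (fun i hi => ?_) fun a => ?_).symm
        · simp [Function.extend_apply' _ _ _ hi]
        · simp only [e.injective.extend_apply]
    · rintro _ ⟨⟨w, z⟩, ⟨hw, hz⟩, rfl⟩
      exact mem_convexHull_of_exists_fintype w z hw.1 hw.2 (fun i => hz i (Set.mem_univ i)) rfl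
  rw [himage]
  refine ((isCompact_stdSimplex ℝ (Fin d)).prod (isCompact_univ_pi fun _ => hs)).image ?_
  fun_prop

/-! ### Posterior tables -/

section Tables

variable {L K : ℕ} {𝒳 : Fin L → Type*} [∀ l, Fintype (𝒳 l)] {𝒴 : Fin K → Type*}
  [∀ k, Fintype (𝒴 k)]

/-- The values of one channel use: the inputs of all users and the outputs at all relays. -/
abbrev Letters {L K : ℕ} (𝒳 : Fin L → Type*) (𝒴 : Fin K → Type*) : Type _ :=
  (∀ l, 𝒳 l) × (∀ k, 𝒴 k)

/-- The channel outputs at some of the relays; `none` marks the absent ones. -/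
abbrev PartialOutput {K : ℕ} (𝒴 : Fin K → Type*) : Type _ := ∀ k, Option (𝒴 k)

/-- A posterior table: it assigns to the outputs at each coalition of relays the posterior
probabilities of the letters of the channel use that the coalition's descriptions induce. The
table is what the random variable `W` determines once the descriptions `U_k` are functions of
`W` and `Y_k`. -/
abbrev Table {L K : ℕ} (𝒳 : Fin L → Type*) (𝒴 : Fin K → Type*) : Type _ :=
  PartialOutput 𝒴 → Letters 𝒳 𝒴 → unitInterval

/-- The outputs at the relays in `A`. -/
def restr (A : Finset (Fin K)) (y : ∀ k, 𝒴 k) : PartialOutput 𝒴 :=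
  fun k => if k ∈ A then some (y k) else none

/-- The entries of the table that are visible to the relays in `A` when the outputs are `y`, one
for every subcoalition `A ∩ B`. -/
def view (A : Finset (Fin K)) (T : Table 𝒳 𝒴) (y : ∀ k, 𝒴 k) :
    Finset (Fin K) → Letters 𝒳 𝒴 → unitInterval :=
  fun B => T (restr (A ∩ B) y)

/-- The joint law of one channel use with independent inputs of laws `P l`. -/
def letterProb (ch : (∀ l, 𝒳 l) → (∀ k, 𝒴 k) → ℝ) (P : ∀ l, 𝒳 l → ℝ) (z : Letters 𝒳 𝒴) : ℝ :=
  (∏ l, P l (z.1 l)) * ch z.1 z.2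

/-- A single-letter configuration: input laws and the law of a posterior table. -/
abbrev Config {L K : ℕ} (𝒳 : Fin L → Type*) [∀ l, Fintype (𝒳 l)] (𝒴 : Fin K → Type*)
    [∀ k, Fintype (𝒴 k)] : Type _ :=
  (∀ l, 𝒳 l → ℝ) × ProbabilityMeasure (Table 𝒳 𝒴)

/-- The configurations whose input laws are pmfs and whose table entries are posteriors: for an
independent table, `T (restr A y)` is the conditional law of the letters given what the coalition
`A` sees of the table. Testing with continuous functions makes this a closed condition. -/
def consistentConfigs (ch : (∀ l, 𝒳 l) → (∀ k, 𝒴 k) → ℝ) : Set (Config 𝒳 𝒴) :=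
  {c | (∀ l, c.1 l ∈ stdSimplex ℝ (𝒳 l)) ∧
    ∀ (A : Finset (Fin K)) (z : Letters 𝒳 𝒴)
      (φ : C(Finset (Fin K) → Letters 𝒳 𝒴 → unitInterval, ℝ)),
      letterProb ch c.1 z * ∫ T, φ (view A T z.2) ∂(c.2 : Measure (Table 𝒳 𝒴)) =
        ∑ z' : Letters 𝒳 𝒴, letterProb ch c.1 z' *
          ∫ T, (T (restr A z'.2) z : ℝ) * φ (view A T z'.2) ∂(c.2 : Measure (Table 𝒳 𝒴))}

theorem continuous_view (A : Finset (Fin K)) (y : ∀ k, 𝒴 k) :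
    Continuous fun T : Table 𝒳 𝒴 => view A T y :=
  continuous_pi fun _ => continuous_apply _

theorem continuous_letterProb (ch : (∀ l, 𝒳 l) → (∀ k, 𝒴 k) → ℝ) (z : Letters 𝒳 𝒴) :
    Continuous fun c : Config 𝒳 𝒴 => letterProb ch c.1 z := by
  unfold letterProb
  fun_prop

theorem continuous_integral_table {φ : Table 𝒳 𝒴 → ℝ} (hφ : Continuous φ) :
    Continuous fun c : Config 𝒳 𝒴 => ∫ T, φ T ∂(c.2 : Measure (Table 𝒳 𝒴)) :=
  (ProbabilityMeasure.continuous_integral_continuousMap (⟨φ, hφ⟩ : C(Table 𝒳 𝒴, ℝ))).comp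
    continuous_snd

theorem isCompact_consistentConfigs (ch : (∀ l, 𝒳 l) → (∀ k, 𝒴 k) → ℝ) :
    IsCompact (consistentConfigs ch) := by
  have h1 : IsCompact ((Set.univ.pi fun l => stdSimplex ℝ (𝒳 l)) ×ˢ
      (Set.univ : Set (ProbabilityMeasure (Table 𝒳 𝒴)))) :=
    (isCompact_univ_pi fun l => isCompact_stdSimplex ℝ (𝒳 l)).prod isCompact_univ
  refine h1.of_isClosed_subset ?_ fun c hc => ⟨fun l _ => hc.1 l, Set.mem_univ _⟩
  have h2 : consistentConfigs ch =
      Prod.fst ⁻¹' (Set.univ.pi fun l => stdSimplex ℝ (𝒳 l)) ∩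
        ⋂ A, ⋂ z, ⋂ φ : C(Finset (Fin K) → Letters 𝒳 𝒴 → unitInterval, ℝ), {c : Config 𝒳 𝒴 |
          letterProb ch c.1 z * ∫ T, φ (view A T z.2) ∂(c.2 : Measure (Table 𝒳 𝒴)) =
            ∑ z' : Letters 𝒳 𝒴, letterProb ch c.1 z' *
              ∫ T, (T (restr A z'.2) z : ℝ) * φ (view A T z'.2) ∂(c.2 : Measure (Table 𝒳 𝒴))} := by
    ext c
    simp [consistentConfigs]
  rw [h2]
  refine ((isClosed_set_pi fun l _ => isClosed_stdSimplex ℝ (𝒳 l)).preimage continuous_fst).inter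
    (isClosed_iInter fun A => isClosed_iInter fun z => isClosed_iInter fun φ =>
      isClosed_eq ?_ ?_)
  · exact (continuous_letterProb ch z).mul
      (continuous_integral_table (φ.continuous.comp (continuous_view A z.2)))
  · refine continuous_finsetSum _ fun z' _ => (continuous_letterProb ch z').mul
      (continuous_integral_table (.mul ?_ (φ.continuous.comp (continuous_view A z'.2))))
    fun_prop

/-- The entropy `H(α(Z) | β(Z), U_A)` in nats of functions of the letters given the descriptions of
the coalition `A`, in terms of the configuration. The empty coalition sees nothing, so that its
posterior is the prior. -/
def coalitionEntropy {α β : Type*} (ch : (∀ l, 𝒳 l) → (∀ k, 𝒴 k) → ℝ) (c : Config 𝒳 𝒴)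
    (A : Finset (Fin K)) (f : Letters 𝒳 𝒴 → α) (g : Letters 𝒳 𝒴 → β) : ℝ :=
  if A = ∅ then cent (letterProb ch c.1) f g
  else ∑ z, letterProb ch c.1 z *
    ∫ T, cent (fun z' => (T (restr A z.2) z' : ℝ)) f g ∂(c.2 : Measure (Table 𝒳 𝒴))

theorem continuous_cent_table {α β : Type*} (o : PartialOutput 𝒴) (f : Letters 𝒳 𝒴 → α)
    (g : Letters 𝒳 𝒴 → β) :
    Continuous fun T : Table 𝒳 𝒴 => cent (fun z' => (T o z' : ℝ)) f g :=
  (continuous_cent f g).comp (by fun_prop)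

theorem continuous_coalitionEntropy {α β : Type*} (ch : (∀ l, 𝒳 l) → (∀ k, 𝒴 k) → ℝ)
    (A : Finset (Fin K)) (f : Letters 𝒳 𝒴 → α) (g : Letters 𝒳 𝒴 → β) :
    Continuous fun c : Config 𝒳 𝒴 => coalitionEntropy ch c A f g := by
  unfold coalitionEntropy
  split_ifs
  · exact (continuous_cent f g).comp (continuous_pi fun z => continuous_letterProb ch z)
  · exact continuous_finsetSum _ fun z _ => (continuous_letterProb ch z).mul
      (continuous_integral_table (continuous_cent_table _ f g))

/-- The inputs of the users in `T`. -/
def inputs (T : Finset (Fin L)) (z : Letters 𝒳 𝒴) : ∀ l : T, 𝒳 l := fun l => z.1 l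

/-- The outputs at the relays in `S`. -/
def outputs (S : Finset (Fin K)) (z : Letters 𝒳 𝒴) : ∀ k : S, 𝒴 k := fun k => z.2 k

/-- The value `-I(Y_S ; U_S | X, U_{Sᶜ}) + I(X_T ; U_{Sᶜ} | X_{Tᶜ})` in nats of the bound for
`T` and `S`. -/
def boundVector (ch : (∀ l, 𝒳 l) → (∀ k, 𝒴 k) → ℝ) (c : Config 𝒳 𝒴)
    (TS : Finset (Fin L) × Finset (Fin K)) : ℝ :=
  -(coalitionEntropy ch c TS.2ᶜ (outputs TS.2) Prod.fst -
      coalitionEntropy ch c Finset.univ (outputs TS.2) Prod.fst) +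
    (coalitionEntropy ch c ∅ (inputs TS.1) (inputs TS.1ᶜ) -
      coalitionEntropy ch c TS.2ᶜ (inputs TS.1) (inputs TS.1ᶜ))

theorem continuous_boundVector (ch : (∀ l, 𝒳 l) → (∀ k, 𝒴 k) → ℝ) :
    Continuous (boundVector ch : Config 𝒳 𝒴 → _) :=
  continuous_pi fun _ => ((continuous_coalitionEntropy ch _ _ _).sub
    (continuous_coalitionEntropy ch _ _ _)).neg.add ((continuous_coalitionEntropy ch _ _ _).sub
    (continuous_coalitionEntropy ch _ _ _))

/-- The averages of the bound over finitely many consistent configurations form a compact set, so a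
vector that they dominate up to every positive slack is dominated by one of them. -/
theorem exists_mem_convexHull_ge (ch : (∀ l, 𝒳 l) → (∀ k, 𝒴 k) → ℝ)
    (r : Finset (Fin L) × Finset (Fin K) → ℝ)
    (h : ∀ δ > 0, ∃ v ∈ convexHull ℝ (boundVector ch '' consistentConfigs ch),
      ∀ i, r i ≤ v i + δ) :
    ∃ v ∈ convexHull ℝ (boundVector ch '' consistentConfigs ch), ∀ i, r i ≤ v i := by
  have hc : IsCompact (convexHull ℝ (boundVector ch '' consistentConfigs ch)) :=
    isCompact_convexHull_of_isCompact
      ((isCompact_consistentConfigs ch).image (continuous_boundVector ch))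
  have h' : ∀ n : ℕ, ∃ v ∈ convexHull ℝ (boundVector ch '' consistentConfigs ch),
      ∀ i, r i ≤ v i + 1 / ((n : ℝ) + 1) := fun n => h _ (by positivity)
  choose v hv hr using h'
  obtain ⟨v₀, hv₀, φ, hφ, hlim⟩ := hc.tendsto_subseq hv
  refine ⟨v₀, hv₀, fun i => ?_⟩
  have h1 : Filter.Tendsto (fun n => v (φ n) i + 1 / ((φ n : ℝ) + 1)) Filter.atTop
      (nhds (v₀ i + 0)) :=
    ((continuous_apply i).tendsto v₀ |>.comp hlim).add
      (tendsto_one_div_add_atTop_nhds_zero_nat.comp hφ.tendsto_atTop)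
  rw [add_zero] at h1
  exact ge_of_tendsto' h1 fun n => hr (φ n) i

end Tables

/-! ### Posterior tables of finite systems -/

section FiniteSystem

variable {L K : ℕ} {𝒳 : Fin L → Type*} [∀ l, Fintype (𝒳 l)] {𝒴 : Fin K → Type*}
  [∀ k, Fintype (𝒴 k)] {W : Type*} [Fintype W] {ι : Fin K → Type*}

theorem letterProb_nonneg {ch : (∀ l, 𝒳 l) → (∀ k, 𝒴 k) → ℝ}
    (hch : ∀ x, ch x ∈ stdSimplex ℝ (∀ k, 𝒴 k)) {P : ∀ l, 𝒳 l → ℝ}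
    (hP : ∀ l, P l ∈ stdSimplex ℝ (𝒳 l)) (z : Letters 𝒳 𝒴) : 0 ≤ letterProb ch P z :=
  mul_nonneg (Finset.prod_nonneg fun l _ => (hP l).1 _) ((hch _).1 _)

theorem sum_letterProb {ch : (∀ l, 𝒳 l) → (∀ k, 𝒴 k) → ℝ}
    (hch : ∀ x, ch x ∈ stdSimplex ℝ (∀ k, 𝒴 k)) {P : ∀ l, 𝒳 l → ℝ}
    (hP : ∀ l, P l ∈ stdSimplex ℝ (𝒳 l)) : ∑ z : Letters 𝒳 𝒴, letterProb ch P z = 1 := by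
  classical
  unfold letterProb
  rw [Fintype.sum_prod_type]
  simp_rw [← Finset.mul_sum, (hch _).2, mul_one]
  rw [← Fintype.prod_sum fun l x => P l x]
  exact Finset.prod_eq_one fun l _ => (hP l).2

/-- The descriptions that the relays produce from partial outputs. -/
def desc (J : ∀ k, W → 𝒴 k → ι k) (o : PartialOutput 𝒴) (w : W) : ∀ k, Option (ι k) :=
  fun k => (o k).map (J k w)

/-- The descriptions of the coalition `A`. -/
def coalitionDesc (J : ∀ k, W → 𝒴 k → ι k) (A : Finset (Fin K)) (x : Letters 𝒳 𝒴 × W) :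
    ∀ k, Option (ι k) :=
  desc J (restr A x.1.2) x.2

open scoped Classical in
/-- The posterior law of the letters given descriptions `u` of the relays with `u k ≠ none`. -/
def posterior (p : Letters 𝒳 𝒴 × W → ℝ) (J : ∀ k, W → 𝒴 k → ι k) (u : ∀ k, Option (ι k))
    (z : Letters 𝒳 𝒴) : ℝ :=
  pr p (fun x => (x.1, coalitionDesc J (Finset.univ.filter fun k => u k ≠ none) x)) (z, u) /
    pr p (coalitionDesc J (Finset.univ.filter fun k => u k ≠ none)) u

theorem posterior_mem {p : Letters 𝒳 𝒴 × W → ℝ} (hp : ∀ x, 0 ≤ p x) (J : ∀ k, W → 𝒴 k → ι k)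
    (u : ∀ k, Option (ι k)) (z : Letters 𝒳 𝒴) : posterior p J u z ∈ unitInterval :=
  ⟨div_nonneg (pr_nonneg hp _ _) (pr_nonneg hp _ _),
    div_le_one_of_le₀ (pr_le_pr_of_imp hp fun _ h => (Prod.mk.inj h).2) (pr_nonneg hp _ _)⟩

theorem posterior_coalitionDesc (p : Letters 𝒳 𝒴 × W → ℝ) (J : ∀ k, W → 𝒴 k → ι k)
    (A : Finset (Fin K)) (x : Letters 𝒳 𝒴 × W) (z : Letters 𝒳 𝒴) :
    posterior p J (coalitionDesc J A x) z =
      pr p (fun x => (x.1, coalitionDesc J A x)) (z, coalitionDesc J A x) /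
        pr p (coalitionDesc J A) (coalitionDesc J A x) := by
  classical
  have : (Finset.univ.filter fun k => coalitionDesc J A x k ≠ none) = A := by
    ext k
    by_cases h : k ∈ A <;> simp [coalitionDesc, desc, restr, h]
  unfold posterior
  rw [this]

/-- The posterior table of the system in which relay `k` describes its output by `J k w`. -/
def posteriorTable {p : Letters 𝒳 𝒴 × W → ℝ} (hp : ∀ x, 0 ≤ p x) (J : ∀ k, W → 𝒴 k → ι k)
    (w : W) : Table 𝒳 𝒴 :=
  fun o z => ⟨posterior p J (desc J o w) z, posterior_mem hp J _ z⟩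

/-- The probability measure with finitely supported mass `ρ` on the image of `T`. -/
def finiteLaw {E : Type*} [MeasurableSpace E] {ρ : W → ℝ} (hρ : ρ ∈ stdSimplex ℝ W) (T : W → E) :
    ProbabilityMeasure E :=
  ⟨∑ w, ENNReal.ofReal (ρ w) • Measure.dirac (T w), ⟨by
    simp only [Measure.coe_finsetSum, Measure.coe_smul, Finset.sum_apply, Pi.smul_apply,
      measure_univ, smul_eq_mul, mul_one]
    rw [← ENNReal.ofReal_sum_of_nonneg fun w _ => hρ.1 w, hρ.2, ENNReal.ofReal_one]⟩⟩

theorem integral_finiteLaw {E : Type*} [MeasurableSpace E] [MeasurableSingletonClass E]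
    {ρ : W → ℝ} (hρ : ρ ∈ stdSimplex ℝ W) (T : W → E) (φ : E → ℝ) :
    ∫ t, φ t ∂(finiteLaw hρ T : Measure E) = ∑ w, ρ w * φ (T w) := by
  have : ((finiteLaw hρ T : ProbabilityMeasure E) : Measure E) =
      ∑ w, ENNReal.ofReal (ρ w) • Measure.dirac (T w) := rfl
  rw [this, integral_finsetSum_measure]
  · refine Finset.sum_congr rfl fun w _ => ?_
    rw [integral_smul_measure, integral_dirac, ENNReal.toReal_ofReal (hρ.1 w), smul_eq_mul]
  · intro w _
    exact (integrable_dirac (by simp)).smul_measure ENNReal.ofReal_ne_top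

variable {ch : (∀ l, 𝒳 l) → (∀ k, 𝒴 k) → ℝ} {P : ∀ l, 𝒳 l → ℝ} {ρ : W → ℝ}

/-- The joint weight of the letters and of an independent finite random variable `W`. -/
def systemWeight (ch : (∀ l, 𝒳 l) → (∀ k, 𝒴 k) → ℝ) (P : ∀ l, 𝒳 l → ℝ) (ρ : W → ℝ)
    (x : Letters 𝒳 𝒴 × W) : ℝ := letterProb ch P x.1 * ρ x.2

theorem systemWeight_nonneg (hch : ∀ x, ch x ∈ stdSimplex ℝ (∀ k, 𝒴 k))
    (hP : ∀ l, P l ∈ stdSimplex ℝ (𝒳 l)) (hρ : ρ ∈ stdSimplex ℝ W) (x : Letters 𝒳 𝒴 × W) :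
    0 ≤ systemWeight ch P ρ x :=
  mul_nonneg (letterProb_nonneg hch hP _) (hρ.1 _)

/-- The configuration of a finite system. -/
def systemConfig (hch : ∀ x, ch x ∈ stdSimplex ℝ (∀ k, 𝒴 k))
    (hP : ∀ l, P l ∈ stdSimplex ℝ (𝒳 l)) (hρ : ρ ∈ stdSimplex ℝ W) (J : ∀ k, W → 𝒴 k → ι k) :
    Config 𝒳 𝒴 :=
  (P, finiteLaw hρ (posteriorTable (systemWeight_nonneg hch hP hρ) J))

/-- The table of a finite system consists of posteriors: what a coalition sees of the table is a
function of its descriptions. -/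
theorem systemConfig_mem (hch : ∀ x, ch x ∈ stdSimplex ℝ (∀ k, 𝒴 k))
    (hP : ∀ l, P l ∈ stdSimplex ℝ (𝒳 l)) (hρ : ρ ∈ stdSimplex ℝ W) (J : ∀ k, W → 𝒴 k → ι k) :
    systemConfig hch hP hρ J ∈ consistentConfigs ch := by
  classical
  refine ⟨hP, fun A z φ => ?_⟩
  have hp := systemWeight_nonneg hch hP hρ (ρ := ρ)
  set p := systemWeight ch P ρ (𝒳 := 𝒳) (𝒴 := 𝒴)
  -- what the coalition sees of the table is a function of its descriptions
  set ψ : (∀ k, Option (ι k)) → ℝ := fun u => φ fun B z =>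
    ⟨posterior p J (fun k => if k ∈ B then u k else none) z, posterior_mem hp J _ z⟩ with hψ
  have hview : ∀ x : Letters 𝒳 𝒴 × W,
      φ (view A (posteriorTable hp J x.2) x.1.2) = ψ (coalitionDesc J A x) := by
    intro x
    simp only [hψ]
    congr 1
    funext B z
    simp only [view, posteriorTable]
    congr 2
    funext k
    by_cases h1 : k ∈ A <;> by_cases h2 : k ∈ B <;> simp [desc, restr, coalitionDesc, h1, h2]
  have := sum_posterior hp (fun x => x.1) (coalitionDesc J A) z ψ
  simp only [systemConfig, integral_finiteLaw]
  rw [Fintype.sum_prod_type] at this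
  calc letterProb ch P z * ∑ w, ρ w * φ (view A (posteriorTable hp J w) z.2)
      = pr (fun x => p x * ψ (coalitionDesc J A x)) (fun x => x.1) z := by
        unfold pr
        rw [Fintype.sum_prod_type, Finset.sum_comm, Finset.mul_sum]
        refine Finset.sum_congr rfl fun w _ => ?_
        simp only [Finset.sum_ite_eq', Finset.mem_univ, if_true]
        rw [hview (z, w)]
        simp only [p, systemWeight, mul_assoc]
    _ = _ := by
        rw [← this]
        refine Finset.sum_congr rfl fun z' _ => ?_
        rw [Finset.mul_sum]
        refine Finset.sum_congr rfl fun w _ => ?_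
        rw [hview (z', w), ← posterior_coalitionDesc]
        simp only [p, systemWeight, mul_assoc]
        rfl

/-- The coalition entropies of the configuration of a finite system are its conditional entropies. -/
theorem coalitionEntropy_systemConfig {α β : Type*} (hch : ∀ x, ch x ∈ stdSimplex ℝ (∀ k, 𝒴 k))
    (hP : ∀ l, P l ∈ stdSimplex ℝ (𝒳 l)) (hρ : ρ ∈ stdSimplex ℝ W) (J : ∀ k, W → 𝒴 k → ι k)
    (A : Finset (Fin K)) (f : Letters 𝒳 𝒴 → α) (g : Letters 𝒳 𝒴 → β) :
    coalitionEntropy ch (systemConfig hch hP hρ J) A f g =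
      cent (systemWeight ch P ρ) (fun x => f x.1) (fun x => (g x.1, coalitionDesc J A x)) := by
  have hp := systemWeight_nonneg hch hP hρ (ρ := ρ)
  unfold coalitionEntropy
  split_ifs with hA
  · subst hA
    have h0 : ∀ x x' : Letters 𝒳 𝒴 × W, coalitionDesc J ∅ x = coalitionDesc J ∅ x' := by
      intro x x'
      funext k
      simp [coalitionDesc, desc, restr]
    rw [cent_congr_iff (A := fun x : Letters 𝒳 𝒴 × W => f x.1)
      (B := fun x => (g x.1, coalitionDesc J ∅ x)) (A' := fun x => f x.1) (C := fun x => g x.1) _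
      (fun x x' => by simp [h0 x x']) (fun _ _ _ => Iff.rfl)]
    refine cent_congr_law fun φ => ?_
    rw [Fintype.sum_prod_type (α₁ := Letters 𝒳 𝒴) (α₂ := W)]
    refine Finset.sum_congr rfl fun z _ => ?_
    simp only [systemWeight, systemConfig]
    rw [← Finset.sum_mul, ← Finset.mul_sum, hρ.2, mul_one]
  · rw [cent_eq_sum_posterior hp (fun x => x.1) (coalitionDesc J A) f g,
      Fintype.sum_prod_type (α₁ := Letters 𝒳 𝒴) (α₂ := W)]
    simp only [systemConfig, integral_finiteLaw, Finset.mul_sum]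
    refine Finset.sum_congr rfl fun z _ => Finset.sum_congr rfl fun w _ => ?_
    rw [← mul_assoc]
    simp only [systemWeight]
    congr 2
    funext z'
    exact posterior_coalitionDesc _ J A (z, w) z'

end FiniteSystem

/-! ### Single-letterization -/

section Block

variable {L K : ℕ} {𝒳 : Fin L → Type*} [∀ l, Fintype (𝒳 l)] {𝒴 : Fin K → Type*}
  [∀ k, Fintype (𝒴 k)] {γ : Type*} [Fintype γ] {ι : Fin K → Type*} {n : ℕ}

/-- The law of `n` independent uses of the channel, with time-sharing letters. -/
def blockWeight (ch : (∀ l, 𝒳 l) → (∀ k, 𝒴 k) → ℝ) (pQ : γ → ℝ) (pX : ∀ l, γ → 𝒳 l → ℝ)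
    (ω : Fin n → γ × Letters 𝒳 𝒴) : ℝ :=
  ∏ i, pQ (ω i).1 * letterProb ch (fun l => pX l (ω i).1) (ω i).2

/-- What is moved into the time-sharing variable at time `i`: the whole time-sharing sequence, the
inputs at all other times and the outputs at all earlier times. -/
def past (i : Fin n) (ω : Fin n → γ × Letters 𝒳 𝒴) :
    Fin n → γ × Option (∀ l, 𝒳 l) × Option (∀ k, 𝒴 k) :=
  fun j => ((ω j).1, if j = i then none else some (ω j).2.1, if j < i then some (ω j).2.2 else none)

theorem past_eq_iff {i : Fin n} {ω ω' : Fin n → γ × Letters 𝒳 𝒴} :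
    past i ω = past i ω' ↔ (∀ j, (ω j).1 = (ω' j).1) ∧ (∀ j, j ≠ i → (ω j).2.1 = (ω' j).2.1) ∧
      ∀ j, j < i → (ω j).2.2 = (ω' j).2.2 := by
  rw [funext_iff]
  simp only [past]
  constructor
  · intro h
    refine ⟨fun j => congrArg (fun t => t.1) (h j), fun j hj => ?_, fun j hj => ?_⟩
    · have := congrArg (fun t => t.2.1) (h j)
      simpa [hj] using this
    · have := congrArg (fun t => t.2.2) (h j)
      simpa [hj] using this
  · rintro ⟨h1, h2, h3⟩ j
    refine Prod.ext (h1 j) (Prod.ext ?_ ?_)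
    · by_cases hj : j = i
      · simp [hj]
      · simp [hj, h2 j hj]
    · by_cases hj : j < i
      · simp [hj, h3 j hj]
      · simp [hj]

/-- The law of fresh outputs for the inputs of `ω`, with a dummy input `x₀` at time `i`. -/
def futureWeight (ch : (∀ l, 𝒳 l) → (∀ k, 𝒴 k) → ℝ) (x₀ : ∀ l, 𝒳 l) (i : Fin n)
    (ω : Fin n → γ × Letters 𝒳 𝒴) (w : Fin n → ∀ k, 𝒴 k) : ℝ :=
  ∏ j, ch (if j = i then x₀ else (ω j).2.1) (w j)

/-- The output sequence that agrees with `ω` before time `i` and with `w` after time `i`. -/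
def splice {k : Fin K} (i : Fin n) (ω : Fin n → γ × Letters 𝒳 𝒴) (w : Fin n → ∀ k, 𝒴 k)
    (y : 𝒴 k) : Fin n → 𝒴 k :=
  fun j => if j < i then (ω j).2.2 k else if j = i then y else w j k

/-- The description of relay `k` as a function of its output at time `i`, of fresh later outputs
`w`, and of the past in `ω`. -/
def spliceDesc (J : ∀ k, (Fin n → 𝒴 k) → (Fin n → γ) → ι k) (i : Fin n)
    (ω : Fin n → γ × Letters 𝒳 𝒴) (k : Fin K) (w : Fin n → ∀ k, 𝒴 k) (y : 𝒴 k) : ι k :=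
  J k (splice i ω w y) (fun j => (ω j).1)

/-- The descriptions of all relays. -/
def blockDesc (J : ∀ k, (Fin n → 𝒴 k) → (Fin n → γ) → ι k) (ω : Fin n → γ × Letters 𝒳 𝒴)
    (k : Fin K) : ι k :=
  J k (fun j => (ω j).2.2 k) (fun j => (ω j).1)

/-- The descriptions of the relays in `A`. -/
def blockCoalitionDesc (J : ∀ k, (Fin n → 𝒴 k) → (Fin n → γ) → ι k) (A : Finset (Fin K))
    (ω : Fin n → γ × Letters 𝒳 𝒴) (k : Fin K) : Option (ι k) :=
  if k ∈ A then some (blockDesc J ω k) else none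

variable {ch : (∀ l, 𝒳 l) → (∀ k, 𝒴 k) → ℝ} {pQ : γ → ℝ} {pX : ∀ l, γ → 𝒳 l → ℝ}

theorem blockWeight_nonneg (hch : ∀ x, ch x ∈ stdSimplex ℝ (∀ k, 𝒴 k)) (hQ : pQ ∈ stdSimplex ℝ γ)
    (hX : ∀ l q, pX l q ∈ stdSimplex ℝ (𝒳 l)) (ω : Fin n → γ × Letters 𝒳 𝒴) :
    0 ≤ blockWeight ch pQ pX ω :=
  Finset.prod_nonneg fun _ _ => mul_nonneg (hQ.1 _) (letterProb_nonneg hch (fun l => hX l _) _)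

theorem sum_blockWeight (hch : ∀ x, ch x ∈ stdSimplex ℝ (∀ k, 𝒴 k)) (hQ : pQ ∈ stdSimplex ℝ γ)
    (hX : ∀ l q, pX l q ∈ stdSimplex ℝ (𝒳 l)) :
    ∑ ω : Fin n → γ × Letters 𝒳 𝒴, blockWeight ch pQ pX ω = 1 := by
  classical
  unfold blockWeight
  rw [← Fintype.prod_sum fun (_ : Fin n) (s : γ × Letters 𝒳 𝒴) =>
    pQ s.1 * letterProb ch (fun l => pX l s.1) s.2]
  refine Finset.prod_eq_one fun _ _ => ?_
  rw [Fintype.sum_prod_type]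
  simp_rw [← Finset.mul_sum, sum_letterProb hch fun l => hX l _, mul_one]
  exact hQ.2

theorem futureWeight_mem (hch : ∀ x, ch x ∈ stdSimplex ℝ (∀ k, 𝒴 k)) (x₀ : ∀ l, 𝒳 l) (i : Fin n)
    (ω : Fin n → γ × Letters 𝒳 𝒴) :
    futureWeight ch x₀ i ω ∈ stdSimplex ℝ (Fin n → ∀ k, 𝒴 k) := by
  classical
  refine ⟨fun w => Finset.prod_nonneg fun j _ => (hch _).1 _, ?_⟩
  unfold futureWeight
  rw [← Fintype.prod_sum fun (j : Fin n) (y : ∀ k, 𝒴 k) =>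
    ch (if j = i then x₀ else (ω j).2.1) y]
  exact Finset.prod_eq_one fun j _ => (hch _).2

theorem sum_systemWeight {W : Type*} [Fintype W] (hch : ∀ x, ch x ∈ stdSimplex ℝ (∀ k, 𝒴 k))
    {P : ∀ l, 𝒳 l → ℝ} (hP : ∀ l, P l ∈ stdSimplex ℝ (𝒳 l)) {ρ : W → ℝ}
    (hρ : ρ ∈ stdSimplex ℝ W) : ∑ x, systemWeight ch P ρ x = 1 := by
  rw [Fintype.sum_prod_type (α₁ := Letters 𝒳 𝒴) (α₂ := W)]
  simp only [systemWeight]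
  simp_rw [← Finset.mul_sum, hρ.2, mul_one]
  exact sum_letterProb hch hP

/-- The exchange of the letters at time `i` and of the later outputs between a block and fresh
letters. -/
def exchange (i : Fin n)
    (t : (Fin n → γ × Letters 𝒳 𝒴) × Letters 𝒳 𝒴 × (Fin n → ∀ k, 𝒴 k)) :
    (Fin n → γ × Letters 𝒳 𝒴) × Letters 𝒳 𝒴 × (Fin n → ∀ k, 𝒴 k) :=
  (fun j => ((t.1 j).1, if j = i then t.2.1 else
      if j < i then (t.1 j).2 else ((t.1 j).2.1, t.2.2 j)),
    (t.1 i).2, fun j => if i < j then (t.1 j).2.2 else t.2.2 j)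

theorem exchange_involutive (i : Fin n) :
    Function.Involutive (exchange i : (Fin n → γ × Letters 𝒳 𝒴) × Letters 𝒳 𝒴 ×
      (Fin n → ∀ k, 𝒴 k) → _) := by
  rintro ⟨ω, z, w⟩
  simp only [exchange]
  refine Prod.ext (funext fun j => ?_) (Prod.ext ?_ (funext fun j => ?_))
  · rcases lt_trichotomy j i with h | h | h
    · simp [h, h.ne]
    · simp [h]
    · simp [h.ne', h.not_gt, h]
  · simp
  · rcases lt_trichotomy j i with h | h | h
    · simp [h.not_gt]
    · simp [h]
    · simp [h.ne', h.not_gt, h]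

/-- The joint law of a block and of fresh letters is invariant under the exchange, because both have
the same conditional law given the past. -/
theorem weight_exchange (x₀ : ∀ l, 𝒳 l) (i : Fin n)
    (t : (Fin n → γ × Letters 𝒳 𝒴) × Letters 𝒳 𝒴 × (Fin n → ∀ k, 𝒴 k)) :
    blockWeight ch pQ pX (exchange i t).1 * systemWeight ch (fun l => pX l ((exchange i t).1 i).1)
        (futureWeight ch x₀ i (exchange i t).1) (exchange i t).2 =
      blockWeight ch pQ pX t.1 * systemWeight ch (fun l => pX l (t.1 i).1)
        (futureWeight ch x₀ i t.1) t.2 := by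
  obtain ⟨ω, z, w⟩ := t
  have h : ∀ (ω : Fin n → γ × Letters 𝒳 𝒴) (z : Letters 𝒳 𝒴) (w : Fin n → ∀ k, 𝒴 k),
      blockWeight ch pQ pX ω * systemWeight ch (fun l => pX l (ω i).1)
        (futureWeight ch x₀ i ω) (z, w) =
      (pQ (ω i).1 * letterProb ch (fun l => pX l (ω i).1) (ω i).2 *
        letterProb ch (fun l => pX l (ω i).1) z * ch x₀ (w i)) *
      ∏ j ∈ Finset.univ.erase i, (pQ (ω j).1 * letterProb ch (fun l => pX l (ω j).1) (ω j).2) *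
        ch (if j = i then x₀ else (ω j).2.1) (w j) := by
    intro ω z w
    simp only [blockWeight, systemWeight, futureWeight]
    rw [← Finset.mul_prod_erase Finset.univ _ (Finset.mem_univ i),
      ← Finset.mul_prod_erase Finset.univ (fun j => ch _ (w j)) (Finset.mem_univ i),
      Finset.prod_mul_distrib
        (f := fun j => pQ (ω j).1 * letterProb ch (fun l => pX l (ω j).1) (ω j).2)]
    simp only [if_true]
    ring
  rw [h, h]
  congr 1
  · simp only [exchange, if_true, lt_irrefl, if_false]
    ring
  · refine Finset.prod_congr rfl fun j hj => ?_
    have hji : j ≠ i := Finset.ne_of_mem_erase hj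
    rcases lt_or_gt_of_ne hji with h' | h'
    · simp [exchange, hji, h', h'.not_gt]
    · simp only [exchange, hji, h', h'.not_gt, letterProb, if_false, if_true]
      ring

/-- Given the past, the letters at time `i` and the later outputs may be drawn afresh. -/
theorem sum_resample (hch : ∀ x, ch x ∈ stdSimplex ℝ (∀ k, 𝒴 k))
    (hX : ∀ l q, pX l q ∈ stdSimplex ℝ (𝒳 l)) (J : ∀ k, (Fin n → 𝒴 k) → (Fin n → γ) → ι k)
    (x₀ : ∀ l, 𝒳 l) (i : Fin n)
    (φ : (Fin n → γ × Option (∀ l, 𝒳 l) × Option (∀ k, 𝒴 k)) → Letters 𝒳 𝒴 → (∀ k, ι k) → ℝ) :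
    ∑ ω, blockWeight ch pQ pX ω * φ (past i ω) (ω i).2 (blockDesc J ω) =
      ∑ t : (Fin n → γ × Letters 𝒳 𝒴) × Letters 𝒳 𝒴 × (Fin n → ∀ k, 𝒴 k),
        blockWeight ch pQ pX t.1 * systemWeight ch (fun l => pX l (t.1 i).1)
          (futureWeight ch x₀ i t.1) t.2 *
        φ (past i t.1) t.2.1 (fun k => spliceDesc J i t.1 k t.2.2 (t.2.1.2 k)) := by
  have h1 : ∀ t : (Fin n → γ × Letters 𝒳 𝒴) × Letters 𝒳 𝒴 × (Fin n → ∀ k, 𝒴 k),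
      φ (past i t.1) t.2.1 (fun k => spliceDesc J i t.1 k t.2.2 (t.2.1.2 k)) =
        φ (past i (exchange i t).1) ((exchange i t).1 i).2 (blockDesc J (exchange i t).1) := by
    rintro ⟨ω, z, w⟩
    have e1 : past i ω = past i (exchange i (ω, z, w)).1 := by
      rw [past_eq_iff]
      refine ⟨fun j => rfl, fun j hj => ?_, fun j hj => ?_⟩
      · simp only [exchange, hj, if_false]
        split_ifs <;> rfl
      · simp [exchange, hj.ne, hj]
    have e2 : (fun k => spliceDesc J i ω k w (z.2 k)) = blockDesc J (exchange i (ω, z, w)).1 := by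
      funext k
      unfold spliceDesc blockDesc
      congr 1
      funext j
      rcases lt_trichotomy j i with h | h | h
      · simp [splice, exchange, h, h.ne]
      · simp [splice, exchange, h]
      · simp [splice, exchange, h.ne', h.not_gt]
    dsimp only
    rw [← e1, e2]
    simp [exchange]
  symm
  calc _ = ∑ t : (Fin n → γ × Letters 𝒳 𝒴) × Letters 𝒳 𝒴 × (Fin n → ∀ k, 𝒴 k),
        blockWeight ch pQ pX (exchange i t).1 *
          systemWeight ch (fun l => pX l ((exchange i t).1 i).1)
            (futureWeight ch x₀ i (exchange i t).1) (exchange i t).2 *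
          φ (past i (exchange i t).1) ((exchange i t).1 i).2 (blockDesc J (exchange i t).1) :=
        Finset.sum_congr rfl fun t _ => by rw [weight_exchange, h1]
    _ = ∑ t : (Fin n → γ × Letters 𝒳 𝒴) × Letters 𝒳 𝒴 × (Fin n → ∀ k, 𝒴 k),
        blockWeight ch pQ pX t.1 * systemWeight ch (fun l => pX l (t.1 i).1)
          (futureWeight ch x₀ i t.1) t.2 * φ (past i t.1) (t.1 i).2 (blockDesc J t.1) :=
        Equiv.sum_comp (Function.Involutive.toPerm _ (exchange_involutive i)) (fun t =>
          blockWeight ch pQ pX t.1 * systemWeight ch (fun l => pX l (t.1 i).1)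
          (futureWeight ch x₀ i t.1) t.2 * φ (past i t.1) (t.1 i).2 (blockDesc J t.1))
    _ = _ := by
        rw [Fintype.sum_prod_type]
        refine Finset.sum_congr rfl fun ω _ => ?_
        simp only
        rw [← Finset.sum_mul, ← Finset.mul_sum,
          sum_systemWeight hch (fun l => hX l _) (futureWeight_mem hch x₀ i ω), mul_one]

/-- The single-letter system at time `i` given the past in `ω`. -/
def blockConfig (hch : ∀ x, ch x ∈ stdSimplex ℝ (∀ k, 𝒴 k))
    (hX : ∀ l q, pX l q ∈ stdSimplex ℝ (𝒳 l)) (J : ∀ k, (Fin n → 𝒴 k) → (Fin n → γ) → ι k)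
    (x₀ : ∀ l, 𝒳 l) (i : Fin n) (ω : Fin n → γ × Letters 𝒳 𝒴) : Config 𝒳 𝒴 :=
  systemConfig hch (fun l => hX l (ω i).1) (futureWeight_mem hch x₀ i ω) (spliceDesc J i ω)

/-- A multi-letter conditional entropy of the letters at time `i` given the past is an average over
the past of single-letter coalition entropies. -/
theorem cent_block_eq {α β : Type*} (hch : ∀ x, ch x ∈ stdSimplex ℝ (∀ k, 𝒴 k))
    (hQ : pQ ∈ stdSimplex ℝ γ) (hX : ∀ l q, pX l q ∈ stdSimplex ℝ (𝒳 l))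
    (J : ∀ k, (Fin n → 𝒴 k) → (Fin n → γ) → ι k) (x₀ : ∀ l, 𝒳 l) (i : Fin n)
    (A : Finset (Fin K)) (f : Letters 𝒳 𝒴 → α) (g : Letters 𝒳 𝒴 → β) :
    cent (blockWeight ch pQ pX) (fun ω => f (ω i).2)
        (fun ω => ((g (ω i).2, blockCoalitionDesc J A ω), past i ω)) =
      ∑ ω, blockWeight ch pQ pX ω * coalitionEntropy ch (blockConfig hch hX J x₀ i ω) A f g := by
  unfold blockConfig
  simp_rw [coalitionEntropy_systemConfig]
  rw [← cent_eq_sum_cent (blockWeight_nonneg hch hQ hX) (V := past i)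
    (κ := fun ω => systemWeight ch (fun l => pX l (ω i).1) (futureWeight ch x₀ i ω))
    (fun ω => systemWeight_nonneg hch (fun l => hX l _) (futureWeight_mem hch x₀ i ω))
    (fun ω _ => sum_systemWeight hch (fun l => hX l _) (futureWeight_mem hch x₀ i ω))
    (fun _ x => f x.1) (fun ω x => (g x.1, coalitionDesc (spliceDesc J i ω) A x))]
  · refine cent_congr_law fun φ => ?_
    have := sum_resample (pQ := pQ) hch hX J x₀ i
      (fun v z j => φ (f z) ((g z, fun k => if k ∈ A then some (j k) else none), v))
    refine this.trans (Finset.sum_congr rfl fun t _ => ?_)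
    congr 4
    funext k
    by_cases hk : k ∈ A <;> simp [coalitionDesc, desc, restr, hk]
  · intro ω ω' h
    obtain ⟨h1, h2, h3⟩ := past_eq_iff.1 h
    have hJ : spliceDesc J i ω = spliceDesc J i ω' := by
      funext k w y
      unfold spliceDesc splice
      congr 1
      · funext j
        by_cases hj : j < i
        · simp [hj, h3 j hj]
        · simp [hj]
      · exact funext h1
    have hF : futureWeight ch x₀ i ω = futureWeight ch x₀ i ω' := by
      funext w
      unfold futureWeight
      refine Finset.prod_congr rfl fun j _ => ?_
      by_cases hj : j = i
      · simp [hj]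
      · simp [hj, h2 j hj]
    exact ⟨by simp only [h1, hF], rfl, by simp only [hJ]⟩

/-- The letters at time `i` depend on the past only through the time-sharing letter. -/
theorem cent_letter_eq {α β : Type*} (hch : ∀ x, ch x ∈ stdSimplex ℝ (∀ k, 𝒴 k))
    (hQ : pQ ∈ stdSimplex ℝ γ) (hX : ∀ l q, pX l q ∈ stdSimplex ℝ (𝒳 l))
    (J : ∀ k, (Fin n → 𝒴 k) → (Fin n → γ) → ι k) (x₀ : ∀ l, 𝒳 l) (i : Fin n)
    (f : Letters 𝒳 𝒴 → α) (g : Letters 𝒳 𝒴 → β) :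
    cent (blockWeight ch pQ pX) (fun ω => f (ω i).2) (fun ω => (g (ω i).2, (ω i).1)) =
      ∑ ω, blockWeight ch pQ pX ω * coalitionEntropy ch (blockConfig hch hX J x₀ i ω) ∅ f g := by
  have h0 : ∀ ω, coalitionEntropy ch (blockConfig hch hX J x₀ i ω) ∅ f g =
      cent (letterProb ch fun l => pX l (ω i).1) f g := fun ω => if_pos rfl
  simp_rw [h0]
  rw [← cent_eq_sum_cent (blockWeight_nonneg hch hQ hX) (V := fun ω => (ω i).1)
    (κ := fun ω => letterProb ch (fun l => pX l (ω i).1))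
    (fun ω => letterProb_nonneg hch (fun l => hX l _))
    (fun ω _ => sum_letterProb hch (fun l => hX l _))
    (fun _ => f) (fun _ => g) (fun ω ω' h => by simp only [h]; simp)]
  refine cent_congr_law fun φ => ?_
  have := sum_resample (pQ := pQ) hch hX J x₀ i (fun v z _ => φ (f z) (g z, (v i).1))
  refine this.trans ?_
  rw [Fintype.sum_prod_type, Fintype.sum_prod_type]
  refine Finset.sum_congr rfl fun ω _ => ?_
  rw [Fintype.sum_prod_type (α₁ := Letters 𝒳 𝒴) (α₂ := Fin n → ∀ k, 𝒴 k)]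
  refine Finset.sum_congr rfl fun z _ => ?_
  simp only [systemWeight, past]
  rw [← Finset.sum_mul, ← Finset.mul_sum, ← Finset.mul_sum, (futureWeight_mem hch x₀ i ω).2,
    mul_one]

end Block

/-! ### Splitting multi-letter entropies over time -/

section BlockBound

variable {L K : ℕ} {𝒳 : Fin L → Type*} [∀ l, Fintype (𝒳 l)] {𝒴 : Fin K → Type*}
  [∀ k, Fintype (𝒴 k)] {γ : Type*} [Fintype γ] {ι : Fin K → Type*} {n : ℕ}

/-- The input sequences of the users in `T`. -/
def blockInputs (T : Finset (Fin L)) (ω : Fin n → γ × Letters 𝒳 𝒴) : Fin n → ∀ l : T, 𝒳 l :=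
  fun i => inputs T (ω i).2

/-- The input sequences of the users in `T` and the time-sharing sequence. -/
def sideInfo (T : Finset (Fin L)) (ω : Fin n → γ × Letters 𝒳 𝒴) :
    (Fin n → ∀ l : T, 𝒳 l) × (Fin n → γ) :=
  (blockInputs T ω, fun i => (ω i).1)

/-- All input sequences and the time-sharing sequence. -/
def fullInfo (ω : Fin n → γ × Letters 𝒳 𝒴) : (Fin n → ∀ l, 𝒳 l) × (Fin n → γ) :=
  (fun i => (ω i).2.1, fun i => (ω i).1)

theorem blockCoalitionDesc_eq_iff {J : ∀ k, (Fin n → 𝒴 k) → (Fin n → γ) → ι k}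
    {A : Finset (Fin K)} {ω ω' : Fin n → γ × Letters 𝒳 𝒴} :
    blockCoalitionDesc J A ω = blockCoalitionDesc J A ω' ↔
      ∀ k ∈ A, blockDesc J ω k = blockDesc J ω' k := by
  constructor
  · intro h k hk
    have := congrFun h k
    simpa [blockCoalitionDesc, hk] using this
  · intro h
    funext k
    by_cases hk : k ∈ A
    · simp [blockCoalitionDesc, hk, h k hk]
    · simp [blockCoalitionDesc, hk]

theorem sideInfo_eq_iff {T : Finset (Fin L)} {ω ω' : Fin n → γ × Letters 𝒳 𝒴} :
    sideInfo T ω = sideInfo T ω' ↔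
      (∀ i, inputs T (ω i).2 = inputs T (ω' i).2) ∧ ∀ i, (ω i).1 = (ω' i).1 := by
  simp [sideInfo, blockInputs, funext_iff]

theorem fullInfo_eq_iff {ω ω' : Fin n → γ × Letters 𝒳 𝒴} :
    fullInfo ω = fullInfo ω' ↔ (∀ i, (ω i).2.1 = (ω' i).2.1) ∧ ∀ i, (ω i).1 = (ω' i).1 := by
  simp [fullInfo, funext_iff]

theorem inputs_eq_iff {T : Finset (Fin L)} {z z' : Letters 𝒳 𝒴} :
    inputs T z = inputs T z' ↔ ∀ l ∈ T, z.1 l = z'.1 l := by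
  simp [inputs, funext_iff]

theorem fst_eq_iff_inputs (T : Finset (Fin L)) {z z' : Letters 𝒳 𝒴} :
    z.1 = z'.1 ↔ inputs T z = inputs T z' ∧ inputs Tᶜ z = inputs Tᶜ z' := by
  simp only [inputs_eq_iff, Finset.mem_compl]
  refine ⟨fun h => ⟨fun l _ => by rw [h], fun l _ => by rw [h]⟩, fun h => funext fun l => ?_⟩
  by_cases hl : l ∈ T
  exacts [h.1 l hl, h.2 l hl]

variable {ch : (∀ l, 𝒳 l) → (∀ k, 𝒴 k) → ℝ} {pQ : γ → ℝ} {pX : ∀ l, γ → 𝒳 l → ℝ}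

/-- The information that the descriptions of a coalition give about the inputs single-letterizes
by the chain rule in the inputs. -/
theorem input_info_le (hch : ∀ x, ch x ∈ stdSimplex ℝ (∀ k, 𝒴 k))
    (hQ : pQ ∈ stdSimplex ℝ γ) (hX : ∀ l q, pX l q ∈ stdSimplex ℝ (𝒳 l))
    (J : ∀ k, (Fin n → 𝒴 k) → (Fin n → γ) → ι k) (x₀ : ∀ l, 𝒳 l)
    (T : Finset (Fin L)) (A : Finset (Fin K)) :
    cent (blockWeight ch pQ pX) (blockCoalitionDesc J A) (sideInfo Tᶜ) -
        cent (blockWeight ch pQ pX) (blockCoalitionDesc J A) fullInfo ≤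
      ∑ i, ((∑ ω, blockWeight ch pQ pX ω *
          coalitionEntropy ch (blockConfig hch hX J x₀ i ω) ∅ (inputs T) (inputs Tᶜ)) -
        ∑ ω, blockWeight ch pQ pX ω *
          coalitionEntropy ch (blockConfig hch hX J x₀ i ω) A (inputs T) (inputs Tᶜ)) := by
  set p := blockWeight (n := n) ch pQ pX with hpdef
  have hp : ∀ ω, 0 ≤ p ω := blockWeight_nonneg hch hQ hX
  have hp1 : ∑ ω, p ω = 1 := sum_blockWeight hch hQ hX
  have hfull : ∀ ω ω' : Fin n → γ × Letters 𝒳 𝒴, fullInfo ω = fullInfo ω' ↔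
      blockInputs T ω = blockInputs T ω' ∧ sideInfo Tᶜ ω = sideInfo Tᶜ ω' := by
    intro ω ω'
    rw [fullInfo_eq_iff, sideInfo_eq_iff, ← and_assoc]
    refine and_congr_left fun _ => ?_
    simp only [fst_eq_iff_inputs T, blockInputs, funext_iff, forall_and]
  have e1 : cent p (blockCoalitionDesc J A) (sideInfo Tᶜ) - cent p (blockCoalitionDesc J A) fullInfo
      = cent p (blockInputs T) (sideInfo Tᶜ) -
        cent p (blockInputs T) (fun ω => (blockCoalitionDesc J A ω, sideInfo Tᶜ ω)) := by
    unfold cent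
    rw [ent_congr_iff p (A := fullInfo) (B := fun ω => (blockInputs T ω, sideInfo Tᶜ ω))
      (fun ω ω' => by simp only [Prod.mk.injEq, hfull]),
      ent_congr_iff p (A := fun ω => (blockCoalitionDesc J A ω, fullInfo ω))
      (B := fun ω => (blockInputs T ω, blockCoalitionDesc J A ω, sideInfo Tᶜ ω))
      (fun ω ω' => by simp only [Prod.mk.injEq, hfull]; tauto)]
    ring
  rw [e1, cent_chain_fin, cent_chain_fin, ← Finset.sum_sub_distrib]
  refine Finset.sum_le_sum fun i _ => sub_le_sub ?_ ?_
  · rw [← cent_letter_eq hch hQ hX J x₀ i]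
    refine cent_anti hp hp1 _ fun ω ω' h => ?_
    simp only [Prod.mk.injEq, sideInfo_eq_iff] at h ⊢
    exact ⟨h.2.1 i, h.2.2 i⟩
  · rw [← cent_block_eq hch hQ hX J x₀ i]
    refine cent_anti hp hp1 _ fun ω ω' h => ?_
    simp only [Prod.mk.injEq, sideInfo_eq_iff, past_eq_iff, pre_eq_pre_iff] at h ⊢
    obtain ⟨⟨h1, h2⟩, h3, h4, h5⟩ := h
    refine ⟨fun j hj => ?_, h2, fun j => ?_, h3⟩
    · exact ((fst_eq_iff_inputs T).1 (h4 j (by rintro rfl; exact lt_irrefl _ hj))).1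
    · by_cases hj : j = i
      · rw [hj]; exact h1
      · exact ((fst_eq_iff_inputs T).1 (h4 j hj)).2

/-- The rate that the relays in `S` spend on describing their outputs single-letterizes by the
chain rule in the outputs of all relays. -/
theorem output_info_le (hch : ∀ x, ch x ∈ stdSimplex ℝ (∀ k, 𝒴 k))
    (hQ : pQ ∈ stdSimplex ℝ γ) (hX : ∀ l q, pX l q ∈ stdSimplex ℝ (𝒳 l))
    (J : ∀ k, (Fin n → 𝒴 k) → (Fin n → γ) → ι k) (x₀ : ∀ l, 𝒳 l) (S : Finset (Fin K)) :
    ∑ i, ((∑ ω, blockWeight ch pQ pX ω *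
          coalitionEntropy ch (blockConfig hch hX J x₀ i ω) Sᶜ (outputs S) Prod.fst) -
        ∑ ω, blockWeight ch pQ pX ω * coalitionEntropy ch (blockConfig hch hX J x₀ i ω)
          Finset.univ (outputs S) Prod.fst) ≤
      cent (blockWeight ch pQ pX) (blockCoalitionDesc J S)
        (fun ω => (blockCoalitionDesc J Sᶜ ω, fullInfo ω)) := by
  set p := blockWeight (n := n) ch pQ pX with hpdef
  have hp : ∀ ω, 0 ≤ p ω := blockWeight_nonneg hch hQ hX
  have hp1 : ∑ ω, p ω = 1 := sum_blockWeight hch hQ hX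
  set Y : (Fin n → γ × Letters 𝒳 𝒴) → Fin n → ∀ k, 𝒴 k := fun ω i => (ω i).2.2 with hY
  set G : (Fin n → γ × Letters 𝒳 𝒴) → _ := fun ω => (blockCoalitionDesc J Sᶜ ω, fullInfo ω) with hG
  have hJ : ∀ ω ω' : Fin n → γ × Letters 𝒳 𝒴, Y ω = Y ω' → fullInfo ω = fullInfo ω' →
      blockDesc J ω = blockDesc J ω' := by
    intro ω ω' h h'
    have h2 := (fullInfo_eq_iff.1 h').2
    funext k
    unfold blockDesc
    congr 1
    · funext j
      exact congrFun (congrFun h j) k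
    · exact funext h2
  have e1 : cent p (blockCoalitionDesc J S) G =
      cent p Y G - cent p Y (fun ω => (blockCoalitionDesc J S ω, G ω)) := by
    unfold cent
    rw [ent_congr_iff p (A := fun ω => (Y ω, blockCoalitionDesc J S ω, G ω))
      (B := fun ω => (Y ω, G ω)) (fun ω ω' => by
        simp only [Prod.mk.injEq, hG]
        refine ⟨fun h => ⟨h.1, h.2.2⟩, fun h => ⟨h.1, ?_, h.2⟩⟩
        exact blockCoalitionDesc_eq_iff.2 fun k _ => congrFun (hJ _ _ h.1 h.2.2) k)]
    ring
  rw [e1, cent_chain_fin, cent_chain_fin, ← Finset.sum_sub_distrib]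
  refine Finset.sum_le_sum fun i _ => ?_
  rw [← cent_block_eq hch hQ hX J x₀ i, ← cent_block_eq hch hQ hX J x₀ i]
  set G1 : (Fin n → γ × Letters 𝒳 𝒴) → _ := fun ω => (pre i (Y ω), G ω) with hG1
  set G2 : (Fin n → γ × Letters 𝒳 𝒴) → _ :=
    fun ω => (pre i (Y ω), blockCoalitionDesc J S ω, G ω) with hG2
  have hsplit : ∀ {δ : Type _} (H : (Fin n → γ × Letters 𝒳 𝒴) → δ), cent p (fun ω => Y ω i) H =
      cent p (fun ω => outputs S (ω i).2) H +
        cent p (fun ω => Y ω i) (fun ω => (outputs S (ω i).2, H ω)) := by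
    intro δ H
    rw [← cent_chain]
    refine cent_congr_iff p (fun _ _ => Iff.rfl) fun ω ω' _ => ?_
    simp only [Prod.mk.injEq, hY]
    exact ⟨fun h => ⟨funext fun k => congrFun h k, h⟩, fun h => h.2⟩
  rw [hsplit G1, hsplit G2]
  have h3 : cent p (fun ω => Y ω i) (fun ω => (outputs S (ω i).2, G2 ω)) ≤
      cent p (fun ω => Y ω i) (fun ω => (outputs S (ω i).2, G1 ω)) :=
    cent_anti hp hp1 _ fun ω ω' h => by
      simp only [Prod.mk.injEq, hG1, hG2] at h ⊢
      exact ⟨h.1, h.2.1, h.2.2.2⟩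
  have hpast : ∀ ω ω' : Fin n → γ × Letters 𝒳 𝒴,
      ((ω i).2.1 = (ω' i).2.1 ∧ past i ω = past i ω') ↔
        (pre i (Y ω) = pre i (Y ω') ∧ fullInfo ω = fullInfo ω') := by
    intro ω ω'
    rw [past_eq_iff, fullInfo_eq_iff, pre_eq_pre_iff]
    constructor
    · rintro ⟨h1, h2, h3, h4⟩
      refine ⟨fun j hj => h4 j hj, fun j => ?_, h2⟩
      by_cases hj : j = i
      · rw [hj]; exact h1
      · exact h3 j hj
    · rintro ⟨h1, h2, h3⟩
      exact ⟨h2 i, h3, fun j _ => h2 j, fun j hj => h1 j hj⟩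
  have e2 : cent p (fun ω => outputs S (ω i).2)
      (fun ω => (((ω i).2.1, blockCoalitionDesc J Sᶜ ω), past i ω)) =
      cent p (fun ω => outputs S (ω i).2) G1 :=
    cent_congr_iff p (fun ω ω' => by
      have := hpast ω ω'
      simp only [Prod.mk.injEq, hG1, hG]
      tauto) (fun _ _ _ => Iff.rfl)
  have e3 : cent p (fun ω => outputs S (ω i).2)
      (fun ω => (((ω i).2.1, blockCoalitionDesc J Finset.univ ω), past i ω)) =
      cent p (fun ω => outputs S (ω i).2) G2 :=
    cent_congr_iff p (fun ω ω' => by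
      have := hpast ω ω'
      have h4 : blockCoalitionDesc J Finset.univ ω = blockCoalitionDesc J Finset.univ ω' ↔
          blockCoalitionDesc J S ω = blockCoalitionDesc J S ω' ∧
          blockCoalitionDesc J Sᶜ ω = blockCoalitionDesc J Sᶜ ω' := by
        simp only [blockCoalitionDesc_eq_iff, Finset.mem_compl]
        refine ⟨fun h => ⟨fun k _ => h k (Finset.mem_univ k), fun k _ => h k (Finset.mem_univ k)⟩,
          fun h k _ => ?_⟩
        by_cases hk : k ∈ S
        exacts [h.1 k hk, h.2 k hk]
      simp only [Prod.mk.injEq, hG2, hG, h4]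
      tauto) (fun _ _ _ => Iff.rfl)
  rw [e2, e3]
  linarith

/-- The multi-letter bound on the rates of the users in `T` is at most the fronthaul rate of the
relays in `S` plus the sum over time of average single-letter bounds. -/
theorem block_bound [∀ k, Fintype (ι k)] [∀ k, Nonempty (ι k)]
    (hch : ∀ x, ch x ∈ stdSimplex ℝ (∀ k, 𝒴 k))
    (hQ : pQ ∈ stdSimplex ℝ γ) (hX : ∀ l q, pX l q ∈ stdSimplex ℝ (𝒳 l))
    (J : ∀ k, (Fin n → 𝒴 k) → (Fin n → γ) → ι k) (x₀ : ∀ l, 𝒳 l)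
    (T : Finset (Fin L)) (S : Finset (Fin K)) :
    cent (blockWeight ch pQ pX) (blockDesc J) (sideInfo Tᶜ) -
        cent (blockWeight ch pQ pX) (blockDesc J) fullInfo ≤
      ∑ k ∈ S, Real.log (Fintype.card (ι k)) +
      ∑ i, ∑ ω, blockWeight ch pQ pX ω * boundVector ch (blockConfig hch hX J x₀ i ω) (T, S) := by
  classical
  set p := blockWeight (n := n) ch pQ pX with hpdef
  have hp : ∀ ω, 0 ≤ p ω := blockWeight_nonneg hch hQ hX
  have hp1 : ∑ ω, p ω = 1 := sum_blockWeight hch hQ hX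
  have hsplit : ∀ {δ : Type _} (H : (Fin n → γ × Letters 𝒳 𝒴) → δ), cent p (blockDesc J) H =
      cent p (blockCoalitionDesc J Sᶜ) H +
        cent p (blockCoalitionDesc J S) (fun ω => (blockCoalitionDesc J Sᶜ ω, H ω)) := by
    intro δ H
    rw [← cent_chain]
    refine cent_congr_iff p (fun _ _ => Iff.rfl) fun ω ω' _ => ?_
    simp only [Prod.mk.injEq, blockCoalitionDesc_eq_iff, Finset.mem_compl]
    refine ⟨fun h => ⟨fun k _ => by rw [h], fun k _ => by rw [h]⟩, fun h => funext fun k => ?_⟩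
    by_cases hk : k ∈ S
    exacts [h.2 k hk, h.1 k hk]
  have h1 := input_info_le hch hQ hX J x₀ T Sᶜ
  have h2 := output_info_le hch hQ hX J x₀ S
  have h3 : cent p (blockCoalitionDesc J S)
      (fun ω => (blockCoalitionDesc J Sᶜ ω, sideInfo Tᶜ ω)) ≤
      ∑ k ∈ S, Real.log (Fintype.card (ι k)) := by
    have := cent_le_log_card hp hp1 (fun ω (k : S) => blockDesc J ω k)
      (fun ω => (blockCoalitionDesc J Sᶜ ω, sideInfo Tᶜ ω))
    rw [Fintype.card_pi, Nat.cast_prod, Real.log_prod] at this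
    · rw [← Finset.sum_coe_sort S fun k => Real.log (Fintype.card (ι k))]
      refine le_trans (le_of_eq ?_) this
      refine cent_congr_iff p (fun _ _ => Iff.rfl) fun ω ω' _ => ?_
      rw [blockCoalitionDesc_eq_iff, funext_iff]
      simp
    · intro k _
      exact_mod_cast Fintype.card_ne_zero
  rw [hsplit, hsplit fullInfo]
  have h4 : ∑ i, ∑ ω, p ω * boundVector ch (blockConfig hch hX J x₀ i ω) (T, S) =
      ∑ i, ((∑ ω, p ω *
          coalitionEntropy ch (blockConfig hch hX J x₀ i ω) ∅ (inputs T) (inputs Tᶜ)) -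
        ∑ ω, p ω *
          coalitionEntropy ch (blockConfig hch hX J x₀ i ω) Sᶜ (inputs T) (inputs Tᶜ)) -
      ∑ i, ((∑ ω, p ω *
          coalitionEntropy ch (blockConfig hch hX J x₀ i ω) Sᶜ (outputs S) Prod.fst) -
        ∑ ω, p ω * coalitionEntropy ch (blockConfig hch hX J x₀ i ω)
          Finset.univ (outputs S) Prod.fst) := by
    rw [← Finset.sum_sub_distrib]
    refine Finset.sum_congr rfl fun i _ => ?_
    simp only [← Finset.sum_sub_distrib]
    refine Finset.sum_congr rfl fun ω _ => ?_
    unfold boundVector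
    ring
  rw [h4]
  linarith

end BlockBound

/-! ### The rates of a code -/

theorem ent_const {Ω α : Type*} [Fintype Ω] {p : Ω → ℝ} (hp1 : ∑ ω, p ω = 1) (a : α) :
    ent p (fun _ => a) = 0 := by
  classical
  simp [ent, pr, hp1]

theorem ent_le_log_card {Ω α : Type*} [Fintype Ω] [Fintype α] [Nonempty α] {p : Ω → ℝ}
    (hp : ∀ ω, 0 ≤ p ω) (hp1 : ∑ ω, p ω = 1) (A : Ω → α) :
    ent p A ≤ Real.log (Fintype.card α) := by
  have h := cent_le_log_card hp hp1 A (fun _ => ())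
  rw [cent, ent_const hp1 (), sub_zero] at h
  refine le_trans (le_of_eq (ent_congr_iff p fun ω ω' => by simp)) h

theorem ent_uniform {α : Type*} [Fintype α] [Nonempty α] :
    ent (fun _ : α => (Fintype.card α : ℝ)⁻¹) (fun a => a) = Real.log (Fintype.card α) := by
  classical
  have hc : (Fintype.card α : ℝ) ≠ 0 := by exact_mod_cast Fintype.card_ne_zero
  simp [ent, pr, hc]

section CodeBound

variable {L K : ℕ} {𝒳 : Fin L → Type*} [∀ l, Fintype (𝒳 l)] {𝒴 : Fin K → Type*}
  [∀ k, Fintype (𝒴 k)] {C : Fin K → ℝ} {n : ℕ} {M : Fin L → ℕ}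

/-- The time-sharing sequence, the codebook indices and the messages of a code. -/
abbrev Code.Inputs (c : Code 𝒳 𝒴 C n M) : Type :=
  ((Fin n → Fin c.nQ) × (∀ l, Fin (Fintype.card (𝒳 l) ^ (n * M l)))) × (∀ l, Fin (M l))

/-- The law of the time-sharing sequence and the codebook indices. -/
def Code.bookWeight (c : Code 𝒳 𝒴 C n M)
    (s : (Fin n → Fin c.nQ) × (∀ l, Fin (Fintype.card (𝒳 l) ^ (n * M l)))) : ℝ :=
  (∏ i, c.pQ (s.1 i)) * ∏ l, c.codebookProb l (s.2 l) s.1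

/-- The joint law of the time-sharing sequence, the codebook indices and the messages. -/
def Code.inputWeight (c : Code 𝒳 𝒴 C n M) (t : c.Inputs) : ℝ :=
  c.bookWeight t.1 * ∏ l, ((M l : ℝ))⁻¹

/-- The transmitted codewords. -/
def Code.codewords (c : Code 𝒳 𝒴 C n M) (t : c.Inputs) (i : Fin n) : ∀ l, 𝒳 l :=
  fun l => c.enc l (t.1.2 l) (t.2 l) t.1.1 i

/-- The memoryless extension of the channel. -/
def blockChannel (ch : (∀ l, 𝒳 l) → (∀ k, 𝒴 k) → ℝ) (x : Fin n → ∀ l, 𝒳 l)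
    (y : Fin n → ∀ k, 𝒴 k) : ℝ := ∏ i, ch (x i) (y i)

/-- The time-sharing letters, channel inputs and channel outputs of a transmission. -/
def Code.block (c : Code 𝒳 𝒴 C n M) (t : c.Inputs × (Fin n → ∀ k, 𝒴 k)) :
    Fin n → Fin c.nQ × Letters 𝒳 𝒴 :=
  fun i => (t.1.1.1 i, c.codewords t.1 i, t.2 i)

/-- The joint law of everything in a transmission. -/
def Code.weight (c : Code 𝒳 𝒴 C n M) (ch : (∀ l, 𝒳 l) → (∀ k, 𝒴 k) → ℝ)
    (t : c.Inputs × (Fin n → ∀ k, 𝒴 k)) : ℝ :=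
  c.inputWeight t.1 * blockChannel ch (c.codewords t.1) t.2

/-- One codeword of a codebook with independent codewords has the law of the codewords. -/
theorem sum_codebooks {β : Fin L → Type*} [∀ l, Fintype (β l)] (m : ∀ l, Fin (M l))
    {w : ∀ l, β l → ℝ} (hw : ∀ l, ∑ b, w l b = 1) (ψ : (∀ l, β l) → ℝ) :
    ∑ cb : (∀ l, Fin (M l) → β l), (∏ l, ∏ j, w l (cb l j)) * ψ (fun l => cb l (m l)) =
      ∑ x : (∀ l, β l), (∏ l, w l (x l)) * ψ x := by
  classical
  have h1 : ∀ x : (∀ l, β l), ∑ cb : (∀ l, Fin (M l) → β l),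
      (if (fun l => cb l (m l)) = x then ∏ l, ∏ j, w l (cb l j) else 0) = ∏ l, w l (x l) := by
    intro x
    have h2 : ∀ cb : (∀ l, Fin (M l) → β l),
        (if (fun l => cb l (m l)) = x then ∏ l, ∏ j, w l (cb l j) else 0) =
        ∏ l, ∏ j, if j = m l ∧ cb l j ≠ x l then 0 else w l (cb l j) := by
      intro cb
      split_ifs with h
      · refine Finset.prod_congr rfl fun l _ => Finset.prod_congr rfl fun j _ => ?_
        rw [if_neg]
        rintro ⟨rfl, h'⟩
        exact h' (congrFun h l)
      · rw [funext_iff, not_forall] at h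
        obtain ⟨l, hl⟩ := h
        refine (Finset.prod_eq_zero (Finset.mem_univ l) ?_).symm
        exact Finset.prod_eq_zero (Finset.mem_univ (m l)) (if_pos ⟨rfl, hl⟩)
    simp_rw [h2]
    rw [← Fintype.prod_sum fun l (b : Fin (M l) → β l) =>
      ∏ j, if j = m l ∧ b j ≠ x l then 0 else w l (b j)]
    refine Finset.prod_congr rfl fun l _ => ?_
    rw [← Fintype.prod_sum fun (j : Fin (M l)) (b : β l) =>
      if j = m l ∧ b ≠ x l then 0 else w l b]
    rw [Finset.prod_eq_single (m l)]
    · rw [Finset.sum_eq_single (x l)]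
      · simp
      · intro b _ hb
        simp [hb]
      · simp
    · intro j _ hj
      simp [hj, hw]
    · simp
  simp_rw [← h1, Finset.sum_mul]
  rw [Finset.sum_comm]
  refine Finset.sum_congr rfl fun cb _ => ?_
  simp [ite_mul]

variable {ch : (∀ l, 𝒳 l) → (∀ k, 𝒴 k) → ℝ}

/-- Since the codebook index runs over all codebooks, with the law of independent codewords, the
transmitted letters are independent over time given the time-sharing sequence. -/
theorem Code.sum_weight (c : Code 𝒳 𝒴 C n M) (φ : (Fin n → Fin c.nQ × Letters 𝒳 𝒴) → ℝ) :
    ∑ t, c.weight ch t * φ (c.block t) = ∑ ω, blockWeight ch c.pQ c.pX ω * φ ω := by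
  classical
  set Φ : (Fin n → Fin c.nQ) → (∀ l, Fin n → 𝒳 l) → ℝ := fun q x =>
    ∑ y : Fin n → ∀ k, 𝒴 k, blockChannel ch (fun i l => x l i) y *
      φ (fun i => (q i, fun l => x l i, y i)) with hΦ
  have h1 : ∑ t, c.weight ch t * φ (c.block t) =
      ∑ q : Fin n → Fin c.nQ, ∑ m : (∀ l, Fin (M l)), (∏ i, c.pQ (q i)) * (∏ l, ((M l : ℝ))⁻¹) *
        ∑ f : (∀ l, Fin (Fintype.card (𝒳 l) ^ (n * M l))), (∏ l, c.codebookProb l (f l) q) *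
          Φ q (fun l => c.enc l (f l) (m l) q) := by
    rw [Fintype.sum_prod_type, Fintype.sum_prod_type, Fintype.sum_prod_type]
    refine Finset.sum_congr rfl fun q _ => ?_
    rw [Finset.sum_comm]
    refine Finset.sum_congr rfl fun m _ => ?_
    rw [Finset.mul_sum]
    refine Finset.sum_congr rfl fun f _ => ?_
    simp only [hΦ, Finset.mul_sum]
    refine Finset.sum_congr rfl fun y _ => ?_
    simp only [Code.weight, Code.inputWeight, Code.bookWeight]
    change _ * blockChannel ch (fun i l => c.enc l (f l) (m l) q i) y *
      φ (fun i => (q i, fun l => c.enc l (f l) (m l) q i, y i)) = _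
    ring
  have h2 : ∀ (q : Fin n → Fin c.nQ) (m : ∀ l, Fin (M l)),
      ∑ f : (∀ l, Fin (Fintype.card (𝒳 l) ^ (n * M l))), (∏ l, c.codebookProb l (f l) q) *
          Φ q (fun l => c.enc l (f l) (m l) q) =
        ∑ x : (∀ l, Fin n → 𝒳 l), (∏ l, ∏ i, c.pX l (q i) (x l i)) * Φ q x := by
    intro q m
    rw [← sum_codebooks m (w := fun l (x : Fin n → 𝒳 l) => ∏ i, c.pX l (q i) (x i))]
    · refine Fintype.sum_equiv
        (Equiv.piCongrRight fun l => Equiv.ofBijective _ (c.enc_bijective l q)) _ _ fun f => ?_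
      rfl
    · intro l
      rw [← Fintype.prod_sum fun (i : Fin n) (x : 𝒳 l) => c.pX l (q i) x]
      exact Finset.prod_eq_one fun i _ => (c.pX_mem l _).2
  rw [h1]
  simp_rw [h2]
  have h3 : ∏ l, ((M l : ℝ))⁻¹ * (M l : ℝ) = 1 := Finset.prod_eq_one fun l _ =>
    inv_mul_cancel₀ (by exact_mod_cast (c.M_pos l).ne')
  have h4 : ∀ a b : ℝ, ∑ _m : (∀ l, Fin (M l)), a * (∏ l, ((M l : ℝ))⁻¹) * b = a * b := by
    intro a b
    rw [Finset.sum_const, Finset.card_univ, Fintype.card_pi]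
    simp only [Fintype.card_fin, nsmul_eq_mul, Nat.cast_prod]
    rw [Finset.prod_mul_distrib] at h3
    linear_combination a * b * h3
  simp_rw [h4]
  let e : (Fin n → Fin c.nQ) × (∀ l, Fin n → 𝒳 l) × (Fin n → ∀ k, 𝒴 k) ≃
      (Fin n → Fin c.nQ × Letters 𝒳 𝒴) :=
    { toFun := fun s i => (s.1 i, fun l => s.2.1 l i, s.2.2 i)
      invFun := fun ω => (fun i => (ω i).1, fun l i => (ω i).2.1 l, fun i => (ω i).2.2)
      left_inv := fun _ => rfl
      right_inv := fun _ => rfl }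
  rw [← Equiv.sum_comp e, Fintype.sum_prod_type]
  refine Finset.sum_congr rfl fun q _ => ?_
  rw [Fintype.sum_prod_type, Finset.mul_sum]
  refine Finset.sum_congr rfl fun x _ => ?_
  simp only [hΦ, Finset.mul_sum]
  refine Finset.sum_congr rfl fun y _ => ?_
  simp only [blockWeight, letterProb, blockChannel, e, Equiv.coe_fn_mk, Finset.prod_mul_distrib]
  rw [Finset.prod_comm]
  ring

theorem Code.bookWeight_nonneg (c : Code 𝒳 𝒴 C n M) (s) : 0 ≤ c.bookWeight s :=
  mul_nonneg (Finset.prod_nonneg fun _ _ => c.pQ_mem.1 _)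
    (Finset.prod_nonneg fun _ _ => Finset.prod_nonneg fun _ _ =>
      Finset.prod_nonneg fun _ _ => (c.pX_mem _ _).1 _)

theorem Code.inputWeight_nonneg (c : Code 𝒳 𝒴 C n M) (t) : 0 ≤ c.inputWeight t :=
  mul_nonneg (c.bookWeight_nonneg _) (Finset.prod_nonneg fun _ _ => by positivity)

theorem blockChannel_nonneg (hch : ∀ x, ch x ∈ stdSimplex ℝ (∀ k, 𝒴 k))
    (x : Fin n → ∀ l, 𝒳 l) (y) : 0 ≤ blockChannel ch x y :=
  Finset.prod_nonneg fun _ _ => (hch _).1 _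

theorem sum_blockChannel (hch : ∀ x, ch x ∈ stdSimplex ℝ (∀ k, 𝒴 k))
    (x : Fin n → ∀ l, 𝒳 l) : ∑ y, blockChannel ch x y = 1 := by
  classical
  unfold blockChannel
  rw [← Fintype.prod_sum fun (i : Fin n) (y : ∀ k, 𝒴 k) => ch (x i) y]
  exact Finset.prod_eq_one fun i _ => (hch _).2

theorem Code.weight_nonneg (c : Code 𝒳 𝒴 C n M) (hch : ∀ x, ch x ∈ stdSimplex ℝ (∀ k, 𝒴 k)) (t) :
    0 ≤ c.weight ch t :=
  mul_nonneg (c.inputWeight_nonneg _) (blockChannel_nonneg hch _ _)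

theorem Code.sum_weight_eq_one (c : Code 𝒳 𝒴 C n M)
    (hch : ∀ x, ch x ∈ stdSimplex ℝ (∀ k, 𝒴 k)) : ∑ t, c.weight ch t = 1 := by
  have := c.sum_weight (ch := ch) (fun _ => 1)
  simpa [sum_blockWeight hch c.pQ_mem c.pX_mem] using this

/-- The fronthaul indices that the relays send. -/
def Code.fronthaul (c : Code 𝒳 𝒴 C n M) (t : c.Inputs × (Fin n → ∀ k, 𝒴 k)) :
    ∀ k, Fin ⌊(2 : ℝ) ^ ((n : ℝ) * C k)⌋₊ :=
  blockDesc c.relay (c.block t)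

theorem Code.errorProb_eq (c : Code 𝒳 𝒴 C n M) :
    c.errorProb ch = ∑ t, c.weight ch t *
      if c.dec t.1.1.2 (c.fronthaul t) t.1.1.1 = t.1.2 then 0 else 1 := by
  unfold Code.errorProb
  rw [Fintype.sum_prod_type, Fintype.sum_prod_type, Fintype.sum_prod_type]
  refine Finset.sum_congr rfl fun q _ => Finset.sum_congr rfl fun f _ =>
    Finset.sum_congr rfl fun m _ => Finset.sum_congr rfl fun y _ => ?_
  rfl

/-- The messages of the users in `T` are uniform given everything but the outputs. -/
theorem Code.log_messages_le (c : Code 𝒳 𝒴 C n M) (hch : ∀ x, ch x ∈ stdSimplex ℝ (∀ k, 𝒴 k))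
    (T : Finset (Fin L)) :
    ∑ l ∈ T, Real.log (M l) ≤ cent (c.weight ch) (fun t (l : T) => t.1.2 l)
      (fun t => ((fun (l : (Tᶜ : Finset (Fin L))) => t.1.2 l), t.1.1)) := by
  classical
  have hne : ∀ l, Nonempty (Fin (M l)) := fun l => ⟨⟨0, c.M_pos l⟩⟩
  have hM : ∀ l, (M l : ℝ) ≠ 0 := fun l => by exact_mod_cast (c.M_pos l).ne'
  set u : (∀ l, Fin (M l)) → ℝ := fun _ => (Fintype.card (∀ l, Fin (M l)) : ℝ)⁻¹ with hu
  have hu0 : ∀ m, 0 ≤ u m := fun m => by positivity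
  have hu1 : ∑ m, u m = 1 := by
    have : (Fintype.card (∀ l, Fin (M l)) : ℝ) ≠ 0 := by exact_mod_cast Fintype.card_ne_zero
    simp only [hu, Finset.sum_const, Finset.card_univ, nsmul_eq_mul]
    exact mul_inv_cancel₀ this
  have hbook1 : ∑ s, c.bookWeight s = 1 := by
    have h := c.sum_weight_eq_one hch
    simp only [Code.weight] at h
    rw [Fintype.sum_prod_type] at h
    simp_rw [← Finset.mul_sum, sum_blockChannel hch, mul_one, Code.inputWeight] at h
    rw [Fintype.sum_prod_type] at h
    simp only [Finset.sum_const, Finset.card_univ, Fintype.card_pi, Fintype.card_fin,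
      nsmul_eq_mul, Nat.cast_prod] at h
    rw [← h]
    refine Finset.sum_congr rfl fun s _ => ?_
    rw [mul_left_comm, ← Finset.prod_mul_distrib,
      Finset.prod_eq_one fun l _ => mul_inv_cancel₀ (hM l), mul_one]
  have h1 : cent (c.weight ch) (fun t (l : T) => t.1.2 l)
      (fun t => ((fun (l : (Tᶜ : Finset (Fin L))) => t.1.2 l), t.1.1)) =
      cent u (fun m (l : T) => m l) (fun m (l : (Tᶜ : Finset (Fin L))) => m l) := by
    have h2 := cent_eq_sum_cent (p := c.bookWeight) c.bookWeight_nonneg (κ := fun _ => u)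
      (fun _ => hu0) (fun _ _ => hu1) (V := fun s => s) (fun _ m (l : T) => m l)
      (fun _ m (l : (Tᶜ : Finset (Fin L))) => m l) (fun s s' _ => by simp)
    rw [← Finset.sum_mul, hbook1, one_mul] at h2
    rw [← h2]
    refine cent_congr_law fun φ => ?_
    rw [Fintype.sum_prod_type]
    refine Finset.sum_congr rfl fun t _ => ?_
    simp only [Code.weight]
    rw [← Finset.sum_mul, ← Finset.mul_sum, sum_blockChannel hch, mul_one]
    simp only [Code.inputWeight, hu, Fintype.card_pi, Fintype.card_fin, Nat.cast_prod,
      Finset.prod_inv_distrib]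
  have h3 : ent u (fun m => ((fun (l : T) => m l), fun (l : (Tᶜ : Finset (Fin L))) => m l)) =
      ∑ l, Real.log (M l) := by
    have : ent u (fun m => ((fun (l : T) => m l), fun (l : (Tᶜ : Finset (Fin L))) => m l)) =
        ent u (fun m => m) := by
      refine ent_congr_iff u fun m m' => ?_
      simp only [Prod.mk.injEq, funext_iff, Subtype.forall, Finset.mem_compl]
      refine ⟨fun h l => ?_, fun h => ⟨fun l _ => h l, fun l _ => h l⟩⟩
      by_cases hl : l ∈ T
      exacts [h.1 l hl, h.2 l hl]
    rw [this, ent_uniform, Fintype.card_pi, Nat.cast_prod, Real.log_prod]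
    · simp
    · intro l _
      simpa using hM l
  have h4 : ent u (fun m (l : (Tᶜ : Finset (Fin L))) => m l) ≤ ∑ l ∈ Tᶜ, Real.log (M l) := by
    have := ent_le_log_card hu0 hu1 (fun m (l : (Tᶜ : Finset (Fin L))) => m l)
    rw [Fintype.card_pi, Nat.cast_prod, Real.log_prod] at this
    · refine this.trans_eq ?_
      rw [← Finset.sum_coe_sort Tᶜ fun l => Real.log (M l)]
      simp
    · intro l _
      simpa using hM l
  rw [h1, cent, h3]
  have := Finset.sum_add_sum_compl T fun l => Real.log (M l)
  linarith

/-- The converse up to multi-letter entropies: Fano's inequality, and the obliviousness of the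
relays, which makes the fronthaul indices depend on the codebooks and messages only through the
codewords. -/
theorem Code.log_messages_le_info (c : Code 𝒳 𝒴 C n M)
    (hch : ∀ x, ch x ∈ stdSimplex ℝ (∀ k, 𝒴 k)) (T : Finset (Fin L)) :
    (1 - c.errorProb ch) * ∑ l ∈ T, Real.log (M l) ≤ Real.log 2 +
      (cent (blockWeight ch c.pQ c.pX) (blockDesc c.relay) (sideInfo Tᶜ) -
        cent (blockWeight ch c.pQ c.pX) (blockDesc c.relay) fullInfo) := by
  classical
  have hne : ∀ l, Nonempty (Fin (M l)) := fun l => ⟨⟨0, c.M_pos l⟩⟩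
  have hM : ∀ l, (M l : ℝ) ≠ 0 := fun l => by exact_mod_cast (c.M_pos l).ne'
  have hp := c.weight_nonneg hch
  have hp1 := c.sum_weight_eq_one hch
  set p := c.weight ch with hpdef
  set mT : c.Inputs × (Fin n → ∀ k, 𝒴 k) → (∀ l : T, Fin (M l)) := fun t l => t.1.2 l with hmT
  set G : c.Inputs × (Fin n → ∀ k, 𝒴 k) → _ :=
    fun t => ((fun (l : (Tᶜ : Finset (Fin L))) => t.1.2 l), t.1.1) with hG
  have h1 : ∑ l ∈ T, Real.log (M l) ≤ cent p mT G := c.log_messages_le hch T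
  have h2 : cent p mT (fun t => (c.fronthaul t, G t)) ≤
      Real.log 2 + c.errorProb ch * ∑ l ∈ T, Real.log (M l) := by
    have ha := cent_anti hp hp1 mT (B := fun t => (c.fronthaul t, G t))
      (C := fun t => (t.1.1, c.fronthaul t)) (fun t t' h => by
        simp only [Prod.mk.injEq, hG] at h ⊢
        exact ⟨h.2.2, h.1⟩)
    have hb := cent_le_fano hp hp1 mT (fun t => (t.1.1, c.fronthaul t))
      (fun b l => c.dec b.1.2 b.2 b.1.1 l)
    have hc : Real.log (Fintype.card (∀ l : T, Fin (M l))) = ∑ l ∈ T, Real.log (M l) := by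
      rw [Fintype.card_pi, Nat.cast_prod, Real.log_prod]
      · rw [← Finset.sum_coe_sort T fun l => Real.log (M l)]
        simp
      · intro l _
        simpa using hM l
    rw [hc] at hb
    refine (ha.trans hb).trans (add_le_add_right (mul_le_mul_of_nonneg_right ?_ ?_) _)
    · rw [c.errorProb_eq]
      refine Finset.sum_le_sum fun t _ => mul_le_mul_of_nonneg_left ?_ (hp t)
      by_cases h : c.dec t.1.1.2 (c.fronthaul t) t.1.1.1 = t.1.2
      · rw [if_pos h, if_pos]
        funext l
        exact congrFun h l
      · rw [if_neg h]
        split_ifs <;> norm_num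
    · exact Finset.sum_nonneg fun l _ => Real.log_natCast_nonneg _
  have h3 : cent p mT G - cent p mT (fun t => (c.fronthaul t, G t)) =
      cent p c.fronthaul G - cent p c.fronthaul (fun t => t.1) := by
    have e1 : ent p (fun t => (mT t, G t)) = ent p (fun t => t.1) := by
      refine ent_congr_iff p fun t t' => ?_
      simp only [Prod.mk.injEq, hG, hmT, funext_iff, Subtype.forall, Finset.mem_compl]
      refine ⟨fun h => Prod.ext h.2.2 (funext fun l => ?_), fun h => ?_⟩
      · by_cases hl : l ∈ T
        exacts [h.1 l hl, h.2.1 l hl]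
      · rw [h]; simp
    have e2 : ent p (fun t => (mT t, c.fronthaul t, G t)) = ent p (fun t => (c.fronthaul t, t.1)) := by
      refine ent_congr_iff p fun t t' => ?_
      simp only [Prod.mk.injEq, hG, hmT]
      refine ⟨fun h => ⟨h.2.1, Prod.ext h.2.2.2 (funext fun l => ?_)⟩, fun h => ?_⟩
      · by_cases hl : l ∈ T
        exacts [congrFun h.1 ⟨l, hl⟩, congrFun h.2.2.1 ⟨l, Finset.mem_compl.2 hl⟩]
      · rw [h.1, h.2]; simp
    unfold cent
    rw [e1, e2]
    ring
  have h4 : cent p c.fronthaul G ≤ cent p c.fronthaul (fun t => sideInfo Tᶜ (c.block t)) := by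
    refine cent_anti hp hp1 _ fun t t' h => ?_
    simp only [hG, Prod.mk.injEq] at h
    rw [sideInfo_eq_iff]
    refine ⟨fun i => ?_, fun i => ?_⟩
    · rw [inputs_eq_iff]
      intro l hl
      have := congrFun h.1 ⟨l, hl⟩
      simp only at this
      simp only [Code.block, Code.codewords]
      rw [h.2, this]
    · simp only [Code.block]
      rw [h.2]
  have h5 : cent p c.fronthaul (fun t => t.1) =
      cent p c.fronthaul (fun t => fullInfo (c.block t)) := by
    have e1 := cent_eq_sum_ent (p := c.inputWeight) c.inputWeight_nonneg
      (κ := fun s => blockChannel ch (c.codewords s)) (fun s => blockChannel_nonneg hch _)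
      (fun s _ => sum_blockChannel hch _) (fun s => s) (fun s y => c.fronthaul (s, y))
      (fun s s' h => by subst h; exact ⟨rfl, rfl⟩)
    have e2 := cent_eq_sum_ent (p := c.inputWeight) c.inputWeight_nonneg
      (κ := fun s => blockChannel ch (c.codewords s)) (fun s => blockChannel_nonneg hch _)
      (fun s _ => sum_blockChannel hch _) (fun s => (c.codewords s, s.1.1))
      (fun s y => c.fronthaul (s, y))
      (fun s s' h => by
        simp only [Prod.mk.injEq] at h
        refine ⟨by simp only [h.1], ?_⟩
        funext y k
        simp only [Code.fronthaul, blockDesc, Code.block]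
        rw [h.2])
    exact e1.trans e2.symm
  have h6 : ∀ {δ : Type _} (H : (Fin n → Fin c.nQ × Letters 𝒳 𝒴) → δ),
      cent p c.fronthaul (fun t => H (c.block t)) =
        cent (blockWeight ch c.pQ c.pX) (blockDesc c.relay) H := fun H =>
    cent_congr_law fun φ => c.sum_weight fun ω => φ (blockDesc c.relay ω) (H ω)
  rw [← h6, ← h6]
  linarith

theorem nonempty_of_mem_stdSimplex {α : Type*} [Fintype α] {p : α → ℝ} (hp : p ∈ stdSimplex ℝ α) :
    Nonempty α := by
  by_contra h
  rw [not_nonempty_iff] at h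
  simpa using hp.2

/-- The average over time and over the past of the single-letter bounds of a block. -/
theorem blockAverage_mem {γ : Type*} [Fintype γ] {ι : Fin K → Type*} {pQ : γ → ℝ}
    {pX : ∀ l, γ → 𝒳 l → ℝ} (hch : ∀ x, ch x ∈ stdSimplex ℝ (∀ k, 𝒴 k))
    (hQ : pQ ∈ stdSimplex ℝ γ) (hX : ∀ l q, pX l q ∈ stdSimplex ℝ (𝒳 l))
    (J : ∀ k, (Fin n → 𝒴 k) → (Fin n → γ) → ι k) (x₀ : ∀ l, 𝒳 l) (hn : 0 < n) :
    (fun TS => (∑ i, ∑ ω, blockWeight ch pQ pX ω *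
      boundVector ch (blockConfig hch hX J x₀ i ω) TS) / n) ∈
      convexHull ℝ (boundVector ch '' consistentConfigs ch) := by
  have hn0 : (n : ℝ) ≠ 0 := by exact_mod_cast hn.ne'
  refine mem_convexHull_of_exists_fintype
    (fun s : Fin n × (Fin n → γ × Letters 𝒳 𝒴) => blockWeight ch pQ pX s.2 / n)
    (fun s => boundVector ch (blockConfig hch hX J x₀ s.1 s.2))
    (fun s => div_nonneg (blockWeight_nonneg hch hQ hX s.2) n.cast_nonneg) ?_
    (fun s => Set.mem_image_of_mem _ (systemConfig_mem hch _ _ _)) ?_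
  · rw [Fintype.sum_prod_type]
    simp only [← Finset.sum_div, sum_blockWeight hch hQ hX, Finset.sum_const, Finset.card_univ,
      Fintype.card_fin, nsmul_eq_mul]
    field_simp
  · funext TS
    rw [Finset.sum_apply, Fintype.sum_prod_type, Finset.sum_div]
    refine Finset.sum_congr rfl fun i _ => ?_
    rw [Finset.sum_div]
    refine Finset.sum_congr rfl fun ω _ => ?_
    simp only [Pi.smul_apply, smul_eq_mul]
    ring

/-- Achievable rates satisfy the bounds, up to any positive slack, for an average of single-letter
configurations. -/
theorem exists_average_of_achievable (hch : ∀ x, ch x ∈ stdSimplex ℝ (∀ k, 𝒴 k)) {R : Fin L → ℝ}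
    (hR : Achievable ch C R) {δ : ℝ} (hδ : 0 < δ) :
    ∃ v ∈ convexHull ℝ (boundVector ch '' consistentConfigs ch),
      ∀ TS : Finset (Fin L) × Finset (Fin K),
        (∑ t ∈ TS.1, R t - ∑ s ∈ TS.2, C s) * Real.log 2 ≤ v TS + δ := by
  classical
  have hlog2 : 0 < Real.log 2 := Real.log_pos one_lt_two
  set B : ℝ := |∑ k, C k| * Real.log 2 with hB
  have hB0 : 0 ≤ B := by positivity
  -- the slack is `2 * ε * (log 2 + B)` from Fano's inequality and `(L + 1) * log 2 / n` from rounding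
  set ε : ℝ := min (1 / 2) (δ / (4 * (Real.log 2 + B))) with hε
  have hε0 : 0 < ε := lt_min (by norm_num) (by positivity)
  have hε1 : ε ≤ 1 / 2 := min_le_left _ _
  have hε2 : 2 * ε * (Real.log 2 + B) ≤ δ / 2 := by
    have : ε ≤ δ / (4 * (Real.log 2 + B)) := min_le_right _ _
    rw [le_div_iff₀ (by positivity)] at this
    linarith
  obtain ⟨n₀, hn₀⟩ := hR ε hε0
  obtain ⟨n₁, hn₁⟩ := exists_nat_ge (2 * ((L : ℝ) + 1) * Real.log 2 / δ)
  obtain ⟨n, hnn₀, hnn₁, hn1'⟩ : ∃ n, n₀ ≤ n ∧ n₁ ≤ n ∧ 1 ≤ n :=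
    ⟨max (max n₀ n₁) 1, by simp, by simp, by simp⟩
  have hn1 : (1 : ℝ) ≤ n := by exact_mod_cast hn1'
  have hn0 : (0 : ℝ) < n := by linarith
  have hnL : ((L : ℝ) + 1) * Real.log 2 ≤ n * (δ / 2) := by
    have : (n₁ : ℝ) ≤ n := by exact_mod_cast hnn₁
    rw [div_le_iff₀ hδ] at hn₁
    nlinarith
  obtain ⟨M, c, hM, herr⟩ := hn₀ n hnn₀
  obtain ⟨q₀⟩ := nonempty_of_mem_stdSimplex c.pQ_mem
  have x₀ : ∀ l, 𝒳 l := fun l => (nonempty_of_mem_stdSimplex (c.pX_mem l q₀)).some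
  obtain ⟨y₀⟩ := nonempty_of_mem_stdSimplex (hch x₀)
  have hne : ∀ k, Nonempty (Fin ⌊(2 : ℝ) ^ ((n : ℝ) * C k)⌋₊) :=
    fun k => ⟨c.relay k (fun _ => y₀ k) (fun _ => q₀)⟩
  have hcard : ∀ k, Real.log (Fintype.card (Fin ⌊(2 : ℝ) ^ ((n : ℝ) * C k)⌋₊)) ≤
      n * C k * Real.log 2 := by
    intro k
    have h1 : 0 < ⌊(2 : ℝ) ^ ((n : ℝ) * C k)⌋₊ := Fin.pos_iff_nonempty.2 (hne k)
    rw [Fintype.card_fin, ← Real.log_rpow two_pos]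
    exact Real.log_le_log (by exact_mod_cast h1) (Nat.floor_le (by positivity))
  have hw := blockWeight_nonneg (n := n) hch c.pQ_mem c.pX_mem
  have hw1 := sum_blockWeight (n := n) hch c.pQ_mem c.pX_mem
  refine ⟨_, blockAverage_mem hch c.pQ_mem c.pX_mem c.relay x₀ (by exact_mod_cast hn0), ?_⟩
  rintro ⟨T, S⟩
  set r := ∑ l ∈ T, Real.log (M l) with hr
  set I := cent (blockWeight (n := n) ch c.pQ c.pX) (blockDesc c.relay) (sideInfo Tᶜ) -
        cent (blockWeight ch c.pQ c.pX) (blockDesc c.relay) fullInfo with hI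
  have h1 : (1 - c.errorProb ch) * r ≤ Real.log 2 + I := c.log_messages_le_info hch T
  have h2 : I ≤ ∑ k ∈ S, Real.log (Fintype.card (Fin ⌊(2 : ℝ) ^ ((n : ℝ) * C k)⌋₊)) +
      ∑ i, ∑ ω, blockWeight ch c.pQ c.pX ω *
        boundVector ch (blockConfig hch c.pX_mem c.relay x₀ i ω) (T, S) :=
    block_bound hch c.pQ_mem c.pX_mem c.relay x₀ T S
  generalize ∑ i, ∑ ω, blockWeight ch c.pQ c.pX ω *
      boundVector ch (blockConfig hch c.pX_mem c.relay x₀ i ω) (T, S) = v at h2 ⊢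
  have h4 : ∑ k ∈ S, Real.log (Fintype.card (Fin ⌊(2 : ℝ) ^ ((n : ℝ) * C k)⌋₊)) ≤
      n * (∑ k ∈ S, C k) * Real.log 2 := by
    rw [Finset.mul_sum, Finset.sum_mul]
    exact Finset.sum_le_sum fun k _ => hcard k
  have h5 : I ≤ n * B := by
    have ha := cent_le_log_card hw hw1 (blockDesc c.relay) (sideInfo Tᶜ)
    have hb := cent_nonneg hw (blockDesc c.relay) fullInfo
    rw [Fintype.card_pi, Nat.cast_prod, Real.log_prod] at ha
    · have hc : ∑ k, Real.log (Fintype.card (Fin ⌊(2 : ℝ) ^ ((n : ℝ) * C k)⌋₊)) ≤ n * B := by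
        calc _ ≤ ∑ k, n * C k * Real.log 2 := Finset.sum_le_sum fun k _ => hcard k
          _ = n * ((∑ k, C k) * Real.log 2) := by
            rw [← Finset.sum_mul, ← Finset.mul_sum, mul_assoc]
          _ ≤ n * B := by
            rw [hB]
            gcongr
            exact le_abs_self _
      linarith
    · intro k _
      exact_mod_cast Fintype.card_ne_zero
  have hr0 : 0 ≤ r := Finset.sum_nonneg fun l _ => Real.log_natCast_nonneg _
  have h6 : r ≤ Real.log 2 + I + ε * r := by
    have := mul_le_mul_of_nonneg_right herr hr0
    linarith
  have h7 : ε * r ≤ 2 * ε * (Real.log 2 + n * B) := by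
    have : r ≤ 2 * (Real.log 2 + n * B) := by
      have := mul_le_mul_of_nonneg_right hε1 hr0
      linarith
    have := mul_le_mul_of_nonneg_left this hε0.le
    linarith
  have h8 : 2 * ε * (Real.log 2 + n * B) ≤ n * (δ / 2) := by
    have ha : Real.log 2 + n * B ≤ n * (Real.log 2 + B) := by nlinarith
    have := mul_le_mul_of_nonneg_left ha (by positivity : 0 ≤ 2 * ε)
    have := mul_le_mul_of_nonneg_left hε2 hn0.le
    linarith
  have h9 : n * (∑ t ∈ T, R t) * Real.log 2 - L * Real.log 2 ≤ r := by
    have ha : ∀ l, n * R l * Real.log 2 - Real.log 2 ≤ Real.log (M l) := by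
      intro l
      have hpos : (1 : ℝ) ≤ M l := by exact_mod_cast c.M_pos l
      have hb : (2 : ℝ) ^ ((n : ℝ) * R l) ≤ 2 * M l := by
        have := Nat.lt_floor_add_one ((2 : ℝ) ^ ((n : ℝ) * R l))
        have h' : ((⌊(2 : ℝ) ^ ((n : ℝ) * R l)⌋₊ : ℕ) : ℝ) ≤ M l := by exact_mod_cast hM l
        linarith
      have := Real.log_le_log (by positivity) hb
      rw [Real.log_rpow two_pos, Real.log_mul two_ne_zero (by positivity)] at this
      linarith
    have hb : ∑ l ∈ T, (n * R l * Real.log 2 - Real.log 2) ≤ r := Finset.sum_le_sum fun l _ => ha l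
    rw [Finset.sum_sub_distrib, ← Finset.sum_mul, ← Finset.mul_sum, Finset.sum_const,
      nsmul_eq_mul] at hb
    have hc : (T.card : ℝ) ≤ L := by exact_mod_cast (Finset.card_le_univ T).trans_eq (by simp)
    nlinarith
  have h10 : n * ((∑ t ∈ T, R t - ∑ s ∈ S, C s) * Real.log 2) ≤ n * (v / n + δ) := by
    rw [mul_add, mul_div_cancel₀ _ hn0.ne']
    linarith
  exact le_of_mul_le_mul_left h10 hn0

end CodeBound

/-! ### Realizing a configuration by deterministic relay functions -/

section Realization

variable {L K : ℕ} {𝒳 : Fin L → Type*} [∀ l, Fintype (𝒳 l)] {𝒴 : Fin K → Type*}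
  [∀ k, Fintype (𝒴 k)]

instance : StandardBorelSpace (Table 𝒳 𝒴) :=
  StandardBorelSpace.pi_countable (α := fun _ : PartialOutput 𝒴 => Letters 𝒳 𝒴 → unitInterval)

instance : IsProbabilityMeasure (volume : Measure UnitAddCircle) :=
  ⟨UnitAddCircle.measure_univ⟩

/-- The entries of a table, as elements of the circle group, so that they can be masked. Halving
makes the encoding injective. -/
def circleCode (t : unitInterval) : UnitAddCircle := ((t / 2 : ℝ) : UnitAddCircle)

/-- The inverse of `circleCode`, with values in `[0, 1]`. -/
def circleDecode (a : UnitAddCircle) : ℝ :=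
  min 1 (2 * (AddCircle.measurableEquivIco 1 0 a : ℝ))

theorem measurable_circleCode : Measurable circleCode :=
  AddCircle.measurable_mk'.comp (measurable_subtype_coe.div_const 2)

theorem measurable_circleDecode : Measurable circleDecode := by
  unfold circleDecode
  fun_prop

theorem circleDecode_mem (a : UnitAddCircle) : circleDecode a ∈ unitInterval :=
  ⟨le_min zero_le_one (mul_nonneg two_pos.le (AddCircle.measurableEquivIco 1 0 a).2.1),
    min_le_left _ _⟩

theorem circleDecode_circleCode (t : unitInterval) : circleDecode (circleCode t) = t := by
  have h : (t / 2 : ℝ) ∈ Set.Ico (0 : ℝ) (0 + 1) := by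
    have h0 := t.2.1
    have h1 := t.2.2
    constructor <;> linarith
  have h2 : AddCircle.measurableEquivIco 1 0 (circleCode t) = ⟨t / 2, h⟩ :=
    AddCircle.equivIco_coe_eq h
  unfold circleDecode
  rw [h2, mul_div_cancel₀ _ two_ne_zero, min_eq_right t.2.2]

/-- Secret permutations of the output alphabets. -/
def Relabeling {K : ℕ} (𝒴 : Fin K → Type*) : Type _ := ∀ k, Equiv.Perm (𝒴 k)

open scoped Classical in
instance : Fintype (Relabeling 𝒴) := inferInstanceAs (Fintype (∀ k, Equiv.Perm (𝒴 k)))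

instance : Nonempty (Relabeling 𝒴) := ⟨fun _ => Equiv.refl _⟩

instance : MeasurableSpace (Relabeling 𝒴) := ⊤

instance : DiscreteMeasurableSpace (Relabeling 𝒴) := ⟨fun _ => trivial⟩

/-- For every relay, a mask for every table entry. -/
abbrev Masks {L K : ℕ} (𝒳 : Fin L → Type*) (𝒴 : Fin K → Type*) : Type _ :=
  Fin K × PartialOutput 𝒴 × Letters 𝒳 𝒴 → UnitAddCircle

/-- The values of `W`: secret permutations, a table and masks. -/
abbrev Secret {L K : ℕ} (𝒳 : Fin L → Type*) (𝒴 : Fin K → Type*) : Type _ :=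
  Relabeling 𝒴 × Table 𝒳 𝒴 × Masks 𝒳 𝒴

/-- Arrays indexed like the entries of a table. -/
abbrev Entries {L K : ℕ} (𝒳 : Fin L → Type*) (𝒴 : Fin K → Type*) : Type _ :=
  PartialOutput 𝒴 × Letters 𝒳 𝒴 → UnitAddCircle

/-- The partial outputs whose labels are `j`. -/
def Relabeling.unlabel (σ : Relabeling 𝒴) (j : PartialOutput 𝒴) : PartialOutput 𝒴 :=
  fun k => (j k).map (σ k).symm

open scoped Classical in
/-- The public array: the table with relabeled arguments, each entry masked by all the relays that
occur in its argument. -/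
def publicArray (w : Secret 𝒳 𝒴) : Entries 𝒳 𝒴 := fun jz =>
  circleCode (w.2.1 (w.1.unlabel jz.1) jz.2) + ∑ k, if jz.1 k = none then 0 else w.2.2 (k, jz)

open scoped Classical in
/-- The masks that relay `k` reveals when the label of its output is `a`. -/
def share (k : Fin K) (s : Masks 𝒳 𝒴) (a : 𝒴 k) : Entries 𝒳 𝒴 := fun jz =>
  if jz.1 k = some a then s (k, jz) else 0

/-- The message of relay `k`: the public array, the label of its output, and its masks at the
entries with that label. This is a private simultaneous message scheme: a coalition `A` can unmask
exactly the entries at arguments built from the labels of its own outputs. -/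
def message (k : Fin K) (w : Secret 𝒳 𝒴) (y : 𝒴 k) : Entries 𝒳 𝒴 × 𝒴 k × Entries 𝒳 𝒴 :=
  (publicArray w, w.1 k y, share k w.2.2 (w.1 k y))

/-- The messages of the relays in `A`. -/
def messages (A : Finset (Fin K)) (w : Secret 𝒳 𝒴) (y : ∀ k, 𝒴 k) :
    ∀ k : A, Entries 𝒳 𝒴 × 𝒴 k × Entries 𝒳 𝒴 :=
  fun k => message k w (y k)

open scoped Classical in
/-- The entry of the table that the messages of a coalition reveal. -/
def decodeMessages (A : Finset (Fin K)) (u : ∀ k : A, Entries 𝒳 𝒴 × 𝒴 k × Entries 𝒳 𝒴)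
    (z : Letters 𝒳 𝒴) : ℝ :=
  if hA : A.Nonempty then
    circleDecode ((u ⟨hA.choose, hA.choose_spec⟩).1
        (fun k => if h : k ∈ A then some (u ⟨k, h⟩).2.1 else none, z) -
      ∑ k : A, (u k).2.2 (fun k => if h : k ∈ A then some (u ⟨k, h⟩).2.1 else none, z))
  else 0

theorem decodeMessages_mem (A : Finset (Fin K))
    (u : ∀ k : A, Entries 𝒳 𝒴 × 𝒴 k × Entries 𝒳 𝒴) (z : Letters 𝒳 𝒴) :
    decodeMessages A u z ∈ unitInterval := by
  unfold decodeMessages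
  split_ifs
  exacts [circleDecode_mem _, ⟨le_rfl, zero_le_one⟩]

theorem decodeMessages_messages {A : Finset (Fin K)} (hA : A.Nonempty) (w : Secret 𝒳 𝒴)
    (y : ∀ k, 𝒴 k) (z : Letters 𝒳 𝒴) :
    decodeMessages A (messages A w y) z = w.2.1 (restr A y) z := by
  classical
  set j : PartialOutput 𝒴 := fun k => if k ∈ A then some (w.1 k (y k)) else none with hj
  have hj' : (fun k => if h : k ∈ A then some (messages A w y ⟨k, h⟩).2.1 else none) = j := by
    funext k
    by_cases h : k ∈ A <;> simp [hj, h, messages, message]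
  have h1 : w.1.unlabel j = restr A y := by
    funext k
    by_cases h : k ∈ A <;> simp [hj, Relabeling.unlabel, restr, h]
  have h2 : ∑ k : A, (messages A w y k).2.2 (j, z) =
      ∑ k, if j k = none then 0 else w.2.2 (k, j, z) := by
    have h3 : ∀ k : A, (messages A w y k).2.2 (j, z) =
        if j k = none then 0 else w.2.2 (k, j, z) := by
      intro k
      simp [messages, message, share, hj]
    simp_rw [h3]
    rw [Finset.sum_coe_sort A (fun k => if j k = none then 0 else w.2.2 (k, j, z))]
    refine Finset.sum_subset (Finset.subset_univ A) fun k _ hk => ?_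
    simp [hj, hk]
  unfold decodeMessages
  rw [dif_pos hA, hj', h2]
  simp only [messages, message, publicArray, h1, add_sub_cancel_right]
  exact circleDecode_circleCode _

/-- Composition with transpositions that give the output `y'` the labels of `y`. -/
def Relabeling.transfer (y y' : ∀ k, 𝒴 k) (σ : Relabeling 𝒴) : Relabeling 𝒴 := by
  classical
  exact fun k => (Equiv.swap (y k) (y' k)).trans (σ k)

theorem Relabeling.transfer_involutive (y y' : ∀ k, 𝒴 k) :
    Function.Involutive (Relabeling.transfer y y') := by
  intro σ
  funext k
  ext a
  simp [Relabeling.transfer]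

theorem Relabeling.transfer_apply (y y' : ∀ k, 𝒴 k) (σ : Relabeling 𝒴) (k : Fin K) :
    σ.transfer y y' k (y' k) = σ k (y k) := by
  simp [Relabeling.transfer]

/-- The expectation over the permutations and masks of a function of the messages of a coalition. -/
def messageAverage (A : Finset (Fin K))
    (h : (∀ k : A, Entries 𝒳 𝒴 × 𝒴 k × Entries 𝒳 𝒴) → ℝ) (T : Table 𝒳 𝒴) (y : ∀ k, 𝒴 k) : ℝ :=
  ∑ σ : Relabeling 𝒴, (Fintype.card (Relabeling 𝒴) : ℝ)⁻¹ *
    ∫ s : Masks 𝒳 𝒴, h (messages A (σ, T, s) y)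

/-- Privacy of the messages: their law depends on the table and on the outputs only through the
entries of the table that the coalition is entitled to see. At every other argument some relay
that is not in the coalition, or that has another label there, keeps its mask secret, so that the
difference of the tables can be absorbed into that mask. -/
theorem messageAverage_congr (A : Finset (Fin K))
    (h : (∀ k : A, Entries 𝒳 𝒴 × 𝒴 k × Entries 𝒳 𝒴) → ℝ) {T T' : Table 𝒳 𝒴} {y y' : ∀ k, 𝒴 k}
    (hT : ∀ B ⊆ A, T (restr B y) = T' (restr B y')) :
    messageAverage A h T y = messageAverage A h T' y' := by
  classical
  -- relay `k` keeps its mask at the argument `j` secret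
  let hid : Relabeling 𝒴 → PartialOutput 𝒴 → Fin K → Prop :=
    fun σ j k => j k ≠ none ∧ ¬(k ∈ A ∧ j k = some (σ k (y k)))
  let g : Relabeling 𝒴 → Masks 𝒳 𝒴 := fun σ kjz =>
    if hex : ∃ k, hid σ kjz.2.1 k then
      if kjz.1 = hex.choose then circleCode (T (σ.unlabel kjz.2.1) kjz.2.2) -
        circleCode (T' ((σ.transfer y y').unlabel kjz.2.1) kjz.2.2) else 0
    else 0
  have hmsg : ∀ σ s, messages A (σ, T, s) y = messages A (σ.transfer y y', T', s + g σ) y' := by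
    intro σ s
    funext ⟨k, hk⟩
    simp only [messages, message, Relabeling.transfer_apply]
    refine Prod.ext ?_ (Prod.ext rfl ?_)
    · funext ⟨j, z⟩
      simp only [publicArray]
      have hsum : ∑ k, (if j k = none then 0 else (s + g σ) (k, j, z)) =
          (∑ k, if j k = none then 0 else s (k, j, z)) +
            (circleCode (T (σ.unlabel j) z) - circleCode (T' ((σ.transfer y y').unlabel j) z)) := by
        by_cases hex : ∃ k, hid σ j k
        · have hg : ∀ k, (if j k = none then 0 else (s + g σ) (k, j, z)) =
              (if j k = none then 0 else s (k, j, z)) + if k = hex.choose then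
                circleCode (T (σ.unlabel j) z) -
                  circleCode (T' ((σ.transfer y y').unlabel j) z) else 0 := by
            intro k
            by_cases hk' : k = hex.choose
            · have : j k ≠ none := by rw [hk']; exact hex.choose_spec.1
              simp only [this, if_false, Pi.add_apply, g, dif_pos hex, hk', if_true]
            · simp only [Pi.add_apply, g, dif_pos hex, hk', if_false, add_zero]
          simp_rw [hg]
          rw [Finset.sum_add_distrib, Finset.sum_ite_eq' Finset.univ, if_pos (Finset.mem_univ _)]
        · -- all masks are revealed: the entry is one that the coalition may see
          have hg : ∀ k, (s + g σ) (k, j, z) = s (k, j, z) := by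
            intro k
            simp only [Pi.add_apply, g, dif_neg hex, add_zero]
          simp_rw [hg]
          have hj : ∀ k, j k = none ∨ (k ∈ A ∧ j k = some (σ k (y k))) := by
            intro k
            by_contra hcon
            rw [not_or] at hcon
            exact hex ⟨k, hcon⟩
          set B : Finset (Fin K) := Finset.univ.filter fun k => j k ≠ none with hB
          have hBA : B ⊆ A := by
            intro k hk'
            rw [hB, Finset.mem_filter] at hk'
            exact ((hj k).resolve_left hk'.2).1
          have e1 : σ.unlabel j = restr B y := by
            funext k
            rcases hj k with h0 | ⟨_, h0⟩ <;> simp [Relabeling.unlabel, restr, hB, h0]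
          have e2 : (σ.transfer y y').unlabel j = restr B y' := by
            funext k
            rcases hj k with h0 | ⟨_, h0⟩
            · simp [Relabeling.unlabel, restr, hB, h0]
            · rw [← Relabeling.transfer_apply y y' σ k] at h0
              simp [Relabeling.unlabel, restr, hB, h0]
          rw [e1, e2, hT B hBA, sub_self, add_zero]
      rw [hsum]
      abel
    · funext ⟨j, z⟩
      simp only [share]
      split_ifs with hjk
      · have : g σ (k, j, z) = 0 := by
          simp only [g]
          split_ifs with hex hk'
          · have := hex.choose_spec.2
            rw [← hk'] at this
            exact absurd ⟨hk, hjk⟩ this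
          · rfl
          · rfl
        rw [Pi.add_apply, this, add_zero]
      · rfl
  unfold messageAverage
  simp_rw [hmsg]
  have hinv : ∀ σ : Relabeling 𝒴,
      ∫ s : Masks 𝒳 𝒴, h (messages A (σ.transfer y y', T', s + g σ) y') =
        ∫ s : Masks 𝒳 𝒴, h (messages A (σ.transfer y y', T', s) y') := fun σ =>
    integral_add_right_eq_self (fun s => h (messages A (σ.transfer y y', T', s) y')) (g σ)
  simp_rw [hinv]
  exact Equiv.sum_comp (Function.Involutive.toPerm _ (Relabeling.transfer_involutive y y'))
    fun σ : Relabeling 𝒴 => (Fintype.card (Relabeling 𝒴) : ℝ)⁻¹ *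
      ∫ s : Masks 𝒳 𝒴, h (messages A (σ, T', s) y')

/-- A table whose entries visible to a coalition are `d`, whatever its outputs are. -/
def tableOfView (d : Finset (Fin K) → Letters 𝒳 𝒴 → unitInterval) : Table 𝒳 𝒴 := by
  classical
  exact fun o => d (Finset.univ.filter fun k => o k ≠ none)

theorem messageAverage_eq_view (A : Finset (Fin K))
    (h : (∀ k : A, Entries 𝒳 𝒴 × 𝒴 k × Entries 𝒳 𝒴) → ℝ) (T : Table 𝒳 𝒴) (y y' : ∀ k, 𝒴 k) :
    messageAverage A h T y = messageAverage A h (tableOfView (view A T y)) y' := by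
  classical
  refine messageAverage_congr A h fun B hB => ?_
  have : (Finset.univ.filter fun k => restr B y' k ≠ none) = B := by
    ext k
    by_cases hk : k ∈ B <;> simp [restr, hk]
  simp only [tableOfView, view, this, Finset.inter_eq_right.2 hB]

end Realization

/-! ### The posterior given the messages -/

section RealizationLaw

variable {L K : ℕ} {𝒳 : Fin L → Type*} [∀ l, Fintype (𝒳 l)] {𝒴 : Fin K → Type*}
  [∀ k, Fintype (𝒴 k)]

theorem integrable_of_measurable_of_bound {α : Type*} [MeasurableSpace α] {μ : Measure α}
    [IsFiniteMeasure μ] {φ : α → ℝ} (hφ : Measurable φ) {b : ℝ} (hb : ∀ a, |φ a| ≤ b) :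
    Integrable φ μ :=
  Integrable.of_bound hφ.aestronglyMeasurable b (Filter.Eventually.of_forall hb)

theorem measurable_table_entry (o : PartialOutput 𝒴) (z : Letters 𝒳 𝒴) :
    Measurable fun T : Table 𝒳 𝒴 => (T o z : ℝ) :=
  measurable_subtype_coe.comp ((measurable_pi_apply z).comp (measurable_pi_apply o))

theorem measurable_view (A : Finset (Fin K)) (y : ∀ k, 𝒴 k) :
    Measurable fun T : Table 𝒳 𝒴 => view A T y :=
  measurable_pi_iff.2 fun _ => measurable_pi_apply _

/-- The consistency of a configuration extends from continuous to bounded measurable test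
functions. -/
theorem consistent_measurable {ch : (∀ l, 𝒳 l) → (∀ k, 𝒴 k) → ℝ}
    (hch : ∀ x, ch x ∈ stdSimplex ℝ (∀ k, 𝒴 k)) {c : Config 𝒳 𝒴} (hc : c ∈ consistentConfigs ch)
    (A : Finset (Fin K)) (z : Letters 𝒳 𝒴)
    {φ : (Finset (Fin K) → Letters 𝒳 𝒴 → unitInterval) → ℝ} (hφ : Measurable φ) {b : ℝ}
    (hb : ∀ d, |φ d| ≤ b) :
    letterProb ch c.1 z * ∫ T, φ (view A T z.2) ∂(c.2 : Measure (Table 𝒳 𝒴)) =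
      ∑ z' : Letters 𝒳 𝒴, letterProb ch c.1 z' *
        ∫ T, (T (restr A z'.2) z : ℝ) * φ (view A T z'.2) ∂(c.2 : Measure (Table 𝒳 𝒴)) := by
  have hP := letterProb_nonneg hch hc.1
  set Λ : Measure (Table 𝒳 𝒴) := (c.2 : Measure (Table 𝒳 𝒴)) with hΛ
  let e : Letters 𝒳 𝒴 → Table 𝒳 𝒴 → ENNReal := fun z' T => ENNReal.ofReal (T (restr A z'.2) z)
  have he : ∀ z', Measurable (e z') := fun z' => (measurable_table_entry _ _).ennreal_ofReal
  have hfin : ∀ z', IsFiniteMeasure (Λ.withDensity (e z')) := fun z' =>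
    isFiniteMeasure_withDensity (ne_of_lt <| (lintegral_mono fun T =>
      (ENNReal.ofReal_le_one.2 (T (restr A z'.2) z).2.2 : e z' T ≤ 1)).trans_lt (by simp))
  let μ₁ : Measure (Finset (Fin K) → Letters 𝒳 𝒴 → unitInterval) :=
    ENNReal.ofReal (letterProb ch c.1 z) • Λ.map fun T => view A T z.2
  let μ₂ : Measure (Finset (Fin K) → Letters 𝒳 𝒴 → unitInterval) :=
    ∑ z', ENNReal.ofReal (letterProb ch c.1 z') •
      (Λ.withDensity (e z')).map fun T => view A T z'.2
  have hfin₁ : IsFiniteMeasure μ₁ := Measure.smul_finite _ ENNReal.ofReal_ne_top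
  have hfin₂ : IsFiniteMeasure μ₂ := by
    have : ∀ z', IsFiniteMeasure (ENNReal.ofReal (letterProb ch c.1 z') •
        (Λ.withDensity (e z')).map fun T => view A T z'.2) :=
      fun z' => Measure.smul_finite _ ENNReal.ofReal_ne_top
    infer_instance
  have h₁ : ∀ {ψ : (Finset (Fin K) → Letters 𝒳 𝒴 → unitInterval) → ℝ}, Measurable ψ →
      ∫ d, ψ d ∂μ₁ = letterProb ch c.1 z * ∫ T, ψ (view A T z.2) ∂Λ := by
    intro ψ hψ
    rw [integral_smul_measure, integral_map (measurable_view A z.2).aemeasurable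
      hψ.aestronglyMeasurable, ENNReal.toReal_ofReal (hP z), smul_eq_mul]
  have h₂ : ∀ {ψ : (Finset (Fin K) → Letters 𝒳 𝒴 → unitInterval) → ℝ}, Measurable ψ →
      (∃ b : ℝ, ∀ d, |ψ d| ≤ b) → ∫ d, ψ d ∂μ₂ = ∑ z' : Letters 𝒳 𝒴, letterProb ch c.1 z' *
        ∫ T, (T (restr A z'.2) z : ℝ) * ψ (view A T z'.2) ∂Λ := by
    rintro ψ hψ ⟨b, hb⟩
    rw [integral_finsetSum_measure fun z' _ =>
      (integrable_of_measurable_of_bound hψ hb).smul_measure ENNReal.ofReal_ne_top]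
    refine Finset.sum_congr rfl fun z' _ => ?_
    rw [integral_smul_measure, integral_map (measurable_view A z'.2).aemeasurable
      hψ.aestronglyMeasurable, ENNReal.toReal_ofReal (hP z'), smul_eq_mul,
      integral_withDensity_eq_integral_toReal_smul (he z')
        (Filter.Eventually.of_forall fun _ => ENNReal.ofReal_lt_top)]
    congr 1
    refine integral_congr_ae (Filter.Eventually.of_forall fun T => ?_)
    simp only [e, smul_eq_mul]
    rw [ENNReal.toReal_ofReal (T (restr A z'.2) z).2.1]
  have hμ : μ₁ = μ₂ := by
    refine ext_of_forall_integral_eq_of_IsFiniteMeasure fun ψ => ?_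
    rw [h₁ ψ.continuous.measurable, h₂ ψ.continuous.measurable
      ⟨‖ψ‖, fun d => ψ.norm_coe_le_norm d⟩]
    exact hc.2 A z ψ.toContinuousMap
  rw [← h₁ hφ, ← h₂ hφ ⟨b, hb⟩, hμ]

/-- The law of `W`: uniform permutations and masks, independent of the table. -/
def secretLaw (Λ : Measure (Table 𝒳 𝒴)) : Measure (Secret 𝒳 𝒴) :=
  (ProbabilityTheory.uniformOn Set.univ : Measure (Relabeling 𝒴)).prod (Λ.prod volume)

instance (Λ : Measure (Table 𝒳 𝒴)) [IsProbabilityMeasure Λ] :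
    IsProbabilityMeasure (secretLaw Λ) := by
  have : IsProbabilityMeasure (ProbabilityTheory.uniformOn Set.univ : Measure (Relabeling 𝒴)) :=
    ProbabilityTheory.isProbabilityMeasure_uniformOn Set.finite_univ Set.univ_nonempty
  unfold secretLaw
  infer_instance

theorem integral_uniformOn_univ {α : Type*} [Fintype α] [Nonempty α] [MeasurableSpace α]
    [MeasurableSingletonClass α] (φ : α → ℝ) :
    ∫ a, φ a ∂(ProbabilityTheory.uniformOn Set.univ : Measure α) =
      ∑ a, (Fintype.card α : ℝ)⁻¹ * φ a := by
  have : IsProbabilityMeasure (ProbabilityTheory.uniformOn Set.univ : Measure α) :=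
    ProbabilityTheory.isProbabilityMeasure_uniformOn Set.finite_univ Set.univ_nonempty
  rw [integral_fintype (Integrable.of_finite)]
  refine Finset.sum_congr rfl fun a _ => ?_
  rw [smul_eq_mul, Measure.real, ProbabilityTheory.uniformOn_univ]
  simp

variable [∀ k, MeasurableSpace (𝒴 k)] [∀ k, MeasurableSingletonClass (𝒴 k)]

theorem measurable_message (k : Fin K) (y : 𝒴 k) :
    Measurable fun w : Secret 𝒳 𝒴 => message k w y := by
  classical
  refine measurable_from_prod_countable_right fun σ => ?_
  change Measurable fun v : Table 𝒳 𝒴 × Masks 𝒳 𝒴 =>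
    (publicArray (σ, v), σ k y, share k v.2 (σ k y))
  refine Measurable.prodMk ?_ (Measurable.prodMk measurable_const ?_)
  · refine measurable_pi_iff.2 fun jz => ?_
    have h1 : Measurable fun v : Table 𝒳 𝒴 × Masks 𝒳 𝒴 =>
        circleCode (v.1 (σ.unlabel jz.1) jz.2) :=
      measurable_circleCode.comp ((measurable_pi_apply jz.2).comp
        ((measurable_pi_apply (σ.unlabel jz.1)).comp measurable_fst))
    have h2 : Measurable fun v : Table 𝒳 𝒴 × Masks 𝒳 𝒴 =>
        ∑ k, if jz.1 k = none then (0 : UnitAddCircle) else v.2 (k, jz) := by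
      refine Finset.measurable_sum _ fun k _ => ?_
      split_ifs
      · exact measurable_const
      · exact (measurable_pi_apply (k, jz)).comp measurable_snd
    exact h1.add h2
  · refine measurable_pi_iff.2 fun jz => ?_
    unfold share
    split_ifs
    · exact (measurable_pi_apply (k, jz)).comp measurable_snd
    · exact measurable_const

theorem measurable_messages (A : Finset (Fin K)) (y : ∀ k, 𝒴 k) :
    Measurable fun w : Secret 𝒳 𝒴 => messages A w y :=
  measurable_pi_iff.2 fun k => measurable_message k.1 (y k)

theorem measurable_decodeMessages (A : Finset (Fin K)) (z : Letters 𝒳 𝒴) :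
    Measurable fun u : ∀ k : A, Entries 𝒳 𝒴 × 𝒴 k × Entries 𝒳 𝒴 => decodeMessages A u z := by
  classical
  unfold decodeMessages
  by_cases hA : A.Nonempty
  · simp only [dif_pos hA]
    -- the labels select an entry; there are finitely many label vectors
    let F : (∀ k : A, 𝒴 k) × (∀ k : A, Entries 𝒳 𝒴 × 𝒴 k × Entries 𝒳 𝒴) → UnitAddCircle :=
      fun v => (v.2 ⟨hA.choose, hA.choose_spec⟩).1
        (fun k => if h : k ∈ A then some (v.1 ⟨k, h⟩) else none, z) -
      ∑ k : A, (v.2 k).2.2 (fun k => if h : k ∈ A then some (v.1 ⟨k, h⟩) else none, z)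
    have hu : ∀ k : A, Measurable fun u : ∀ k : A, Entries 𝒳 𝒴 × 𝒴 k × Entries 𝒳 𝒴 => u k :=
      fun k => measurable_pi_apply k
    have hF : Measurable F := by
      refine measurable_from_prod_countable_right fun a => Measurable.sub ?_
        (Finset.measurable_sum _ fun k _ => ?_)
      · exact (measurable_pi_apply (fun k => if h : k ∈ A then some (a ⟨k, h⟩) else none, z)).comp
          (measurable_fst.comp (hu ⟨hA.choose, hA.choose_spec⟩))
      · exact (measurable_pi_apply (fun k => if h : k ∈ A then some (a ⟨k, h⟩) else none, z)).comp
          (measurable_snd.comp (measurable_snd.comp (hu k)))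
    have hlab : Measurable fun u : ∀ k : A, Entries 𝒳 𝒴 × 𝒴 k × Entries 𝒳 𝒴 =>
        (fun k : A => (u k).2.1 : ∀ k : A, 𝒴 k) :=
      measurable_pi_iff.2 fun k =>
        measurable_fst.comp (measurable_snd.comp (hu k))
    exact measurable_circleDecode.comp (hF.comp (hlab.prodMk measurable_id))
  · simp only [dif_neg hA]
    exact measurable_const

/-- Averaging over permutations and masks first. -/
theorem integral_secretLaw (Λ : Measure (Table 𝒳 𝒴)) [IsProbabilityMeasure Λ]
    (A : Finset (Fin K)) (y : ∀ k, 𝒴 k) {a : Table 𝒳 𝒴 → ℝ} (ha : Measurable a) {b₁ : ℝ}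
    (hb₁ : ∀ T, |a T| ≤ b₁) {h : (∀ k : A, Entries 𝒳 𝒴 × 𝒴 k × Entries 𝒳 𝒴) → ℝ}
    (hh : Measurable h) {b₂ : ℝ} (hb₂ : ∀ u, |h u| ≤ b₂) :
    ∫ w, a w.2.1 * h (messages A w y) ∂(secretLaw Λ) =
      ∫ T, a T * messageAverage A h T y ∂Λ := by
  have : IsProbabilityMeasure (ProbabilityTheory.uniformOn Set.univ : Measure (Relabeling 𝒴)) :=
    ProbabilityTheory.isProbabilityMeasure_uniformOn Set.finite_univ Set.univ_nonempty
  have hmeas : Measurable fun w : Secret 𝒳 𝒴 => a w.2.1 * h (messages A w y) :=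
    (ha.comp (measurable_fst.comp measurable_snd)).mul (hh.comp (measurable_messages A y))
  have hbound : ∀ w : Secret 𝒳 𝒴, |a w.2.1 * h (messages A w y)| ≤ b₁ * b₂ := fun w => by
    rw [abs_mul]
    exact mul_le_mul (hb₁ _) (hb₂ _) (abs_nonneg _) ((abs_nonneg _).trans (hb₁ w.2.1))
  have hσ : ∀ σ : Relabeling 𝒴, Measurable fun v : Table 𝒳 𝒴 × Masks 𝒳 𝒴 =>
      a v.1 * h (messages A (σ, v.1, v.2) y) := fun σ => hmeas.comp measurable_prodMk_left
  have h1 : ∀ σ : Relabeling 𝒴,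
      ∫ v : Table 𝒳 𝒴 × Masks 𝒳 𝒴, a v.1 * h (messages A (σ, v.1, v.2) y) ∂(Λ.prod volume) =
        ∫ T, a T * (∫ s : Masks 𝒳 𝒴, h (messages A (σ, T, s) y)) ∂Λ := by
    intro σ
    rw [integral_prod _ (integrable_of_measurable_of_bound (hσ σ) fun v => hbound (σ, v))]
    simp only [integral_const_mul]
  have h2 : ∀ σ : Relabeling 𝒴,
      Integrable (fun T => a T * ∫ s : Masks 𝒳 𝒴, h (messages A (σ, T, s) y)) Λ := by
    intro σ
    have := (integrable_of_measurable_of_bound (μ := Λ.prod volume) (hσ σ)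
      fun v => hbound (σ, v)).integral_prod_left
    simpa only [integral_const_mul] using this
  unfold secretLaw
  rw [integral_prod _ (integrable_of_measurable_of_bound hmeas hbound), integral_uniformOn_univ]
  simp only [h1, messageAverage, Finset.mul_sum]
  rw [integral_finsetSum]
  · refine Finset.sum_congr rfl fun σ _ => ?_
    rw [← integral_const_mul]
    exact integral_congr_ae (Filter.Eventually.of_forall fun T => by ring)
  · intro σ _
    refine ((h2 σ).const_mul (Fintype.card (Relabeling 𝒴) : ℝ)⁻¹).congr
      (Filter.Eventually.of_forall fun T => ?_)
    simp only
    ring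

theorem measurable_messageAverage (A : Finset (Fin K)) (y : ∀ k, 𝒴 k)
    {h : (∀ k : A, Entries 𝒳 𝒴 × 𝒴 k × Entries 𝒳 𝒴) → ℝ} (hh : Measurable h) :
    Measurable fun d => messageAverage A h (tableOfView d : Table 𝒳 𝒴) y := by
  unfold messageAverage
  refine Finset.measurable_sum _ fun σ _ => Measurable.const_mul ?_ _
  refine (StronglyMeasurable.integral_prod_right (ν := (volume : Measure (Masks 𝒳 𝒴)))
    (f := fun d s => h (messages A (σ, tableOfView d, s) y)) ?_).measurable
  refine Measurable.stronglyMeasurable (hh.comp ((measurable_messages A y).comp ?_))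
  refine measurable_const.prodMk (Measurable.prodMk ?_ measurable_snd)
  exact measurable_pi_iff.2 fun o => (measurable_pi_apply _).comp measurable_fst

theorem abs_messageAverage_le (A : Finset (Fin K)) (y : ∀ k, 𝒴 k)
    {h : (∀ k : A, Entries 𝒳 𝒴 × 𝒴 k × Entries 𝒳 𝒴) → ℝ} {b : ℝ}
    (hb : ∀ u, |h u| ≤ b) (T : Table 𝒳 𝒴) : |messageAverage A h T y| ≤ b := by
  unfold messageAverage
  calc _ ≤ ∑ σ : Relabeling 𝒴, (Fintype.card (Relabeling 𝒴) : ℝ)⁻¹ * b := by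
        refine (Finset.abs_sum_le_sum_abs _ _).trans (Finset.sum_le_sum fun σ _ => ?_)
        rw [abs_mul, abs_of_nonneg (by positivity : (0:ℝ) ≤ (Fintype.card (Relabeling 𝒴) : ℝ)⁻¹)]
        refine mul_le_mul_of_nonneg_left ?_ (by positivity)
        have := norm_integral_le_of_norm_le_const (μ := (volume : Measure (Masks 𝒳 𝒴)))
          (f := fun s => h (messages A (σ, T, s) y)) (Filter.Eventually.of_forall fun s => hb _)
        simpa using this
    _ = b := by
        have : (Fintype.card (Relabeling 𝒴) : ℝ) ≠ 0 := by exact_mod_cast Fintype.card_ne_zero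
        rw [Finset.sum_const, Finset.card_univ, nsmul_eq_mul, mul_inv_cancel_left₀ this]

/-- The decoded entry is the posterior of the letters given the messages of the coalition. -/
theorem messages_posterior {ch : (∀ l, 𝒳 l) → (∀ k, 𝒴 k) → ℝ}
    (hch : ∀ x, ch x ∈ stdSimplex ℝ (∀ k, 𝒴 k)) {c : Config 𝒳 𝒴} (hc : c ∈ consistentConfigs ch)
    {A : Finset (Fin K)} (hA : A.Nonempty) (z : Letters 𝒳 𝒴)
    {h : (∀ k : A, Entries 𝒳 𝒴 × 𝒴 k × Entries 𝒳 𝒴) → ℝ} (hh : Measurable h) {b : ℝ}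
    (hb : ∀ u, |h u| ≤ b) :
    letterProb ch c.1 z * ∫ w, h (messages A w z.2) ∂(secretLaw (c.2 : Measure (Table 𝒳 𝒴))) =
      ∑ z' : Letters 𝒳 𝒴, letterProb ch c.1 z' *
        ∫ w, decodeMessages A (messages A w z'.2) z * h (messages A w z'.2)
          ∂(secretLaw (c.2 : Measure (Table 𝒳 𝒴))) := by
  have h1 := consistent_measurable hch hc A z (measurable_messageAverage A z.2 hh)
    fun d => abs_messageAverage_le A z.2 hb (tableOfView d)
  simp only [← messageAverage_eq_view] at h1
  have h2 : ∀ y : ∀ k, 𝒴 k, ∫ w, h (messages A w y) ∂(secretLaw (c.2 : Measure (Table 𝒳 𝒴))) =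
      ∫ T, messageAverage A h T y ∂(c.2 : Measure (Table 𝒳 𝒴)) := by
    intro y
    have := integral_secretLaw (c.2 : Measure (Table 𝒳 𝒴)) A y (a := fun _ => 1)
      measurable_const (b₁ := 1) (by simp) hh hb
    simpa using this
  rw [h2, h1]
  refine Finset.sum_congr rfl fun z' _ => ?_
  simp only [decodeMessages_messages hA]
  rw [integral_secretLaw (c.2 : Measure (Table 𝒳 𝒴)) A z'.2
    (a := fun T => (T (restr A z'.2) z : ℝ)) (measurable_table_entry _ _) (b₁ := 1)
    (fun T => abs_le.2 ⟨by linarith [(T (restr A z'.2) z).2.1], (T (restr A z'.2) z).2.2⟩) hh hb]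

end RealizationLaw

/-! ### Conditional entropy through posteriors -/

section Pointwise

variable {ζ α β : Type*} [Fintype ζ] [Fintype α] [Fintype β]

/-- The conditional probability of `f = a` given `g = b` under the weight `p`. -/
def condPr (p : ζ → ℝ) (f : ζ → α) (g : ζ → β) (a : α) (b : β) : ℝ :=
  pr p (fun z => (f z, g z)) (a, b) / pr p g b

theorem condPr_mem {p : ζ → ℝ} (hp : ∀ z, 0 ≤ p z) (f : ζ → α) (g : ζ → β) (a : α) (b : β) :
    condPr p f g a b ∈ unitInterval :=
  ⟨div_nonneg (pr_nonneg hp _ _) (pr_nonneg hp _ _),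
    div_le_one_of_le₀ (pr_le_pr_of_imp hp fun _ h => (Prod.mk.inj h).2) (pr_nonneg hp _ _)⟩

theorem pr_mul_condPr {p : ζ → ℝ} (hp : ∀ z, 0 ≤ p z) (f : ζ → α) (g : ζ → β) (a : α) (b : β) :
    pr p g b * condPr p f g a b = pr p (fun z => (f z, g z)) (a, b) := by
  unfold condPr
  rcases eq_or_ne (pr p g b) 0 with h | h
  · have h1 : pr p (fun z => (f z, g z)) (a, b) ≤ pr p g b :=
      pr_le_pr_of_imp hp fun _ h => (Prod.mk.inj h).2
    rw [h, zero_mul]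
    exact (le_antisymm (h1.trans_eq h) (pr_nonneg hp _ _)).symm
  · rw [mul_div_cancel₀ _ h]

open scoped Classical in
theorem sum_mul_condPr {p : ζ → ℝ} (hp : ∀ z, 0 ≤ p z) (f : ζ → α) (g : ζ → β) (a : α)
    (φ : β → ℝ) :
    ∑ z, p z * (φ (g z) * condPr p f g a (g z)) =
      ∑ z, p z * (φ (g z) * if f z = a then 1 else 0) := by
  rw [sum_mul_comp p g fun b => φ b * condPr p f g a b,
    sum_mul_comp p (fun z => (f z, g z)) fun ab => φ ab.2 * if ab.1 = a then 1 else 0,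
    Fintype.sum_prod_type_right]
  refine Finset.sum_congr rfl fun b _ => ?_
  simp only [mul_ite, mul_one, mul_zero, Finset.sum_ite_eq', Finset.mem_univ, if_true]
  rw [← pr_mul_condPr hp f g]
  ring

theorem sum_pr_prod (p : ζ → ℝ) (f : ζ → α) (g : ζ → β) (b : β) :
    ∑ a, pr p (fun z => (f z, g z)) (a, b) = pr p g b := by
  classical
  unfold pr
  rw [Finset.sum_comm]
  refine Finset.sum_congr rfl fun z _ => ?_
  by_cases h : g z = b <;> simp [h]

/-- Conditional entropy is the expected entropy of the conditional law. -/
theorem sum_negMulLog_condPr {p : ζ → ℝ} (hp : ∀ z, 0 ≤ p z) (f : ζ → α) (g : ζ → β) :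
    ∑ z, p z * ∑ a, Real.negMulLog (condPr p f g a (g z)) = cent p f g := by
  rw [sum_mul_comp p g fun b => ∑ a, Real.negMulLog (condPr p f g a b)]
  unfold cent
  rw [ent_eq_sum_negMulLog, ent_eq_sum_negMulLog, Fintype.sum_prod_type_right,
    ← Finset.sum_sub_distrib]
  refine Finset.sum_congr rfl fun b _ => ?_
  have h : ∀ a, Real.negMulLog (pr p (fun z => (f z, g z)) (a, b)) =
      condPr p f g a b * Real.negMulLog (pr p g b) +
        pr p g b * Real.negMulLog (condPr p f g a b) := fun a => by
    rw [← pr_mul_condPr hp, Real.negMulLog_mul]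
  simp_rw [h]
  rw [Finset.sum_add_distrib, ← Finset.mul_sum, ← Finset.sum_mul]
  rcases eq_or_ne (pr p g b) 0 with h0 | h0
  · simp [h0]
  · have : ∑ a, condPr p f g a b = 1 := by
      unfold condPr
      rw [← Finset.sum_div, sum_pr_prod, div_self h0]
    rw [this]
    ring

end Pointwise

section CondEntropy

variable {Ω ζ α β γ 𝒱 : Type*} [MeasurableSpace Ω] {μ : Measure Ω} [IsProbabilityMeasure μ]
  [Fintype ζ] [MeasurableSpace ζ] [MeasurableSingletonClass ζ] [Fintype α] [Fintype β]
  [MeasurableSpace β] [MeasurableSingletonClass β] [MeasurableSpace γ] [MeasurableSpace 𝒱]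

theorem measurable_condPr {π : 𝒱 → ζ → ℝ} (hπ : ∀ z, Measurable fun v => π v z) (f : ζ → α)
    (g : ζ → β) (a : α) (b : β) : Measurable fun v => condPr (π v) f g a b :=
  ((continuous_pr _ _).measurable.comp (measurable_pi_iff.2 hπ)).div
    ((continuous_pr _ _).measurable.comp (measurable_pi_iff.2 hπ))

open scoped Classical in
/-- If `π v` is the conditional law of `Z` given `V = v`, then it disintegrates expectations. -/
theorem integral_eq_integral_posterior {Z : Ω → ζ} (hZ : Measurable Z) {V : Ω → 𝒱}
    (hV : Measurable V) {π : 𝒱 → ζ → ℝ} (hπ : ∀ z, Measurable fun v => π v z)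
    (hπ1 : ∀ v z, π v z ∈ unitInterval)
    (hpost : ∀ (z : ζ) (h : 𝒱 → ℝ), Measurable h → (∃ b : ℝ, ∀ v, |h v| ≤ b) →
      ∫ ω, (if Z ω = z then h (V ω) else 0) ∂μ = ∫ ω, π (V ω) z * h (V ω) ∂μ)
    {φ : ζ → 𝒱 → ℝ} (hφ : ∀ z, Measurable (φ z)) {b : ℝ} (hb : ∀ z v, |φ z v| ≤ b) :
    ∫ ω, φ (Z ω) (V ω) ∂μ = ∫ ω, ∑ z, π (V ω) z * φ z (V ω) ∂μ := by
  have h1 : ∀ ω, φ (Z ω) (V ω) = ∑ z, if Z ω = z then φ z (V ω) else 0 := fun ω => by simp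
  simp_rw [h1]
  rw [integral_finsetSum, integral_finsetSum]
  · exact Finset.sum_congr rfl fun z _ => hpost z (φ z) (hφ z) ⟨b, hb z⟩
  · intro z _
    refine integrable_of_measurable_of_bound (b := b)
      (((hπ z).comp hV).mul ((hφ z).comp hV)) fun ω => ?_
    rw [abs_mul, abs_of_nonneg (hπ1 _ _).1]
    exact (mul_le_of_le_one_left (abs_nonneg _) (hπ1 _ _).2).trans (hb _ _)
  · intro z _
    refine integrable_of_measurable_of_bound (b := b) (Measurable.ite
      (hZ (measurableSet_singleton z)) ((hφ z).comp hV) measurable_const) fun ω => ?_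
    split_ifs
    · exact hb _ _
    · rw [abs_zero]
      exact (abs_nonneg _).trans (hb z (V ω))

/-- The conditional entropy given `(g(Z), V)` of a function `f(Z)`, when the posterior of `Z` given
`V` is known. -/
theorem condEntropy_eq_integral_posterior {Z : Ω → ζ} (hZ : Measurable Z) {V : Ω → 𝒱}
    (hV : Measurable V) {π : 𝒱 → ζ → ℝ} (hπ : ∀ z, Measurable fun v => π v z)
    (hπ1 : ∀ v z, π v z ∈ unitInterval)
    (hpost : ∀ (z : ζ) (h : 𝒱 → ℝ), Measurable h → (∃ b : ℝ, ∀ v, |h v| ≤ b) →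
      ∫ ω, Set.indicator {ω | Z ω = z} (fun ω => h (V ω)) ω ∂μ = ∫ ω, π (V ω) z * h (V ω) ∂μ)
    (f : ζ → α) (g : ζ → β) {G : Ω → γ}
    (hG : MeasurableSpace.comap G inferInstance =
      MeasurableSpace.comap (fun ω => (g (Z ω), V ω)) inferInstance) :
    condEntropy μ (fun ω => f (Z ω)) G * Real.log 2 = ∫ ω, cent (π (V ω)) f g ∂μ := by
  classical
  have hpost' : ∀ (z : ζ) (h : 𝒱 → ℝ), Measurable h → (∃ b : ℝ, ∀ v, |h v| ≤ b) →
      ∫ ω, (if Z ω = z then h (V ω) else 0) ∂μ = ∫ ω, π (V ω) z * h (V ω) ∂μ := by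
    intro z h hh hb
    rw [← hpost z h hh hb]
    rfl
  have hgZ : Measurable fun ω => g (Z ω) := Measurable.of_discrete.comp hZ
  have hgV : Measurable fun ω => (g (Z ω), V ω) := hgZ.prodMk hV
  have hm_le := hgV.comap_le
  have hcond : ∀ a, (fun ω => condPr (π (V ω)) f g a (g (Z ω))) =ᵐ[μ]
      μ[((fun ω => f (Z ω)) ⁻¹' {a}).indicator (fun _ => (1 : ℝ)) |
        MeasurableSpace.comap (fun ω => (g (Z ω), V ω)) inferInstance] := by
    intro a
    have hR : Measurable fun bv : β × 𝒱 => condPr (π bv.2) f g a bv.1 :=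
      measurable_from_prod_countable_right fun b => measurable_condPr hπ f g a b
    have hRabs : ∀ v b, |condPr (π v) f g a b| ≤ 1 := fun v b => by
      have := condPr_mem (fun z => (hπ1 v z).1) f g a b
      rw [abs_of_nonneg this.1]
      exact this.2
    have hfa : MeasurableSet ((fun ω => f (Z ω)) ⁻¹' {a}) :=
      hZ (Set.Finite.measurableSet (Set.toFinite (f ⁻¹' {a})))
    refine ae_eq_condExp_of_forall_setIntegral_eq hm_le
      ((integrable_const (1 : ℝ)).indicator hfa) (fun s _ _ =>
        (integrable_of_measurable_of_bound (hR.comp hgV) fun ω => hRabs _ _).integrableOn) ?_ ?_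
    · rintro s ⟨D, hD, rfl⟩ -
      rw [← integral_indicator (hgV hD), ← integral_indicator (hgV hD)]
      have e1 : ∀ ω, ((fun ω => (g (Z ω), V ω)) ⁻¹' D).indicator
          (fun ω => condPr (π (V ω)) f g a (g (Z ω))) ω =
          (if (g (Z ω), V ω) ∈ D then 1 else 0) * condPr (π (V ω)) f g a (g (Z ω)) := fun ω => by
        simp [Set.indicator_apply]
      have e2 : ∀ ω, ((fun ω => (g (Z ω), V ω)) ⁻¹' D).indicator
          (((fun ω => f (Z ω)) ⁻¹' {a}).indicator (fun _ => (1 : ℝ))) ω =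
          (if (g (Z ω), V ω) ∈ D then 1 else 0) * if f (Z ω) = a then 1 else 0 := fun ω => by
        simp only [Set.indicator_apply, Set.mem_preimage, Set.mem_singleton_iff]
        split_ifs <;> simp
      simp_rw [e1, e2]
      have hDm : ∀ b, Measurable fun v => if (b, v) ∈ D then (1 : ℝ) else 0 := fun b =>
        Measurable.ite (measurable_prodMk_left hD) measurable_const measurable_const
      rw [integral_eq_integral_posterior hZ hV hπ hπ1 hpost'
          (φ := fun z v => (if (g z, v) ∈ D then 1 else 0) * condPr (π v) f g a (g z)) (b := 1)
          (fun z => (hDm _).mul (measurable_condPr hπ f g a (g z))) ?_,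
        integral_eq_integral_posterior hZ hV hπ hπ1 hpost'
          (φ := fun z v => (if (g z, v) ∈ D then 1 else 0) * if f z = a then 1 else 0) (b := 1)
          (fun z => (hDm _).mul measurable_const) ?_]
      · refine integral_congr_ae (Filter.Eventually.of_forall fun ω => ?_)
        exact sum_mul_condPr (fun z => (hπ1 (V ω) z).1) f g a
          fun b => if (b, V ω) ∈ D then 1 else 0
      · intro z v
        split_ifs <;> simp
      · intro z v
        split_ifs
        · simpa using hRabs v (g z)
        · simp
    · exact (hR.comp (comap_measurable _)).stronglyMeasurable.aestronglyMeasurable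
  unfold condEntropy
  rw [div_mul_cancel₀ _ (Real.log_pos one_lt_two).ne', hG]
  have h1 : ∫ ω, ∑ a, Real.negMulLog
      ((μ[((fun ω => f (Z ω)) ⁻¹' {a}).indicator (fun _ => (1 : ℝ)) |
        MeasurableSpace.comap (fun ω => (g (Z ω), V ω)) inferInstance]) ω) ∂μ =
      ∫ ω, ∑ a, Real.negMulLog (condPr (π (V ω)) f g a (g (Z ω))) ∂μ := by
    refine integral_congr_ae ?_
    filter_upwards [ae_all_iff.2 hcond] with ω hω
    exact Finset.sum_congr rfl fun a _ => by rw [← hω a]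
  rw [h1, integral_eq_integral_posterior hZ hV hπ hπ1 hpost'
    (φ := fun z v => ∑ a, Real.negMulLog (condPr (π v) f g a (g z))) (b := ∑ _a : α, 1) ?_ ?_]
  · refine integral_congr_ae (Filter.Eventually.of_forall fun ω => ?_)
    exact sum_negMulLog_condPr (fun z => (hπ1 (V ω) z).1) f g
  · exact fun z => Finset.measurable_sum _ fun a _ =>
      Real.continuous_negMulLog.measurable.comp (measurable_condPr hπ f g a (g z))
  · intro z v
    refine (Finset.abs_sum_le_sum_abs _ _).trans (Finset.sum_le_sum fun a _ => ?_)
    have h := condPr_mem (fun z => (hπ1 v z).1) f g a (g z)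
    rw [abs_of_nonneg (Real.negMulLog_nonneg h.1 h.2)]
    exact (Real.negMulLog_le_one_sub_self h.1).trans (by linarith [h.1])

end CondEntropy

/-! ### The single-letter random variables of a configuration -/

section RealRealization

variable {L K : ℕ} {𝒳 : Fin L → Type*} [∀ l, Fintype (𝒳 l)] {𝒴 : Fin K → Type*}
  [∀ k, Fintype (𝒴 k)]

/-- Random variables `W` of law `ν` and `U_k = f k W Y_k` realize a configuration when the posterior
`dec A` of the letters given `U_A` has the joint law that the table prescribes. -/
structure IsRealization (ch : (∀ l, 𝒳 l) → (∀ k, 𝒴 k) → ℝ) (c : Config 𝒳 𝒴) {W : Type}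
    [MeasurableSpace W] {U : Fin K → Type} [∀ k, MeasurableSpace (U k)] (ν : Measure W)
    (f : ∀ k, W → 𝒴 k → U k)
    (dec : ∀ A : Finset (Fin K), (∀ k : A, U k) → Letters 𝒳 𝒴 → ℝ) : Prop where
  isProbabilityMeasure : IsProbabilityMeasure ν
  measurable_f : ∀ k y, Measurable fun w => f k w y
  measurable_dec : ∀ A z, Measurable fun u => dec A u z
  dec_mem : ∀ A u z, dec A u z ∈ unitInterval
  /-- `dec A` is the posterior of the letters given `U_A` -/
  posterior : ∀ (A : Finset (Fin K)) (z : Letters 𝒳 𝒴) (h : (∀ k : A, U k) → ℝ), Measurable h →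
    (∃ b : ℝ, ∀ u, |h u| ≤ b) →
    letterProb ch c.1 z * ∫ w, h (fun k => f k w (z.2 k)) ∂ν =
      ∑ z' : Letters 𝒳 𝒴, letterProb ch c.1 z' *
        ∫ w, dec A (fun k => f k w (z'.2 k)) z * h (fun k => f k w (z'.2 k)) ∂ν
  dec_empty : ∀ u, dec ∅ u = letterProb ch c.1
  /-- the posteriors are distributed like the entries of the table -/
  integral_dec : ∀ A : Finset (Fin K), A.Nonempty → ∀ (y : ∀ k, 𝒴 k) (G : (Letters 𝒳 𝒴 → ℝ) → ℝ),
    Continuous G → ∫ w, G (dec A fun k => f k w (y k)) ∂ν =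
      ∫ T, G (fun z => (T (restr A y) z : ℝ)) ∂(c.2 : Measure (Table 𝒳 𝒴))

theorem letterProb_le_one {ch : (∀ l, 𝒳 l) → (∀ k, 𝒴 k) → ℝ}
    (hch : ∀ x, ch x ∈ stdSimplex ℝ (∀ k, 𝒴 k)) {P : ∀ l, 𝒳 l → ℝ}
    (hP : ∀ l, P l ∈ stdSimplex ℝ (𝒳 l)) (z : Letters 𝒳 𝒴) : letterProb ch P z ≤ 1 :=
  (Finset.single_le_sum (fun z _ => letterProb_nonneg hch hP z) (Finset.mem_univ z)).trans_eq
    (sum_letterProb hch hP)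

variable [∀ k, MeasurableSpace (𝒴 k)] [∀ k, MeasurableSingletonClass (𝒴 k)]

/-- Every consistent configuration is realized by the messages of the relays, encoded as real
numbers. -/
theorem exists_isRealization {ch : (∀ l, 𝒳 l) → (∀ k, 𝒴 k) → ℝ}
    (hch : ∀ x, ch x ∈ stdSimplex ℝ (∀ k, 𝒴 k)) {c : Config 𝒳 𝒴}
    (hc : c ∈ consistentConfigs ch) : ∃ (ν : Measure ℝ) (f : ∀ k, ℝ → 𝒴 k → ℝ)
      (dec : ∀ A : Finset (Fin K), (A → ℝ) → Letters 𝒳 𝒴 → ℝ), IsRealization ch c ν f dec := by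
  classical
  have x₀ : ∀ l, 𝒳 l := fun l => (nonempty_of_mem_stdSimplex (hc.1 l)).some
  obtain ⟨y₀⟩ := nonempty_of_mem_stdSimplex (hch x₀)
  have hne : ∀ k, Nonempty (𝒴 k) := fun k => ⟨y₀ k⟩
  have hY : ∀ k, StandardBorelSpace (𝒴 k) := fun k => inferInstance
  have hE : StandardBorelSpace (Entries 𝒳 𝒴) := inferInstance
  have hE2 : ∀ k, StandardBorelSpace (𝒴 k × Entries 𝒳 𝒴) := fun k => inferInstance
  have he := measurableEmbedding_embeddingReal (Secret 𝒳 𝒴)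
  have he' := fun k : Fin K => measurableEmbedding_embeddingReal (Entries 𝒳 𝒴 × 𝒴 k × Entries 𝒳 𝒴)
  set Λ : Measure (Table 𝒳 𝒴) := (c.2 : Measure (Table 𝒳 𝒴)) with hΛ
  let f : ∀ k, ℝ → 𝒴 k → ℝ := fun k r y =>
    embeddingReal (Entries 𝒳 𝒴 × 𝒴 k × Entries 𝒳 𝒴) (message k (he.invFun r) y)
  let read : ∀ A : Finset (Fin K), (A → ℝ) → ∀ k : A, Entries 𝒳 𝒴 × 𝒴 k × Entries 𝒳 𝒴 :=
    fun A u k => (he' k).invFun (u k)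
  let send : ∀ A : Finset (Fin K), (∀ k : A, Entries 𝒳 𝒴 × 𝒴 k × Entries 𝒳 𝒴) → A → ℝ :=
    fun A m k => embeddingReal _ (m k)
  have hsend : ∀ A, Measurable (send A) := fun A => measurable_pi_iff.2 fun k =>
    (he' k).measurable.comp (measurable_pi_apply k)
  have hread : ∀ A, Measurable (read A) := fun A => measurable_pi_iff.2 fun k =>
    (he' k).measurable_invFun.comp (measurable_pi_apply k)
  have hread_send : ∀ A m, read A (send A m) = m := fun A m => funext fun k =>
    (he' k).leftInverse_invFun (m k)
  have hf : ∀ (A : Finset (Fin K)) (w : Secret 𝒳 𝒴) (y : ∀ k, 𝒴 k),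
      (fun k : A => f k (embeddingReal _ w) (y k)) = send A (messages A w y) := by
    intro A w y
    funext k
    simp only [f, send, messages, he.leftInverse_invFun w]
  have hint : ∀ Ψ : ℝ → ℝ, ∫ r, Ψ r ∂((secretLaw Λ).map (embeddingReal (Secret 𝒳 𝒴))) =
      ∫ w, Ψ (embeddingReal _ w) ∂(secretLaw Λ) := fun Ψ => he.integral_map Ψ
  refine ⟨(secretLaw Λ).map (embeddingReal (Secret 𝒳 𝒴)), f, fun A u z =>
    if A = ∅ then letterProb ch c.1 z else decodeMessages A (read A u) z, ?_⟩
  refine ⟨Measure.isProbabilityMeasure_map he.measurable.aemeasurable, fun k y => ?_,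
    fun A z => ?_, fun A u z => ?_, fun A z h hh ⟨b, hb⟩ => ?_, fun u => ?_, fun A hA y G hG => ?_⟩
  · exact (he' k).measurable.comp ((measurable_message k y).comp he.measurable_invFun)
  · split_ifs
    · exact measurable_const
    · exact (measurable_decodeMessages A z).comp (hread A)
  · split_ifs
    · exact ⟨letterProb_nonneg hch hc.1 z, letterProb_le_one hch hc.1 z⟩
    · exact decodeMessages_mem A _ z
  · simp only [hint, hf, hread_send]
    rcases A.eq_empty_or_nonempty with rfl | hA
    · have hu : ∀ u : (∅ : Finset (Fin K)) → ℝ, h u = h 0 := fun u => by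
        congr 1
        funext k
        exact absurd k.2 (Finset.notMem_empty _)
      simp only [if_true, hu, integral_const, probReal_univ, one_smul, ← Finset.sum_mul,
        sum_letterProb hch hc.1, one_mul]
    · simp only [if_neg hA.ne_empty]
      exact messages_posterior hch hc hA z (hh.comp (hsend A)) fun u => hb _
  · funext z
    simp
  · simp only [hint, hf, hread_send, if_neg hA.ne_empty, decodeMessages_messages hA]
    have hmap : (secretLaw Λ).map (fun w : Secret 𝒳 𝒴 => w.2.1) = Λ := by
      have : IsProbabilityMeasure
          (ProbabilityTheory.uniformOn Set.univ : Measure (Relabeling 𝒴)) :=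
        ProbabilityTheory.isProbabilityMeasure_uniformOn Set.finite_univ Set.univ_nonempty
      exact (measurePreserving_fst.comp measurePreserving_snd).map_eq
    have hGm : Continuous fun T : Table 𝒳 𝒴 => G fun z => (T (restr A y) z : ℝ) :=
      hG.comp (by fun_prop)
    conv_rhs => rw [← hΛ, ← hmap]
    rw [integral_map (by fun_prop) hGm.measurable.aestronglyMeasurable]

end RealRealization

section Assembly

variable {L K : ℕ} {𝒳 : Fin L → Type*} [∀ l, Fintype (𝒳 l)] [∀ l, MeasurableSpace (𝒳 l)]
  [∀ l, MeasurableSingletonClass (𝒳 l)] {𝒴 : Fin K → Type*} [∀ k, Fintype (𝒴 k)]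
  [∀ k, MeasurableSpace (𝒴 k)] [∀ k, MeasurableSingletonClass (𝒴 k)]
  {ch : (∀ l, 𝒳 l) → (∀ k, 𝒴 k) → ℝ}

namespace Aux

/-- The letters `(X, Y)`. -/
def letters (a : Aux 𝒳 𝒴) (ω : a.Ω) : Letters 𝒳 𝒴 := (ω.2.1, ω.2.2.1)

theorem measurable_letters (a : Aux 𝒳 𝒴) : Measurable a.letters :=
  (measurable_fst.comp measurable_snd).prodMk
    (measurable_fst.comp (measurable_snd.comp measurable_snd))

theorem measurable_Qvar (a : Aux 𝒳 𝒴) : Measurable a.Qvar := measurable_fst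

theorem measurable_Uvar (a : Aux 𝒳 𝒴) (A : Finset (Fin K)) : Measurable (a.Uvar A) := by
  refine measurable_pi_iff.2 fun k => measurable_from_prod_countable_right fun q =>
    measurable_from_prod_countable_right fun x => measurable_from_prod_countable_right fun y => ?_
  exact a.measurable_f k (y k) q

theorem prob_nonneg (a : Aux 𝒳 𝒴) (hch : ∀ x, ch x ∈ stdSimplex ℝ (∀ k, 𝒴 k)) (q : Fin a.nQ)
    (x : ∀ l, 𝒳 l) (y : ∀ k, 𝒴 k) : 0 ≤ a.pQ q * (∏ l, a.pX l q (x l)) * ch x y :=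
  mul_nonneg (mul_nonneg (a.pQ_mem.1 q) (Finset.prod_nonneg fun l _ => (a.pX_mem l q).1 _))
    ((hch x).1 y)

theorem measurable_sample (a : Aux 𝒳 𝒴) (q : Fin a.nQ) (x : ∀ l, 𝒳 l) (y : ∀ k, 𝒴 k) :
    Measurable fun w : a.W => ((q, x, y, w) : a.Ω) :=
  measurable_const.prodMk (measurable_const.prodMk (measurable_const.prodMk measurable_id))

theorem sum_prob (a : Aux 𝒳 𝒴) (hch : ∀ x, ch x ∈ stdSimplex ℝ (∀ k, 𝒴 k)) :
    ∑ q, ∑ x : (∀ l, 𝒳 l), ∑ y : (∀ k, 𝒴 k), a.pQ q * (∏ l, a.pX l q (x l)) * ch x y = 1 := by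
  classical
  have h1 : ∀ q, ∑ x : (∀ l, 𝒳 l), ∏ l, a.pX l q (x l) = 1 := fun q => by
    rw [← Fintype.prod_sum fun l x => a.pX l q x]
    exact Finset.prod_eq_one fun l _ => (a.pX_mem l q).2
  have h2 : ∀ (q : Fin a.nQ) (x : ∀ l, 𝒳 l), ∑ y : (∀ k, 𝒴 k),
      a.pQ q * (∏ l, a.pX l q (x l)) * ch x y = a.pQ q * ∏ l, a.pX l q (x l) := fun q x => by
    rw [← Finset.mul_sum, (hch x).2, mul_one]
  have h3 : ∀ q : Fin a.nQ, ∑ x : (∀ l, 𝒳 l), a.pQ q * ∏ l, a.pX l q (x l) = a.pQ q :=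
    fun q => by rw [← Finset.mul_sum, h1, mul_one]
  simp_rw [h2, h3]
  exact a.pQ_mem.2

theorem isProbabilityMeasure_law (a : Aux 𝒳 𝒴) (hch : ∀ x, ch x ∈ stdSimplex ℝ (∀ k, 𝒴 k)) :
    IsProbabilityMeasure (a.law ch) := by
  refine ⟨?_⟩
  have h1 : ∀ q x y, ((a.pW q).map fun w => ((q, x, y, w) : a.Ω)) Set.univ = 1 := fun q x y => by
    have := Measure.isProbabilityMeasure_map (μ := a.pW q)
      (a.measurable_sample q x y).aemeasurable
    exact measure_univ
  simp only [law, Measure.coe_finsetSum, Finset.sum_apply, Measure.smul_apply, h1, smul_eq_mul,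
    mul_one]
  rw [← ENNReal.ofReal_one, ← a.sum_prob hch, ENNReal.ofReal_sum_of_nonneg fun q _ =>
    Finset.sum_nonneg fun x _ => Finset.sum_nonneg fun y _ => a.prob_nonneg hch q x y]
  refine Finset.sum_congr rfl fun q _ => ?_
  rw [ENNReal.ofReal_sum_of_nonneg fun x _ =>
    Finset.sum_nonneg fun y _ => a.prob_nonneg hch q x y]
  refine Finset.sum_congr rfl fun x _ => ?_
  rw [ENNReal.ofReal_sum_of_nonneg fun y _ => a.prob_nonneg hch q x y]

/-- The expectation under the joint law as an average over `q` and the letters. -/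
theorem integral_law (a : Aux 𝒳 𝒴) (hch : ∀ x, ch x ∈ stdSimplex ℝ (∀ k, 𝒴 k)) {φ : a.Ω → ℝ}
    (hφ : Measurable φ) {b : ℝ} (hb : ∀ ω, |φ ω| ≤ b) :
    ∫ ω, φ ω ∂(a.law ch) = ∑ q, a.pQ q * ∑ z : Letters 𝒳 𝒴,
      letterProb ch (fun l => a.pX l q) z * ∫ w, φ (q, z.1, z.2, w) ∂(a.pW q) := by
  have h1 : ∀ q x y, Integrable φ ((a.pW q).map fun w => ((q, x, y, w) : a.Ω)) := fun q x y => by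
    have := Measure.isProbabilityMeasure_map (μ := a.pW q)
      (a.measurable_sample q x y).aemeasurable
    exact integrable_of_measurable_of_bound hφ hb
  have h2 : ∀ q x y, Integrable φ (ENNReal.ofReal (a.pQ q * (∏ l, a.pX l q (x l)) * ch x y) •
      (a.pW q).map fun w => ((q, x, y, w) : a.Ω)) := fun q x y =>
    (h1 q x y).smul_measure ENNReal.ofReal_ne_top
  unfold law
  rw [integral_finsetSum_measure fun q _ => integrable_finsetSum_measure.2 fun x _ =>
    integrable_finsetSum_measure.2 fun y _ => h2 q x y]
  refine Finset.sum_congr rfl fun q _ => ?_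
  rw [integral_finsetSum_measure fun x _ => integrable_finsetSum_measure.2 fun y _ => h2 q x y,
    Fintype.sum_prod_type, Finset.mul_sum]
  refine Finset.sum_congr rfl fun x _ => ?_
  rw [integral_finsetSum_measure fun y _ => h2 q x y, Finset.mul_sum]
  refine Finset.sum_congr rfl fun y _ => ?_
  rw [integral_smul_measure, integral_map (a.measurable_sample q x y).aemeasurable
    hφ.aestronglyMeasurable, ENNReal.toReal_ofReal (a.prob_nonneg hch q x y), smul_eq_mul]
  unfold letterProb
  ring

/-- For realizations `U` of configurations `c q`, the conditional entropies given `U_A` and `Q` are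
the averages of the coalition entropies. -/
theorem condEntropy_law {α β γ : Type*} [Fintype α] [Fintype β] [MeasurableSpace β]
    [MeasurableSingletonClass β] [MeasurableSpace γ] (a : Aux 𝒳 𝒴)
    (hch : ∀ x, ch x ∈ stdSimplex ℝ (∀ k, 𝒴 k)) {c : Fin a.nQ → Config 𝒳 𝒴}
    (hc : ∀ q, (c q).1 = fun l => a.pX l q)
    {dec : Fin a.nQ → ∀ A : Finset (Fin K), (∀ k : A, a.U k) → Letters 𝒳 𝒴 → ℝ}
    (hdec : ∀ q, IsRealization ch (c q) (a.pW q) (fun k w y => a.f k w y q) (dec q))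
    (A : Finset (Fin K)) (f : Letters 𝒳 𝒴 → α) (g : Letters 𝒳 𝒴 → β) {G : a.Ω → γ}
    (hG : MeasurableSpace.comap G inferInstance =
      MeasurableSpace.comap (fun ω => (g (a.letters ω), a.Uvar A ω, a.Qvar ω)) inferInstance) :
    condEntropy (a.law ch) (fun ω => f (a.letters ω)) G * Real.log 2 =
      ∑ q, a.pQ q * coalitionEntropy ch (c q) A f g := by
  classical
  have := a.isProbabilityMeasure_law hch
  let π : (∀ k : A, a.U k) × Fin a.nQ → Letters 𝒳 𝒴 → ℝ := fun v => dec v.2 A v.1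
  have hV : Measurable fun ω => (a.Uvar A ω, a.Qvar ω) :=
    (a.measurable_Uvar A).prodMk a.measurable_Qvar
  have hπ : ∀ z, Measurable fun v => π v z := fun z =>
    measurable_from_prod_countable_left fun q => (hdec q).measurable_dec A z
  have hπ1 : ∀ v z, π v z ∈ unitInterval := fun v z => (hdec v.2).dec_mem A v.1 z
  rw [condEntropy_eq_integral_posterior a.measurable_letters hV hπ hπ1 ?_ f g hG]
  · obtain ⟨b, hb⟩ := (isCompact_univ_pi fun _ : Letters 𝒳 𝒴 =>
      isCompact_Icc (a := (0 : ℝ)) (b := 1)).exists_bound_of_continuousOn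
        (continuous_cent f g).continuousOn
    rw [a.integral_law hch (φ := fun ω => cent (π (a.Uvar A ω, a.Qvar ω)) f g)
      (((continuous_cent f g).measurable.comp (measurable_pi_iff.2 hπ)).comp hV)
      (b := b) fun ω => hb _ fun z _ => hπ1 _ z]
    refine Finset.sum_congr rfl fun q _ => ?_
    congr 1
    unfold coalitionEntropy
    rw [← hc q]
    split_ifs with hA
    · subst hA
      have hsum : ∑ z : Letters 𝒳 𝒴, letterProb ch (c q).1 z = 1 :=
        sum_letterProb hch fun l => by rw [hc q]; exact a.pX_mem l q
      have : ∀ u, π (u, q) = letterProb ch (c q).1 := fun u => (hdec q).dec_empty u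
      simp only [Qvar, this, integral_const, probReal_univ, one_smul,
        ← Finset.sum_mul, hsum, one_mul]
    · refine Finset.sum_congr rfl fun z _ => ?_
      congr 1
      exact (hdec q).integral_dec A (Finset.nonempty_iff_ne_empty.2 hA) z.2 _ (continuous_cent f g)
  · rintro z h hh ⟨b, hb⟩
    have hhV := hh.comp hV
    rw [a.integral_law hch (φ := Set.indicator {ω | a.letters ω = z}
        fun ω => h (a.Uvar A ω, a.Qvar ω)) (hhV.indicator (a.measurable_letters (measurableSet_singleton z)))
        (b := b) fun ω => ?_,
      a.integral_law hch (φ := fun ω => π (a.Uvar A ω, a.Qvar ω) z * h (a.Uvar A ω, a.Qvar ω))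
        (((hπ z).comp hV).mul hhV) (b := b) fun ω => ?_]
    · refine Finset.sum_congr rfl fun q _ => ?_
      congr 1
      rw [← hc q]
      refine Eq.trans ?_ ((hdec q).posterior A z (fun u => h (u, q)) (hh.comp measurable_prodMk_right)
        ⟨b, fun u => hb _⟩)
      rw [Finset.sum_eq_single z]
      · congr 1
        refine integral_congr_ae (Filter.Eventually.of_forall fun w => ?_)
        simp [letters, Qvar]
        rfl
      · intro z' _ hz'
        simp [letters, hz']
      · exact fun hz => absurd (Finset.mem_univ z) hz
    · rw [abs_mul, abs_of_nonneg (hπ1 _ _).1]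
      exact (mul_le_of_le_one_left (abs_nonneg _) (hπ1 _ _).2).trans (hb _)
    · simp only [Set.indicator_apply]
      split_ifs
      · exact hb _
      · rw [abs_zero]
        exact (abs_nonneg _).trans (hb (a.Uvar A ω, a.Qvar ω))

theorem comap_eq_comap {Ω γ γ' : Type*} [MeasurableSpace γ] [MeasurableSpace γ'] {G : Ω → γ}
    {G' : Ω → γ'} (φ : γ' → γ) (hφ : Measurable φ) (ψ : γ → γ') (hψ : Measurable ψ)
    (h : ∀ ω, G ω = φ (G' ω)) (h' : ∀ ω, G' ω = ψ (G ω)) :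
    MeasurableSpace.comap G inferInstance = MeasurableSpace.comap G' inferInstance := by
  refine le_antisymm ?_ ?_
  · rw [show G = φ ∘ G' from funext h, ← MeasurableSpace.comap_comp]
    exact MeasurableSpace.comap_mono hφ.comap_le
  · rw [show G' = ψ ∘ G from funext h', ← MeasurableSpace.comap_comp]
    exact MeasurableSpace.comap_mono hψ.comap_le

/-- The single-letter bound of the realized random variables, in nats, is the average of the bounds
of the configurations. -/
theorem condMutualInfo_law (a : Aux 𝒳 𝒴) (hch : ∀ x, ch x ∈ stdSimplex ℝ (∀ k, 𝒴 k))
    {c : Fin a.nQ → Config 𝒳 𝒴} (hc : ∀ q, (c q).1 = fun l => a.pX l q)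
    {dec : Fin a.nQ → ∀ A : Finset (Fin K), (∀ k : A, a.U k) → Letters 𝒳 𝒴 → ℝ}
    (hdec : ∀ q, IsRealization ch (c q) (a.pW q) (fun k w y => a.f k w y q) (dec q))
    (T : Finset (Fin L)) (S : Finset (Fin K)) :
    (-condMutualInfo (a.law ch) (a.Yvar S) (a.Uvar S)
          (fun ω => (a.Xvar Finset.univ ω, a.Uvar Sᶜ ω, a.Qvar ω)) +
        condMutualInfo (a.law ch) (a.Xvar T) (a.Uvar Sᶜ)
          (fun ω => (a.Xvar Tᶜ ω, a.Qvar ω))) * Real.log 2 =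
      ∑ q, a.pQ q * boundVector ch (c q) (T, S) := by
  classical
  have h1 := a.condEntropy_law hch hc hdec Sᶜ (outputs S) Prod.fst
    (G := fun ω => (a.Xvar Finset.univ ω, a.Uvar Sᶜ ω, a.Qvar ω))
    (comap_eq_comap (fun v => (fun l => v.1 l, v.2)) (by fun_prop)
      (fun v => (fun l => v.1 ⟨l, Finset.mem_univ l⟩, v.2)) (by fun_prop)
      (fun _ => rfl) (fun _ => rfl))
  have h2 := a.condEntropy_law hch hc hdec Finset.univ (outputs S) Prod.fst
    (G := fun ω => (a.Uvar S ω, a.Xvar Finset.univ ω, a.Uvar Sᶜ ω, a.Qvar ω))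
    (comap_eq_comap (fun v => (fun k => v.2.1 ⟨k, Finset.mem_univ _⟩, fun l => v.1 l,
        fun k => v.2.1 ⟨k, Finset.mem_univ _⟩, v.2.2)) (by fun_prop)
      (fun v => (fun l => v.2.1 ⟨l, Finset.mem_univ l⟩,
        fun k => if h : k.1 ∈ S then v.1 ⟨k, h⟩ else v.2.2.1 ⟨k, Finset.mem_compl.2 h⟩, v.2.2.2))
      (by
        refine Measurable.prodMk (by fun_prop) (Measurable.prodMk ?_ (by fun_prop))
        refine measurable_pi_iff.2 fun k => ?_
        split_ifs <;> fun_prop)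
      (fun _ => rfl) (fun ω => by
        refine Prod.ext rfl (Prod.ext (funext fun k => ?_) rfl)
        simp only
        split_ifs <;> rfl))
  have h3 := a.condEntropy_law hch hc hdec ∅ (inputs T) (inputs Tᶜ)
    (G := fun ω => (a.Xvar Tᶜ ω, a.Qvar ω))
    (comap_eq_comap (fun v => (v.1, v.2.2)) (by fun_prop)
      (fun v => (v.1, fun k => absurd k.2 (Finset.notMem_empty _), v.2))
      (by
        refine Measurable.prodMk (by fun_prop) (Measurable.prodMk ?_ (by fun_prop))
        exact measurable_pi_iff.2 fun k => absurd k.2 (Finset.notMem_empty _))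
      (fun _ => rfl) (fun ω => by
        refine Prod.ext rfl (Prod.ext (funext fun k => ?_) rfl)
        exact absurd k.2 (Finset.notMem_empty _)))
  have h4 := a.condEntropy_law hch hc hdec Sᶜ (inputs T) (inputs Tᶜ)
    (G := fun ω => (a.Uvar Sᶜ ω, a.Xvar Tᶜ ω, a.Qvar ω))
    (comap_eq_comap (fun v => (v.2.1, v.1, v.2.2)) (by fun_prop)
      (fun v => (v.2.1, v.1, v.2.2)) (by fun_prop) (fun _ => rfl) (fun _ => rfl))
  have hY : a.Yvar S = fun ω => outputs S (a.letters ω) := rfl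
  have hX : a.Xvar T = fun ω => inputs T (a.letters ω) := rfl
  unfold condMutualInfo boundVector
  rw [← hY] at h1 h2
  rw [← hX] at h3 h4
  rw [add_mul, neg_mul, sub_mul, sub_mul, h1, h2, h3, h4]
  simp only [mul_add, mul_neg, mul_sub, Finset.sum_add_distrib, Finset.sum_sub_distrib,
    Finset.sum_neg_distrib]

end Aux

end Assembly

end CRAN

end

theorem theorem4 {L K : ℕ}
    {𝒳 : Fin L → Type*} [∀ l, Fintype (𝒳 l)] [∀ l, MeasurableSpace (𝒳 l)]
    [∀ l, MeasurableSingletonClass (𝒳 l)]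
    {𝒴 : Fin K → Type*} [∀ k, Fintype (𝒴 k)] [∀ k, MeasurableSpace (𝒴 k)]
    [∀ k, MeasurableSingletonClass (𝒴 k)]
    (ch : (∀ l, 𝒳 l) → (∀ k, 𝒴 k) → ℝ)
    (hch : ∀ x, ch x ∈ stdSimplex ℝ (∀ k, 𝒴 k))
    (C : Fin K → ℝ) (R : Fin L → ℝ) (hR : CRAN.Achievable ch C R) :
    ∃ a : CRAN.Aux 𝒳 𝒴, ∀ (T : Finset (Fin L)) (S : Finset (Fin K)),
      ∑ t ∈ T, R t ≤
        (∑ s ∈ S, C s)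
          - CRAN.condMutualInfo (a.law ch) (a.Yvar S) (a.Uvar S)
              (fun ω => (a.Xvar Finset.univ ω, a.Uvar Sᶜ ω, a.Qvar ω))
          + CRAN.condMutualInfo (a.law ch) (a.Xvar T) (a.Uvar Sᶜ)
              (fun ω => (a.Xvar Tᶜ ω, a.Qvar ω)) := by
  obtain ⟨v, hv, hle⟩ := CRAN.exists_mem_convexHull_ge ch
    (fun TS => (∑ t ∈ TS.1, R t - ∑ s ∈ TS.2, C s) * Real.log 2)
    fun δ hδ => CRAN.exists_average_of_achievable hch hR hδ
  obtain ⟨ι, _, w, z, hw0, hw1, hz, rfl⟩ := mem_convexHull_iff_exists_fintype.1 hv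
  let e : Fin (Fintype.card ι) ≃ ι := (Fintype.equivFin ι).symm
  choose c hc hcz using hz
  choose ν f dec hreal using fun i => CRAN.exists_isRealization hch (hc i)
  let a : CRAN.Aux 𝒳 𝒴 :=
    { nQ := Fintype.card ι
      pQ := fun q => w (e q)
      pQ_mem := ⟨fun q => hw0 _, by rw [Equiv.sum_comp e w, hw1]⟩
      pX := fun l q => (c (e q)).1 l
      pX_mem := fun l q => (hc (e q)).1 l
      W := ℝ
      pW := fun q => ν (e q)
      probW := fun q => (hreal (e q)).isProbabilityMeasure
      U := fun _ => ℝ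
      f := fun k w y q => f (e q) k w y
      measurable_f := fun k y q => (hreal (e q)).measurable_f k y }
  refine ⟨a, fun T S => ?_⟩
  have h1 := a.condMutualInfo_law hch (c := fun q => c (e q)) (fun _ => rfl)
    (dec := fun q => dec (e q)) (fun q => hreal (e q)) T S
  have h2 : ∑ q, a.pQ q * CRAN.boundVector ch (c (e q)) (T, S) =
      (∑ i, w i • z i) (T, S) := by
    rw [Finset.sum_apply]
    simp only [Pi.smul_apply, smul_eq_mul, ← hcz]
    exact Equiv.sum_comp e fun i => w i * CRAN.boundVector ch (c i) (T, S)
  have h3 := hle (T, S)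
  rw [← h2, ← h1] at h3
  have := le_of_mul_le_mul_right h3 (Real.log_pos one_lt_two)
  linarith
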